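/- **Setting.** Let $m,n\ge 1$, let $D_1,D_2$ be diagonal matrices of sizes $m,n$ with positive diagonal entries, and let $U\subset\mathbb R^m$, $V\subset\mathbb R^n$, $I\subset\mathbb R$ be open and connected with $0\in V$, $0\in I$. (S1) $H_1:U\times V\times I\to\mathbb R^m$, $G:U\times V\times I\to\mathbb R^n$ and $H_2:U\times V\to\mathbb R^m$ are $C^2$, and $H_2(u,0)=0$, $G(u,0,\epsilon)=0$ for $u\in U$, $\epsilon\in I$. (S2) For each $u\in U$ the real part $\frac12(\mathcal G+\mathcal G^*)$ of $\mathcal G=\partial_vG(u,0,0)$ is positive definite. (S3) For all sufficiently small $\epsilon>0$ there is a $2L_\epsilon$-periodic solution $\phi_{p,\epsilon}=(u_{p,\epsilon},p_{p,\epsilon},v_{p,\epsilon},q_{p,\epsilon}):\mathbb R\to U\times\mathbb R^m\times V\times\mathbb R^n$ of $$D_1u'=\epsilon p,\quad p'=\epsilon H_1(u,v,\epsilon)+H_2(u,v),\quad D_2v'=q,\quad q'=G(u,v,\epsilon),$$ such that: (1) $\epsilon L_\epsilon\to\check L_0>0$ as $\epsilon\downarrow0$; (2) there are $u_0\in U$,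 $p_0\in\mathbb R^m$ and a nontrivial solution $(v_h,q_h)$ of $D_2v'=q$, $q'=G(u_0,v,0)$ in $V\times\mathbb R^n$, homoclinic to $(0,0)$, with $\|\phi_{p,\epsilon}(0)-(u_0,p_0,v_h(0),q_h(0))\|=O(\epsilon)$; (3) with $\mathcal M=\{(u,p,0,0):u\in U,\ p\in\mathbb R^m\}$, there are $L_s,\beta_s>0$ and a solution $(u_s,p_s)$ of $D_1u'=p$, $p'=H_1(u,0,0)$, $u\in U$, on an open interval containing $[0,2\check L_0]$, such that for all small $\epsilon>0$ and all $x\in[0,2L_\epsilon]$ $$d(\phi_{p,\epsilon}(x),\mathcal M)\le L_se^{-\beta_s\min\{x,2L_\epsilon-x\}},\qquad \|\phi_{p,\epsilon}(x)-(u_s(\epsilon x),p_s(\epsilon x),0,0)\|\le L_s\max\{\epsilon,e^{-\beta_s\min\{x,2L_\epsilon-x\}}\}.$$ **Linear stability problem.** With the derivatives of $H_1,H_2,G$ evaluated along $(u_{p,\epsilon}(x),v_{p,\epsilon}(x))$, put $$\mathcal A_{11,\epsilon}=\begin{pmatrix}0&D_1^{-1}\\ \epsilon(\partial_uH_1+\lambda)+\partial_uH_2&0\end{pmatrix},\quad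 \mathcal A_{12,\epsilon}=\begin{pmatrix}0&0\\ \epsilon\partial_vH_1+\partial_vH_2&0\end{pmatrix},\quad \mathcal A_{21,\epsilon}=\begin{pmatrix}0&0\\ \partial_uG&0\end{pmatrix},\quad \mathcal A_{22,\epsilon}=\begin{pmatrix}0&D_2^{-1}\\ \partial_vG+\lambda&0\end{pmatrix}.$$ For a linear system $\phi'=A(x)\phi$ with evolution operator $T(x,y)$ call $\det(T(0,-L_\epsilon)-\gamma T(0,L_\epsilon))$ its Floquet determinant. The Evans function $\mathcal E_\epsilon(\lambda,\gamma)$ is the Floquet determinant of the system with coefficient matrix $$\begin{pmatrix}\sqrt\epsilon\,\mathcal A_{11,\epsilon}&\sqrt\epsilon\,\mathcal A_{12,\epsilon}\\ \mathcal A_{21,\epsilon}&\mathcal A_{22,\epsilon}\end{pmatrix}.$$ Let $\mathcal A_{22,0}(x,\lambda)$ and $\mathcal A_{21,0}(x)$ be $\mathcal A_{22,\epsilon}$ and $\mathcal A_{21,\epsilon}$ with $(u_{p,\epsilon},v_{p,\epsilon},\epsilon)$ replaced by $(u_0,v_h,0)$. **Constants and regions.** (a) Let $\mathcal K_U\subset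 U$ be a compact set with $u_0\in\mathcal K_U$ that contains $u_{p,\epsilon}(x)$ for all $x\in\mathbb R$ and all small $\epsilon>0$. (b) Let $\Lambda_0>0$ be such that for each $\Lambda\in(-\Lambda_0,0)$ the spectrum of $\begin{pmatrix}0&D_2^{-1}\\ \partial_vG(u,0,0)+\lambda&0\end{pmatrix}$ is bounded away from the imaginary axis uniformly in $u\in\mathcal K_U$ and $\operatorname{Re}\lambda>\Lambda$. (c) Let $\beta_f\in(0,\frac14]$ and $\rho>0$ be such that, with $I_\epsilon=[-\epsilon^{-\rho},\epsilon^{-\rho}]$ and $\phi_h(x)=(u_0,\,p_0+\int_0^xH_2(u_0,v_h(z))\,dz,\,v_h(x),\,q_h(x))$, one has $\|\phi_{p,\epsilon}(x)-\phi_h(x)\|=O(\epsilon^{\beta_f})$ uniformly for $x\in I_\epsilon$. For $\Lambda\in(-\Lambda_0,0)$ and $\operatorname{Re}\lambda\ge\Lambda$ let $\mathcal E_{f,0}(\lambda)=\det(B_+,B_-)$, where the columns of $B_+$ and $B_-$ form bases of $\operatorname{ran}P_+(0)$ and $\ker P_-(0)$, and $P_\pm$ are the projections of exponential dichotomies of $\phi'=\mathcal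 A_{22,0}(x,\lambda)\phi$ on $[0,\infty)$ and $(-\infty,0]$; whether it vanishes does not depend on these choices. For $\omega>0$, $\varpi\in(\pi/2,\pi)$ and $\delta>0$ let $$\Sigma_{\Lambda,0}=\{\lambda:\Lambda<\operatorname{Re}\lambda<\omega,\ |\arg(\lambda-\omega)|>\varpi\},\qquad \Sigma_{\Lambda,\delta}=\Sigma_{\Lambda,0}\setminus\bigcup\{B(z,\delta):\operatorname{Re}z\ge\Lambda,\ \mathcal E_{f,0}(z)=0\}.$$ **Theorem.** Assume (S1)–(S3). Sets $\mathcal K_U$ as in (a) exist, for each of them numbers $\Lambda_0$ as in (b) exist, and exponents $\beta_f,\rho$ as in (c) exist. For every such choice and all $\Lambda\in(-\Lambda_0,0)$, $\delta>0$, $\omega>0$, $\varpi\in(\pi/2,\pi)$ the following holds. For every $\lambda\in\Sigma_{\Lambda,\delta}$ the inhomogeneous fast limit problem $\mathcal X'=\mathcal A_{22,0}(x,\lambda)\mathcal X+\mathcal A_{21,0}(x)$, $\mathcal X\in\mathrm{Mat}_{2n\times2m}(\mathbb C)$, has a unique bounded solution $\mathcal X_{in}(\cdot,\lambda)$ on $\mathbb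 R$, and it is exponentially localized. There are $\epsilon_0>0$ and, for $\epsilon\in(0,\epsilon_0)$, functions $U_\epsilon:\mathbb R\times\Sigma_{\Lambda,\delta}\to\mathrm{Mat}_{2n\times2m}(\mathbb C)$ that solve the Riccati equation $$\partial_xU=\mathcal A_{22,\epsilon}U-\sqrt\epsilon\,U\mathcal A_{11,\epsilon}-\sqrt\epsilon\,U\mathcal A_{12,\epsilon}U+\mathcal A_{21,\epsilon},$$ such that for all $\epsilon\in(0,\epsilon_0)$, $\lambda\in\Sigma_{\Lambda,\delta}$ and $\gamma\in\mathbb C$ $$\mathcal E_\epsilon(\lambda,\gamma)=\mathcal E_{s,\epsilon}(\lambda,\gamma)\,\mathcal E_{f,\epsilon}(\lambda,\gamma),$$ where $\mathcal E_{s,\epsilon}$ and $\mathcal E_{f,\epsilon}$ are the Floquet determinants of $\chi'=\sqrt\epsilon(\mathcal A_{11,\epsilon}+\mathcal A_{12,\epsilon}U_\epsilon)\chi$ and $\omega'=(\mathcal A_{22,\epsilon}-\sqrt\epsilon\,U_\epsilon\mathcal A_{12,\epsilon})\omega$. Moreover: 1. $U_\epsilon(x,\lambda)$ is bounded uniformly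 in $x\in\mathbb R$, $\lambda\in\Sigma_{\Lambda,\delta}$ and $\epsilon\in(0,\epsilon_0)$; 2. $U_\epsilon(\cdot,\lambda)$ is $2L_\epsilon$-periodic for each $\lambda\in\Sigma_{\Lambda,\delta}$; 3. $\|U_\epsilon(x,\lambda)-\mathcal X_{in}(x,\lambda)\|=O(\epsilon^{\beta_f})$ uniformly in $x\in[-L_\epsilon,L_\epsilon]$ and $\lambda\in\Sigma_{\Lambda,\delta}$; 4. $\|U_\epsilon(x,\lambda)\|=O(\epsilon^3)$ uniformly in $x\in[-L_\epsilon,L_\epsilon]\setminus I_\epsilon$ and $\lambda\in\Sigma_{\Lambda,\delta}$. -/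

import Mathlib

open Set Filter Topology

attribute [local instance] Matrix.linftyOpNormedAddCommGroup Matrix.linftyOpNormedSpace

namespace EvansRiccati

noncomputable section

/-! ### Linear systems, evolution operators, exponential dichotomies -/

/-- `T x y` is the evolution of `∂ₓ φ = A(x) φ`: the matrix solution that equals `1` at `x = y`. -/
def IsEvolution {ι : Type*} [Fintype ι] [DecidableEq ι]
    (A : ℝ → Matrix ι ι ℂ) (T : ℝ → ℝ → Matrix ι ι ℂ) : Prop :=
  ∀ y, T y y = 1 ∧ ∀ x, HasDerivAt (fun s => T s y) (A x * T x y) x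

/-- The evolution operator of `∂ₓ φ = A(x) φ` (it exists and is unique for continuous `A`). -/
def evolution {ι : Type*} [Fintype ι] [DecidableEq ι]
    (A : ℝ → Matrix ι ι ℂ) : ℝ → ℝ → Matrix ι ι ℂ :=
  Classical.epsilon (IsEvolution A)

/-- The Floquet determinant `det (T(0,-L) - γ T(0,L))` of `∂ₓ φ = A(x) φ`. -/
def floquetDet {ι : Type*} [Fintype ι] [DecidableEq ι]
    (A : ℝ → Matrix ι ι ℂ) (L : ℝ) (γ : ℂ) : ℂ :=
  (evolution A 0 (-L) - γ • evolution A 0 L).det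

/-- `∂ₓ φ = A(x) φ` has an exponential dichotomy on `J` with constants `K, μ` and
projections `P(x)`, `x ∈ J`. -/
structure HasExpDichotomy {ι : Type*} [Fintype ι] [DecidableEq ι]
    (A : ℝ → Matrix ι ι ℂ) (J : Set ℝ) (K μ : ℝ) (P : ℝ → Matrix ι ι ℂ) : Prop where
  K_pos : 0 < K
  μ_pos : 0 < μ
  proj : ∀ x ∈ J, P x * P x = P x
  comm : ∀ x ∈ J, ∀ y ∈ J, P x * evolution A x y = evolution A x y * P y
  stable : ∀ x ∈ J, ∀ y ∈ J, y ≤ x →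
    ‖evolution A x y * P y‖ ≤ K * Real.exp (-μ * (x - y))
  unstable : ∀ x ∈ J, ∀ y ∈ J, x ≤ y →
    ‖evolution A x y * (1 - P y)‖ ≤ K * Real.exp (-μ * (y - x))

/-- The Jacobian matrix of `f` at `x`. -/
def jac {a b : ℕ} (f : (Fin a → ℝ) → (Fin b → ℝ)) (x : Fin a → ℝ) : Matrix (Fin b) (Fin a) ℝ :=
  LinearMap.toMatrix' (fderiv ℝ f x : (Fin a → ℝ) →ₗ[ℝ] (Fin b → ℝ))

/-- A real matrix regarded as a complex one. -/
def cx {a b : ℕ} (M : Matrix (Fin a) (Fin b) ℝ) : Matrix (Fin a) (Fin b) ℂ :=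
  M.map (fun r => (r : ℂ))

/-! ### The reaction-diffusion system -/

/-- The data of the system
`ε² ∂ₜ u = D₁ uₓₓ - ε² H₁(u,v,ε) - ε H₂(u,v)`, `∂ₜ v = D₂ vₓₓ - G(u,v,ε)`, with
`D₁ = diag d₁`, `D₂ = diag d₂` positive, and the domains `U, V, I` of `u, v, ε`. -/
structure RDSystem (m n : ℕ) where
  d₁ : Fin m → ℝ
  d₂ : Fin n → ℝ
  d₁_pos : ∀ i, 0 < d₁ i
  d₂_pos : ∀ i, 0 < d₂ i
  U : Set (Fin m → ℝ)
  V : Set (Fin n → ℝ)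
  I : Set ℝ
  H₁ : (Fin m → ℝ) → (Fin n → ℝ) → ℝ → (Fin m → ℝ)
  H₂ : (Fin m → ℝ) → (Fin n → ℝ) → (Fin m → ℝ)
  G : (Fin m → ℝ) → (Fin n → ℝ) → ℝ → (Fin n → ℝ)

/-- The phase space of `(u,p,v,q)`. -/
abbrev Phase (m n : ℕ) : Type :=
  (Fin m → ℝ) × (Fin m → ℝ) × (Fin n → ℝ) × (Fin n → ℝ)

namespace RDSystem

variable {m n : ℕ}

/-- `D₁⁻¹`. -/
def D₁inv (S : RDSystem m n) : Matrix (Fin m) (Fin m) ℝ := Matrix.diagonal fun i => (S.d₁ i)⁻¹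

/-- `D₂⁻¹`. -/
def D₂inv (S : RDSystem m n) : Matrix (Fin n) (Fin n) ℝ := Matrix.diagonal fun i => (S.d₂ i)⁻¹

/-- Conditions on the interaction terms. -/
structure S1 (S : RDSystem m n) : Prop where
  U_open : IsOpen S.U
  V_open : IsOpen S.V
  I_open : IsOpen S.I
  U_conn : IsConnected S.U
  V_conn : IsConnected S.V
  I_conn : IsConnected S.I
  zero_mem_V : (0 : Fin n → ℝ) ∈ S.V
  zero_mem_I : (0 : ℝ) ∈ S.I
  H₁_C2 : ContDiffOn ℝ 2 (fun z : (Fin m → ℝ) × (Fin n → ℝ) × ℝ => S.H₁ z.1 z.2.1 z.2.2)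
    (S.U ×ˢ S.V ×ˢ S.I)
  G_C2 : ContDiffOn ℝ 2 (fun z : (Fin m → ℝ) × (Fin n → ℝ) × ℝ => S.G z.1 z.2.1 z.2.2)
    (S.U ×ˢ S.V ×ˢ S.I)
  H₂_C2 : ContDiffOn ℝ 2 (fun z : (Fin m → ℝ) × (Fin n → ℝ) => S.H₂ z.1 z.2) (S.U ×ˢ S.V)
  H₂_zero : ∀ u ∈ S.U, S.H₂ u 0 = 0
  G_zero : ∀ u ∈ S.U, ∀ ε ∈ S.I, S.G u 0 ε = 0

/-- Normal hyperbolicity: the real part of `∂ᵥG(u,0,0)` is positive definite. -/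
def S2 (S : RDSystem m n) : Prop :=
  ∀ u ∈ S.U, ((1 / 2 : ℝ) • (jac (fun v => S.G u v 0) 0 +
    (jac (fun v => S.G u v 0) 0).conjTranspose)).PosDef

/-- The invariant manifold `ℳ = {(u,p,0,0) : u ∈ U}`. -/
def slowManifold (S : RDSystem m n) : Set (Phase m n) :=
  {z | z.1 ∈ S.U ∧ z.2.2.1 = 0 ∧ z.2.2.2 = 0}

/-- The matrix `A(u,λ)` with blocks `0, D₂⁻¹, ∂ᵥG(u,0,0) + λ, 0`. -/
def asympMatrix (S : RDSystem m n) (u : Fin m → ℝ) (lam : ℂ) :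
    Matrix (Fin n ⊕ Fin n) (Fin n ⊕ Fin n) ℂ :=
  Matrix.fromBlocks 0 (cx S.D₂inv) (cx (jac (fun v => S.G u v 0) 0) + lam • 1) 0

/-- For each `Λ ∈ (-Λ₀,0)` the spectrum of `A(u,λ)` is bounded away from the imaginary axis,
uniformly in `u ∈ K` and `Re λ > Λ`. -/
def SpectralGap (S : RDSystem m n) (K : Set (Fin m → ℝ)) (Lam₀ : ℝ) : Prop :=
  ∀ Lam ∈ Ioo (-Lam₀) 0, ∃ c > 0, ∀ u ∈ K, ∀ lam : ℂ, Lam < lam.re →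
    ∀ μ ∈ spectrum ℂ (S.asympMatrix u lam), c ≤ |μ.re|

end RDSystem

/-! ### Periodic pulse solutions -/

/-- A family `(u,p,v,q) ε x` of curves with half-periods `L ε`, together with the singular objects
`u₀, p₀, (v_h,q_h)` and the limit `Lc₀` of `ε L_ε`. -/
structure PulseFamily (m n : ℕ) where
  u : ℝ → ℝ → (Fin m → ℝ)
  p : ℝ → ℝ → (Fin m → ℝ)
  v : ℝ → ℝ → (Fin n → ℝ)
  q : ℝ → ℝ → (Fin n → ℝ)
  L : ℝ → ℝ
  Lc₀ : ℝ
  u₀ : Fin m → ℝ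
  p₀ : Fin m → ℝ
  vh : ℝ → (Fin n → ℝ)
  qh : ℝ → (Fin n → ℝ)

namespace PulseFamily

variable {m n : ℕ}

/-- The periodic pulse `φ_{p,ε}(x) = (u,p,v,q)`. -/
def phi (F : PulseFamily m n) (ε x : ℝ) : Phase m n := (F.u ε x, F.p ε x, F.v ε x, F.q ε x)

/-- The singular pulse `φ_h(x) = (u₀, p₀ + ∫₀ˣ H₂(u₀,v_h(z)) dz, v_h(x), q_h(x))`. -/
def phiH (F : PulseFamily m n) (S : RDSystem m n) (x : ℝ) : Phase m n :=
  (F.u₀, F.p₀ + ∫ z in (0 : ℝ)..x, S.H₂ F.u₀ (F.vh z), F.vh x, F.qh x)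

/-- Existence of a periodic pulse solution. -/
structure S3 (F : PulseFamily m n) (S : RDSystem m n) : Prop where
  solution : ∀ᶠ ε in 𝓝[>] (0 : ℝ), ∀ x, F.u ε x ∈ S.U ∧ F.v ε x ∈ S.V ∧
    HasDerivAt (F.u ε) (S.D₁inv.mulVec (ε • F.p ε x)) x ∧
    HasDerivAt (F.p ε) (ε • S.H₁ (F.u ε x) (F.v ε x) ε + S.H₂ (F.u ε x) (F.v ε x)) x ∧
    HasDerivAt (F.v ε) (S.D₂inv.mulVec (F.q ε x)) x ∧
    HasDerivAt (F.q ε) (S.G (F.u ε x) (F.v ε x) ε) x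
  periodic : ∀ᶠ ε in 𝓝[>] (0 : ℝ), ∀ x, F.phi ε (x + 2 * F.L ε) = F.phi ε x
  Lc₀_pos : 0 < F.Lc₀
  period : Tendsto (fun ε => ε * F.L ε) (𝓝[>] 0) (𝓝 F.Lc₀)
  u₀_mem : F.u₀ ∈ S.U
  pulse : ∀ x, F.vh x ∈ S.V ∧ HasDerivAt F.vh (S.D₂inv.mulVec (F.qh x)) x ∧
    HasDerivAt F.qh (S.G F.u₀ (F.vh x) 0) x
  homoclinic_top : Tendsto (fun x => (F.vh x, F.qh x)) atTop (𝓝 0)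
  homoclinic_bot : Tendsto (fun x => (F.vh x, F.qh x)) atBot (𝓝 0)
  nontrivial : ∃ x, (F.vh x, F.qh x) ≠ 0
  initial : ∃ C : ℝ, ∀ᶠ ε in 𝓝[>] (0 : ℝ),
    ‖F.phi ε 0 - (F.u₀, F.p₀, F.vh 0, F.qh 0)‖ ≤ C * ε
  slow : ∃ Ls > 0, ∃ βs > 0, ∃ us ps : ℝ → (Fin m → ℝ),
    (∃ a b : ℝ, a < 0 ∧ 2 * F.Lc₀ < b ∧ ∀ y ∈ Ioo a b, us y ∈ S.U ∧
      HasDerivAt us (S.D₁inv.mulVec (ps y)) y ∧ HasDerivAt ps (S.H₁ (us y) 0 0) y) ∧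
    ∀ᶠ ε in 𝓝[>] (0 : ℝ), ∀ x ∈ Icc 0 (2 * F.L ε),
      Metric.infDist (F.phi ε x) S.slowManifold
        ≤ Ls * Real.exp (-βs * min x (2 * F.L ε - x)) ∧
      ‖F.phi ε x - (us (ε * x), ps (ε * x), 0, 0)‖
        ≤ Ls * max ε (Real.exp (-βs * min x (2 * F.L ε - x)))

/-- `K` is an `ε`-independent compact subset of `U` that contains `u₀` and, for small `ε`, the
`u`-component of the pulse. -/
def IsSlowCompactum (F : PulseFamily m n) (S : RDSystem m n) (K : Set (Fin m → ℝ)) : Prop :=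
  IsCompact K ∧ K ⊆ S.U ∧ F.u₀ ∈ K ∧ ∀ᶠ ε in 𝓝[>] (0 : ℝ), ∀ x, F.u ε x ∈ K

/-- The pulse region `I_ε = [-ε^{-ρ}, ε^{-ρ}]`. -/
def pulseRegion (ρ ε : ℝ) : Set ℝ := Icc (-(ε ^ (-ρ))) (ε ^ (-ρ))

/-- The exponents `β_f ∈ (0,1/4]` and `ρ > 0` are such that `φ_{p,ε} - φ_h = O(ε^{β_f})` on the
pulse region. -/
def IsPulseRate (F : PulseFamily m n) (S : RDSystem m n) (βf ρ : ℝ) : Prop :=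
  0 < βf ∧ βf ≤ 1 / 4 ∧ 0 < ρ ∧ ∃ C : ℝ, ∀ᶠ ε in 𝓝[>] (0 : ℝ),
    ∀ x ∈ pulseRegion ρ ε, ‖F.phi ε x - F.phiH S x‖ ≤ C * ε ^ βf

/-! ### The linear stability problem -/

/-- `𝒜₁₁,ε(x,λ)`. -/
def A11 (F : PulseFamily m n) (S : RDSystem m n) (ε x : ℝ) (lam : ℂ) :
    Matrix (Fin m ⊕ Fin m) (Fin m ⊕ Fin m) ℂ :=
  Matrix.fromBlocks 0 (cx S.D₁inv)
    ((ε : ℂ) • (cx (jac (fun u => S.H₁ u (F.v ε x) ε) (F.u ε x)) + lam • 1)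
      + cx (jac (fun u => S.H₂ u (F.v ε x)) (F.u ε x))) 0

/-- `𝒜₁₂,ε(x)`. -/
def A12 (F : PulseFamily m n) (S : RDSystem m n) (ε x : ℝ) :
    Matrix (Fin m ⊕ Fin m) (Fin n ⊕ Fin n) ℂ :=
  Matrix.fromBlocks 0 0
    ((ε : ℂ) • cx (jac (fun v => S.H₁ (F.u ε x) v ε) (F.v ε x))
      + cx (jac (fun v => S.H₂ (F.u ε x) v) (F.v ε x))) 0

/-- `𝒜₂₁,ε(x)`. -/
def A21 (F : PulseFamily m n) (S : RDSystem m n) (ε x : ℝ) :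
    Matrix (Fin n ⊕ Fin n) (Fin m ⊕ Fin m) ℂ :=
  Matrix.fromBlocks 0 0 (cx (jac (fun u => S.G u (F.v ε x) ε) (F.u ε x))) 0

/-- `𝒜₂₂,ε(x,λ)`. -/
def A22 (F : PulseFamily m n) (S : RDSystem m n) (ε x : ℝ) (lam : ℂ) :
    Matrix (Fin n ⊕ Fin n) (Fin n ⊕ Fin n) ℂ :=
  Matrix.fromBlocks 0 (cx S.D₂inv)
    (cx (jac (fun v => S.G (F.u ε x) v ε) (F.v ε x)) + lam • 1) 0

/-- Coefficient matrix of the linear stability problem in the variables `((u,p),(v,q))`. -/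
def fullCoeff (F : PulseFamily m n) (S : RDSystem m n) (ε : ℝ) (lam : ℂ) (x : ℝ) :
    Matrix ((Fin m ⊕ Fin m) ⊕ (Fin n ⊕ Fin n)) ((Fin m ⊕ Fin m) ⊕ (Fin n ⊕ Fin n)) ℂ :=
  Matrix.fromBlocks ((√ε : ℂ) • F.A11 S ε x lam) ((√ε : ℂ) • F.A12 S ε x)
    (F.A21 S ε x) (F.A22 S ε x lam)

/-- The Evans function `ℰ_ε(λ,γ)`. -/
def evans (F : PulseFamily m n) (S : RDSystem m n) (ε : ℝ) (lam γ : ℂ) : ℂ :=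
  floquetDet (F.fullCoeff S ε lam) (F.L ε) γ

/-- Coefficient matrix `√ε (𝒜₁₁ + 𝒜₁₂ W)` of the diagonalized slow system. -/
def slowCoeff (F : PulseFamily m n) (S : RDSystem m n)
    (W : ℝ → Matrix (Fin n ⊕ Fin n) (Fin m ⊕ Fin m) ℂ) (ε : ℝ) (lam : ℂ) (x : ℝ) :
    Matrix (Fin m ⊕ Fin m) (Fin m ⊕ Fin m) ℂ :=
  (√ε : ℂ) • (F.A11 S ε x lam + F.A12 S ε x * W x)

/-- Coefficient matrix `𝒜₂₂ - √ε W 𝒜₁₂` of the diagonalized fast system. -/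
def fastCoeff (F : PulseFamily m n) (S : RDSystem m n)
    (W : ℝ → Matrix (Fin n ⊕ Fin n) (Fin m ⊕ Fin m) ℂ) (ε : ℝ) (lam : ℂ) (x : ℝ) :
    Matrix (Fin n ⊕ Fin n) (Fin n ⊕ Fin n) ℂ :=
  F.A22 S ε x lam - (√ε : ℂ) • (W x * F.A12 S ε x)

/-- The matrix Riccati equation
`W' = 𝒜₂₂ W - √ε W 𝒜₁₁ - √ε W 𝒜₁₂ W + 𝒜₂₁`. -/
def SolvesRiccati (F : PulseFamily m n) (S : RDSystem m n)
    (W : ℝ → Matrix (Fin n ⊕ Fin n) (Fin m ⊕ Fin m) ℂ) (ε : ℝ) (lam : ℂ) : Prop :=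
  ∀ x, HasDerivAt W (F.A22 S ε x lam * W x - (√ε : ℂ) • (W x * F.A11 S ε x lam)
    - (√ε : ℂ) • (W x * F.A12 S ε x * W x) + F.A21 S ε x) x

/-! ### The fast limit problems -/

/-- `𝒜₂₂,₀(x,λ)`, the coefficient matrix of the homogeneous fast limit problem. -/
def A22lim (F : PulseFamily m n) (S : RDSystem m n) (lam : ℂ) (x : ℝ) :
    Matrix (Fin n ⊕ Fin n) (Fin n ⊕ Fin n) ℂ :=
  Matrix.fromBlocks 0 (cx S.D₂inv)
    (cx (jac (fun v => S.G F.u₀ v 0) (F.vh x)) + lam • 1) 0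

/-- `𝒜₂₁,₀(x)`. -/
def A21lim (F : PulseFamily m n) (S : RDSystem m n) (x : ℝ) :
    Matrix (Fin n ⊕ Fin n) (Fin m ⊕ Fin m) ℂ :=
  Matrix.fromBlocks 0 0 (cx (jac (fun u => S.G u (F.vh x) 0) F.u₀)) 0

/-- The inhomogeneous fast limit problem `X' = 𝒜₂₂,₀ X + 𝒜₂₁,₀`. -/
def SolvesFastInhom (F : PulseFamily m n) (S : RDSystem m n) (lam : ℂ)
    (X : ℝ → Matrix (Fin n ⊕ Fin n) (Fin m ⊕ Fin m) ℂ) : Prop :=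
  ∀ x, HasDerivAt X (F.A22lim S lam x * X x + F.A21lim S x) x

/-- `X` is exponentially localized and is the unique bounded solution of the inhomogeneous
fast limit problem. -/
def IsXin (F : PulseFamily m n) (S : RDSystem m n) (lam : ℂ)
    (X : ℝ → Matrix (Fin n ⊕ Fin n) (Fin m ⊕ Fin m) ℂ) : Prop :=
  F.SolvesFastInhom S lam X ∧
  (∃ K > 0, ∃ μ > 0, ∀ x, ‖X x‖ ≤ K * Real.exp (-μ * |x|)) ∧
  ∀ Y, F.SolvesFastInhom S lam Y → (∃ C : ℝ, ∀ x, ‖Y x‖ ≤ C) → Y = X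

/-- `e` is a value at `λ` of the fast reduced Evans function: `e = det(B₊, B₋)`, where the columns
of `B₊` form a basis of the range of `P₊(0)`, those of `B₋` a basis of the kernel of `P₋(0)`,
and `P₊`, `P₋` are the projections of exponential dichotomies of the homogeneous fast limit
problem on `[0,∞)` and `(-∞,0]`. Whether `e = 0` does not depend on the bases and projections. -/
def IsFastReducedEvansValue (F : PulseFamily m n) (S : RDSystem m n) (lam e : ℂ) : Prop :=
  ∃ (K μ : ℝ) (Pp Pm : ℝ → Matrix (Fin n ⊕ Fin n) (Fin n ⊕ Fin n) ℂ)
    (Bp Bm : Matrix (Fin n ⊕ Fin n) (Fin n) ℂ),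
    HasExpDichotomy (F.A22lim S lam) (Ici 0) K μ Pp ∧
    HasExpDichotomy (F.A22lim S lam) (Iic 0) K μ Pm ∧
    LinearIndependent ℂ Bp.col ∧ Submodule.span ℂ (range Bp.col) = (Pp 0).mulVecLin.range ∧
    LinearIndependent ℂ Bm.col ∧ Submodule.span ℂ (range Bm.col) = (Pm 0).mulVecLin.ker ∧
    e = (Matrix.fromCols Bp Bm).det

/-- The zeros of the fast reduced Evans function in `Re λ ≥ Λ`. -/
def fastZeros (F : PulseFamily m n) (S : RDSystem m n) (Lam : ℝ) : Set ℂ :=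
  {lam | Lam ≤ lam.re ∧ F.IsFastReducedEvansValue S lam 0}

end PulseFamily

/-- `Σ_{Λ,0}`: the part of `Re λ > Λ` outside the sector `{λ = ω or |arg(λ - ω)| ≤ ϖ}`. -/
def regionZero (ω ϖ Lam : ℝ) : Set ℂ :=
  {lam | Lam < lam.re ∧ lam.re < ω ∧ ϖ < |(lam - (ω : ℂ)).arg|}

/-- `Σ_{Λ,δ}`: the region `Σ_{Λ,0}` without the open `δ`-discs around the zeros of the fast
reduced Evans function. -/
def region {m n : ℕ} (F : PulseFamily m n) (S : RDSystem m n) (ω ϖ Lam δ : ℝ) : Set ℂ :=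
  regionZero ω ϖ Lam \ ⋃ z ∈ F.fastZeros S Lam, Metric.ball z δ

end

end EvansRiccati

namespace EvansRiccati


/-! ### Linear differential equations in Banach spaces -/

section LinearODE

variable {E : Type*} [NormedAddCommGroup E] [NormedSpace ℝ E]

/-! A periodic solution `W` of the Riccati equation makes the shear with blocks `1, 0, W, 1` a
periodic change of variables that turns the full linear system into a block upper triangular one.
The shear has determinant one and the same value at `L` and `-L`, so it drops out of the Floquet
determinant, which becomes the product of those of the diagonal blocks (`floquetDet_fromBlocks`).
Everything else concerns the construction and control of `W`.

The analytic core is a single estimate, `PulseFamily.S3.exists_uniform_apriori`: bounded solutions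
of `W' = 𝒜₂₂ W + Φ` satisfy `sup ‖W‖ ≤ C sup ‖Φ‖` with `C` independent of small `ε` and of `λ` in
the region. It is proved by compactness. If it failed, there would be normalized solutions with
forcing tending to zero, each translated so that it is not small at the origin. A limit along an
ultrafilter is a nonzero bounded solution of a homogeneous limit equation. If the translations stay
bounded, this is the fast limit problem along the homoclinic, and its bounded solutions force a zero
of the fast reduced Evans function (`isFastReducedEvansValue_zero_of_bounded`), excluded by the
region. If they do not, it is a constant hyperbolic system, which has no nonzero bounded solution
(`eq_zero_of_bounded_of_hyperbolic`). Exponential dichotomies are needed only for the link to the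
Evans function; the reversing symmetry `diag(1, -1)` gives both projections rank `n`.

The rest follows from this estimate. Uniqueness of periodic solutions gives existence by the
Fredholm alternative, and since the slow terms carry `√ε`, a contraction argument solves the Riccati
equation (`exists_periodic_riccati`). The forcing `𝒜₂₁` vanishes with `v`, hence is exponentially
small away from the pulse, and a periodic exponential weight transfers this to `W`
(`riccati_localized`). This gives the uniform bound and the `ε³` estimate. The solution `Xin` is
obtained as a limit of these `W` as `ε ↓ 0`, and the a priori estimate applied to a cut-off of `W -
Xin` yields the rate `ε^βf` (`PulseFamily.S3.exists_norm_sub_le`).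

The auxiliary sets and exponents exist by elementary arguments: a thickening of the slow orbit for
the compact set, positivity of the quadratic form of `∂ᵥG` for the spectral gap, and Gronwall up to
logarithmic time combined with exponential decay beyond it for the pulse rate. -/

theorem gronwall_forward {w w' : ℝ → E} {M δ R : ℝ} (hM : 0 ≤ M) (hδ : 0 ≤ δ)
    (hw : ∀ x ∈ Icc 0 R, HasDerivAt w (w' x) x)
    (hb : ∀ x ∈ Ico 0 R, ‖w' x‖ ≤ M * ‖w x‖ + δ) :
    ∀ x ∈ Icc 0 R, ‖w x‖ ≤ (‖w 0‖ + δ * R) * Real.exp (M * R) := by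
  intro x hx
  have hR : 0 ≤ R := hx.1.trans hx.2
  have h := norm_le_gronwallBound_of_norm_deriv_right_le (f := w) (f' := w') (δ := ‖w 0‖)
    (K := M) (ε := δ) (a := 0) (b := R)
    (fun y hy => (hw y hy).continuousAt.continuousWithinAt)
    (fun y hy => (hw y (Ico_subset_Icc_self hy)).hasDerivWithinAt) le_rfl hb x hx
  rw [sub_zero] at h
  refine h.trans ((gronwallBound_mono (norm_nonneg _) hδ hM hx.2).trans ?_)
  rcases eq_or_ne M 0 with rfl | hM0
  · simp [gronwallBound_K0]
  have hM' : 0 < M := lt_of_le_of_ne hM (Ne.symm hM0)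
  rw [gronwallBound_of_K_ne_0 hM0]
  have h1 : Real.exp (M * R) - 1 ≤ M * R * Real.exp (M * R) := by
    have h2 := Real.add_one_le_exp (-(M * R))
    have h3 : Real.exp (-(M * R)) * Real.exp (M * R) = 1 := by
      rw [← Real.exp_add]; simp
    nlinarith [Real.exp_pos (M * R)]
  have h4 : δ / M * (Real.exp (M * R) - 1) ≤ δ / M * (M * R * Real.exp (M * R)) := by gcongr
  have h5 : δ / M * (M * R * Real.exp (M * R)) = δ * R * Real.exp (M * R) := by
    field_simp
  simp only [add_mul]
  linarith

theorem hasDerivAt_comp_neg {w : ℝ → E} {w' : E} {x : ℝ} (h : HasDerivAt w w' (-x)) :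
    HasDerivAt (fun y => w (-y)) (-w') x := by
  simpa [Function.comp_def] using h.scomp x (hasDerivAt_neg x)

/-- The derivative bound is asked for only on the open interval, which is what a continuation
argument such as `le_of_bootstrap` can supply. -/
theorem gronwall_two_sided_of_lt {w w' : ℝ → E} {M δ R : ℝ} (hM : 0 ≤ M) (hδ : 0 ≤ δ)
    (hw : ∀ x, HasDerivAt w (w' x) x)
    (hb : ∀ x, |x| < R → ‖w' x‖ ≤ M * ‖w x‖ + δ) :
    ∀ x, |x| ≤ R → ‖w x‖ ≤ (‖w 0‖ + δ * R) * Real.exp (M * R) := by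
  intro x hx
  rcases le_total 0 x with h0 | h0
  · refine gronwall_forward hM hδ (fun y hy => hw y) (fun y hy => hb y ?_) x
      ⟨h0, (le_abs_self x).trans hx⟩
    rw [abs_of_nonneg hy.1]; exact hy.2
  · have := gronwall_forward (w := fun y => w (-y)) (w' := fun y => -w' (-y)) (R := R) hM hδ
      (fun y hy => hasDerivAt_comp_neg (hw (-y))) (fun y hy => ?_) (-x)
      ⟨by linarith, (neg_le_abs x).trans hx⟩
    · simpa using this
    · rw [norm_neg]; exact hb (-y) (by rw [abs_neg, abs_of_nonneg hy.1]; exact hy.2)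

theorem gronwall_two_sided {w w' : ℝ → E} {M δ R : ℝ} (hM : 0 ≤ M) (hδ : 0 ≤ δ)
    (hw : ∀ x, HasDerivAt w (w' x) x)
    (hb : ∀ x, |x| ≤ R → ‖w' x‖ ≤ M * ‖w x‖ + δ) :
    ∀ x, |x| ≤ R → ‖w x‖ ≤ (‖w 0‖ + δ * R) * Real.exp (M * R) :=
  gronwall_two_sided_of_lt hM hδ hw fun x hx => hb x hx.le

/-- Uniqueness for linear equations with continuous coefficients. -/
theorem linearODE_eq_zero {A : ℝ → E →L[ℝ] E} (hA : Continuous A) {w : ℝ → E}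
    (hw : ∀ x, HasDerivAt w (A x (w x)) x) {y : ℝ} (h0 : w y = 0) : w = 0 := by
  have key : ∀ (B : ℝ → E →L[ℝ] E), Continuous B → ∀ z : ℝ → E,
      (∀ x, HasDerivAt z (B x (z x)) x) → z 0 = 0 → ∀ x, z x = 0 := by
    intro B hB z hz hz0 x
    obtain ⟨M, hM⟩ := (isCompact_Icc (a := -|x|) (b := |x|)).exists_bound_of_continuousOn
      hB.continuousOn
    have hM0 : 0 ≤ M := (norm_nonneg _).trans (hM 0 (by simp))
    have := gronwall_two_sided (w := z) (M := M) (δ := 0) (R := |x|) hM0 le_rfl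
      hz (fun y hy => ?_) x le_rfl
    · simpa [hz0] using this
    · rw [add_zero]
      exact ((B y).le_opNorm _).trans (by gcongr; exact hM y (abs_le.1 hy))
  funext x
  have := key (fun s => A (s + y)) (by fun_prop) (fun s => w (s + y))
    (fun s => (hw (s + y)).comp_add_const s y) (by simpa using h0) (x - y)
  simpa using this

variable [CompleteSpace E]

/-- Global existence in one contraction: in the sup norm weighted by `exp |2 ∫₀ˣ ‖A‖|`, the Volterra
integral operator has Lipschitz constant `1/2` on the whole line, so no gluing of local solutions is
needed. -/
theorem exists_linearODE {A : ℝ → E →L[ℝ] E} (hA : Continuous A) (ξ : E) :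
    ∃ w : ℝ → E, w 0 = ξ ∧ ∀ x, HasDerivAt w (A x (w x)) x := by
  set n : ℝ → ℝ := fun x => 2 * ∫ s in (0 : ℝ)..x, ‖A s‖ with hn
  have hn' : ∀ x, HasDerivAt n (2 * ‖A x‖) x := fun x =>
    (intervalIntegral.integral_hasDerivAt_right (hA.norm.intervalIntegrable _ _)
      (hA.norm.stronglyMeasurableAtFilter _ _) hA.norm.continuousAt).const_mul 2
  have hnc : Continuous n := continuous_iff_continuousAt.2 fun x => (hn' x).continuousAt
  have hn0 : n 0 = 0 := by simp [hn]
  have hnm : Monotone n := monotone_of_hasDerivAt_nonneg hn' fun x => by positivity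
  set e : ℝ → ℝ := fun x => Real.exp |n x| with he
  have hec : Continuous e := by fun_prop
  have he1 : ∀ x, 1 ≤ e x := fun x => Real.one_le_exp (abs_nonneg _)
  -- The weight is chosen so that `‖A‖ e` is, up to sign, half the derivative of `e` on each
  -- half-line; this is the source of the factor `1/2`.
  have key : ∀ (g : ℝ → E) (d : ℝ), 0 ≤ d → (∀ x, ‖g x‖ ≤ e x * ‖A x‖ * d) → ∀ x,
      ‖∫ s in (0 : ℝ)..x, g s‖ ≤ d / 2 * e x := by
    intro g d hd hg x
    rcases le_total 0 x with hx | hx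
    · have hint : IntervalIntegrable (fun s => Real.exp (n s) * ‖A s‖ * d) MeasureTheory.volume
          0 x :=
        Continuous.intervalIntegrable (by fun_prop) _ _
      have h1 := intervalIntegral.norm_integral_le_of_norm_le (f := g) hx
        (g := fun s => Real.exp (n s) * ‖A s‖ * d)
        (Eventually.of_forall fun s hs => by
          have : e s = Real.exp (n s) := by
            simp only [he]; rw [abs_of_nonneg]; rw [← hn0]; exact hnm hs.1.le
          rw [← this]; exact hg s) hint
      have h2 : ∫ s in (0 : ℝ)..x, Real.exp (n s) * ‖A s‖ * d
          = d / 2 * Real.exp (n x) - d / 2 * Real.exp (n 0) :=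
        intervalIntegral.integral_eq_sub_of_hasDerivAt (f := fun s => d / 2 * Real.exp (n s))
          (fun s _ => by
            have := (hn' s).exp.const_mul (d / 2)
            exact this.congr_deriv (by ring)) hint
      rw [h2] at h1
      have : Real.exp (n x) ≤ e x := Real.exp_le_exp.2 (le_abs_self _)
      have h3 : d / 2 * Real.exp (n x) ≤ d / 2 * e x := by gcongr
      have h4 : 0 ≤ d / 2 * Real.exp (n 0) := by positivity
      linarith
    · have hint : IntervalIntegrable (fun s => Real.exp (-n s) * ‖A s‖ * d) MeasureTheory.volume
          x 0 :=
        Continuous.intervalIntegrable (by fun_prop) _ _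
      have h1 := intervalIntegral.norm_integral_le_of_norm_le (f := g) hx
        (g := fun s => Real.exp (-n s) * ‖A s‖ * d)
        (Eventually.of_forall fun s hs => by
          have : e s = Real.exp (-n s) := by
            simp only [he]; rw [abs_of_nonpos]; rw [← hn0]; exact hnm hs.2
          rw [← this]; exact hg s) hint
      have h2 : ∫ s in x..(0 : ℝ), Real.exp (-n s) * ‖A s‖ * d
          = -(d / 2) * Real.exp (-n 0) - -(d / 2) * Real.exp (-n x) :=
        intervalIntegral.integral_eq_sub_of_hasDerivAt (f := fun s => -(d / 2) * Real.exp (-n s))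
          (fun s _ => by
            have := (hn' s).neg.exp.const_mul (-(d / 2))
            exact this.congr_deriv (by simp only [Pi.neg_apply]; ring)) hint
      rw [intervalIntegral.integral_symm, norm_neg]
      rw [h2] at h1
      have : Real.exp (-n x) ≤ e x := Real.exp_le_exp.2 (neg_le_abs _)
      have h3 : d / 2 * Real.exp (-n x) ≤ d / 2 * e x := by gcongr
      have h4 : 0 ≤ d / 2 * Real.exp (-n 0) := by positivity
      linarith
  -- Fixed points of `Φ` are `z = w / e` with `w` the sought solution; dividing by the weight keeps
  -- the iteration among bounded continuous functions.
  let Φ : (ℝ → E) → ℝ → E := fun z x => (e x)⁻¹ • (ξ + ∫ s in (0 : ℝ)..x, e s • A s (z s))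
  have hg : ∀ z : BoundedContinuousFunction ℝ E, ∀ x,
      ‖e x • A x (z x)‖ ≤ e x * ‖A x‖ * ‖z‖ := fun z x => by
    rw [norm_smul, Real.norm_of_nonneg (zero_le_one.trans (he1 x)), mul_assoc]
    have := zero_le_one.trans (he1 x)
    gcongr
    exact ((A x).le_opNorm _).trans (by gcongr; exact z.norm_coe_le_norm x)
  have hgc : ∀ z : BoundedContinuousFunction ℝ E, Continuous fun s => e s • A s (z s) :=
    fun z => hec.smul (hA.clm_apply z.continuous)
  have hder : ∀ z : BoundedContinuousFunction ℝ E, ∀ x,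
      HasDerivAt (fun x => ∫ s in (0 : ℝ)..x, e s • A s (z s)) (e x • A x (z x)) x := fun z x =>
    intervalIntegral.integral_hasDerivAt_right ((hgc z).intervalIntegrable _ _)
      ((hgc z).stronglyMeasurableAtFilter _ _) (hgc z).continuousAt
  have hΦc : ∀ z : BoundedContinuousFunction ℝ E, Continuous (Φ z) := fun z => by
    refine (hec.inv₀ fun x => (zero_lt_one.trans_le (he1 x)).ne').smul (continuous_const.add ?_)
    exact continuous_iff_continuousAt.2 fun x => (hder z x).continuousAt
  have hinv : ∀ x, ‖(e x)⁻¹‖ = (e x)⁻¹ := fun x =>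
    Real.norm_of_nonneg (inv_nonneg.2 (zero_le_one.trans (he1 x)))
  have hΦb : ∀ z : BoundedContinuousFunction ℝ E, ∀ x, ‖Φ z x‖ ≤ ‖ξ‖ + ‖z‖ / 2 := fun z x => by
    have h0 := zero_lt_one.trans_le (he1 x)
    simp only [Φ]
    rw [norm_smul, hinv, inv_mul_le_iff₀ h0]
    refine (norm_add_le _ _).trans ?_
    have h1 := key _ _ (norm_nonneg z) (hg z) x
    have h2 : ‖ξ‖ ≤ e x * ‖ξ‖ := le_mul_of_one_le_left (norm_nonneg _) (he1 x)
    nlinarith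
  let Ψ : BoundedContinuousFunction ℝ E → BoundedContinuousFunction ℝ E := fun z =>
    BoundedContinuousFunction.ofNormedAddCommGroup (Φ z) (hΦc z) _ (hΦb z)
  have hcontr : ContractingWith (1 / 2) Ψ := by
    refine ⟨by rw [← NNReal.coe_lt_coe]; norm_num, LipschitzWith.of_dist_le_mul fun z z' => ?_⟩
    rw [BoundedContinuousFunction.dist_le (by positivity)]
    intro x
    have h0 := zero_lt_one.trans_le (he1 x)
    change dist (Φ z x) (Φ z' x) ≤ _
    have h1 : Φ z x - Φ z' x = (e x)⁻¹ • ∫ s in (0 : ℝ)..x, e s • A s ((z - z') s) := by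
      simp only [Φ]
      rw [← smul_sub, add_sub_add_left_eq_sub, ← intervalIntegral.integral_sub
        ((hgc z).intervalIntegrable _ _) ((hgc z').intervalIntegrable _ _)]
      simp [smul_sub]
    rw [dist_eq_norm, h1, norm_smul, hinv, inv_mul_le_iff₀ h0, dist_eq_norm]
    have h2 := key _ _ (norm_nonneg (z - z')) (hg (z - z')) x
    refine h2.trans (le_of_eq ?_)
    norm_num
    ring
  let z := hcontr.fixedPoint
  have hz : ∀ x, z x = Φ z x := fun x => by
    have : Ψ z = z := hcontr.fixedPoint_isFixedPt
    exact (congrArg (fun f : BoundedContinuousFunction ℝ E => f x) this).symm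
  have hez : ∀ x, e x • z x = ξ + ∫ s in (0 : ℝ)..x, e s • A s (z s) := fun x => by
    rw [hz x, smul_inv_smul₀ (zero_lt_one.trans_le (he1 x)).ne']
  refine ⟨fun x => e x • z x, by simp [hez], fun x => ?_⟩
  have h1 : (fun x => e x • z x) = fun x => ξ + ∫ s in (0 : ℝ)..x, e s • A s (z s) := funext hez
  rw [h1]
  have h2 := (hder z x).const_add ξ
  convert h2 using 1
  simp only [← hez x, map_smul]

/-- The equation is suspended to a homogeneous one on `E × ℝ`, whose last coordinate stays equal to
`1` and carries the inhomogeneity; a time shift moves the initial point from `0` to `y`. -/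
theorem exists_affineODE {A : ℝ → E →L[ℝ] E} (hA : Continuous A) {f : ℝ → E} (hf : Continuous f)
    (y : ℝ) (ξ : E) :
    ∃ w : ℝ → E, w y = ξ ∧ ∀ x, HasDerivAt w (A x (w x) + f x) x := by
  let B : ℝ → (E × ℝ) →L[ℝ] (E × ℝ) := fun x => (ContinuousLinearMap.inl ℝ E ℝ).comp
    (((A (x + y)).comp (ContinuousLinearMap.fst ℝ E ℝ)) +
      (ContinuousLinearMap.smulRightL ℝ (E × ℝ) E (ContinuousLinearMap.snd ℝ E ℝ)) (f (x + y)))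
  have hB : Continuous B := by
    have hA' : Continuous fun x => A (x + y) := by fun_prop
    have hf' : Continuous fun x => f (x + y) := by fun_prop
    exact continuous_const.clm_comp ((hA'.clm_comp continuous_const).add
      ((ContinuousLinearMap.continuous _).comp hf'))
  obtain ⟨W, hW0, hW⟩ := exists_linearODE hB (ξ, 1)
  have h2 : ∀ x, (W x).2 = 1 := by
    have hd : ∀ x, HasDerivAt (fun x => (W x).2) 0 x := fun x => by
      have := (ContinuousLinearMap.snd ℝ E ℝ).hasFDerivAt.comp_hasDerivAt x (hW x)
      simpa [B, Function.comp_def] using this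
    intro x
    have := is_const_of_deriv_eq_zero (fun x => (hd x).differentiableAt) (fun x => (hd x).deriv) x 0
    rw [this, hW0]
  refine ⟨fun x => (W (x - y)).1, by simp [hW0], fun x => ?_⟩
  have := ((ContinuousLinearMap.fst ℝ E ℝ).hasFDerivAt.comp_hasDerivAt (x - y)
    (hW (x - y))).comp_sub_const x y
  simpa [B, h2, Function.comp_def] using this

end LinearODE


/-! ### Matrix differential equations and evolution operators -/

section MatrixODE

variable {ι κ l : Type*} [Fintype ι] [Fintype κ] [Fintype l]

/-- Matrix multiplication as a continuous bilinear map. -/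
noncomputable def mulCLM (l ι κ : Type*) [Fintype l] [Fintype ι] [Fintype κ] :
    Matrix l ι ℂ →L[ℝ] Matrix ι κ ℂ →L[ℝ] Matrix l κ ℂ :=
  LinearMap.mkContinuous₂
    (LinearMap.mk₂ ℝ (fun (A : Matrix l ι ℂ) (B : Matrix ι κ ℂ) => A * B)
      (fun _ _ _ => Matrix.add_mul _ _ _) (fun _ _ _ => Matrix.smul_mul _ _ _)
      (fun _ _ _ => Matrix.mul_add _ _ _) (fun _ _ _ => Matrix.mul_smul _ _ _)) 1
    (fun A B => by simpa using Matrix.linfty_opNorm_mul A B)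

theorem hasDerivAt_matrix_mul {A : ℝ → Matrix l ι ℂ} {B : ℝ → Matrix ι κ ℂ}
    {A' : Matrix l ι ℂ} {B' : Matrix ι κ ℂ} {x : ℝ}
    (hA : HasDerivAt A A' x) (hB : HasDerivAt B B' x) :
    HasDerivAt (fun s => A s * B s) (A' * B x + A x * B') x := by
  have h := (mulCLM l ι κ).hasDerivAt_of_bilinear (fun _ => hA) (fun _ => hB)
  rw [add_comm]
  exact h

theorem exists_matrixODE {A : ℝ → Matrix ι ι ℂ} (hA : Continuous A) {F : ℝ → Matrix ι κ ℂ}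
    (hF : Continuous F) (y : ℝ) (Ξ : Matrix ι κ ℂ) :
    ∃ W : ℝ → Matrix ι κ ℂ, W y = Ξ ∧ ∀ x, HasDerivAt W (A x * W x + F x) x :=
  exists_affineODE (A := fun x => mulCLM ι ι κ (A x)) ((mulCLM ι ι κ).continuous.comp hA) hF y Ξ

theorem matrixODE_unique {A : ℝ → Matrix ι ι ℂ} (hA : Continuous A) {F W Z : ℝ → Matrix ι κ ℂ}
    (hW : ∀ x, HasDerivAt W (A x * W x + F x) x) (hZ : ∀ x, HasDerivAt Z (A x * Z x + F x) x)
    {y : ℝ} (h : W y = Z y) : W = Z := by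
  have := linearODE_eq_zero (A := fun x => mulCLM ι ι κ (A x)) ((mulCLM ι ι κ).continuous.comp hA)
    (w := fun x => W x - Z x) (fun x => ?_) (y := y) (sub_eq_zero.2 h)
  · funext x
    exact sub_eq_zero.1 (congrFun this x)
  · refine ((hW x).sub (hZ x)).congr_deriv ?_
    change _ = A x * (W x - Z x)
    rw [Matrix.mul_sub]; abel

variable [DecidableEq ι]

/-- `evolution` is a choice that means nothing unless some evolution exists; continuity of the
coefficients guarantees that. -/
theorem isEvolution_evolution {A : ℝ → Matrix ι ι ℂ} (hA : Continuous A) :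
    IsEvolution A (evolution A) := by
  refine Classical.epsilon_spec (p := IsEvolution A) ?_
  choose T hT hT' using fun y => exists_matrixODE hA (F := fun _ => (0 : Matrix ι ι ℂ))
    continuous_const y 1
  exact ⟨fun x y => T y x, fun y => ⟨hT y, fun x => by simpa using hT' y x⟩⟩

theorem evolution_self {A : ℝ → Matrix ι ι ℂ} (hA : Continuous A) (y : ℝ) :
    evolution A y y = 1 := (isEvolution_evolution hA y).1

theorem hasDerivAt_evolution {A : ℝ → Matrix ι ι ℂ} (hA : Continuous A) (x y : ℝ) :
    HasDerivAt (fun s => evolution A s y) (A x * evolution A x y) x :=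
  (isEvolution_evolution hA y).2 x

theorem hasDerivAt_evolution_mul {A : ℝ → Matrix ι ι ℂ} (hA : Continuous A) (x y : ℝ)
    (Ξ : Matrix ι κ ℂ) :
    HasDerivAt (fun s => evolution A s y * Ξ) (A x * (evolution A x y * Ξ)) x := by
  have := hasDerivAt_matrix_mul (hasDerivAt_evolution hA x y) (hasDerivAt_const x Ξ)
  simpa [Matrix.mul_assoc] using this

theorem eq_evolution_mul {A : ℝ → Matrix ι ι ℂ} (hA : Continuous A) {W : ℝ → Matrix ι κ ℂ}
    (hW : ∀ x, HasDerivAt W (A x * W x) x) (x y : ℝ) : W x = evolution A x y * W y := by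
  have := matrixODE_unique hA (F := fun _ => 0) (W := W) (Z := fun s => evolution A s y * W y)
    (fun s => by simpa using hW s)
    (fun s => by simpa using hasDerivAt_evolution_mul hA s y (W y)) (y := y)
    (by rw [evolution_self hA, Matrix.one_mul])
  exact congrFun this x

theorem evolution_mul_evolution {A : ℝ → Matrix ι ι ℂ} (hA : Continuous A) (x y z : ℝ) :
    evolution A x y * evolution A y z = evolution A x z :=
  (eq_evolution_mul hA (fun s => hasDerivAt_evolution hA s z) x y).symm

theorem evolution_mul_cancel {κ : Type*} {A : ℝ → Matrix ι ι ℂ} (hA : Continuous A) (x y : ℝ)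
    (Ξ : Matrix ι κ ℂ) : evolution A x y * (evolution A y x * Ξ) = Ξ := by
  rw [← Matrix.mul_assoc, evolution_mul_evolution hA, evolution_self hA, Matrix.one_mul]

theorem continuous_evolution {A : ℝ → Matrix ι ι ℂ} (hA : Continuous A) (y : ℝ) :
    Continuous fun x => evolution A x y :=
  continuous_iff_continuousAt.2 fun x => (hasDerivAt_evolution hA x y).continuousAt

theorem norm_evolution_le {A : ℝ → Matrix ι ι ℂ} (hA : Continuous A) {M R : ℝ}
    (hM : ∀ x, ‖A x‖ ≤ M) {x y : ℝ} (hxy : |x - y| ≤ R) :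
    ‖evolution A x y‖ ≤ ‖(1 : Matrix ι ι ℂ)‖ * Real.exp (M * R) := by
  have := gronwall_two_sided (w := fun s => evolution A (s + y) y) (R := R) (δ := 0)
    ((norm_nonneg _).trans (hM 0)) le_rfl
    (fun s => (hasDerivAt_evolution hA (s + y) y).comp_add_const s y)
    (fun s _ => (Matrix.linfty_opNorm_mul _ _).trans (by
      rw [add_zero]; gcongr; exact hM _)) (x - y) hxy
  simpa [evolution_self hA] using this

end MatrixODE

/-! ### A priori estimates -/

section APriori

variable {ι κ : Type*} [Fintype ι] [Fintype κ]

/-- Bounded solutions of `W' = A W + F` with `W` valued in `ι × κ` matrices are bounded by `C`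
times the bound of `F`. -/
def APriori (A : ℝ → Matrix ι ι ℂ) (κ : Type*) [Fintype κ] (C : ℝ) : Prop :=
  ∀ (W F : ℝ → Matrix ι κ ℂ) (B δ : ℝ), (∀ x, HasDerivAt W (A x * W x + F x) x) →
    (∀ x, ‖W x‖ ≤ B) → (∀ x, ‖F x‖ ≤ δ) → ∀ x, ‖W x‖ ≤ C * δ

/-- By linearity one may divide by `sup ‖W‖`. If `sup ‖W‖` exceeded `δ / η`, the rescaled solution
would have forcing at most `η`, and its supremum `1` would be at most `1/2`. The hypothesis is in
the form whose negation yields normalized sequences for compactness arguments. -/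
theorem apriori_of_normalized {A : ℝ → Matrix ι ι ℂ} {η : ℝ} (hη : 0 < η)
    (h : ∀ W F : ℝ → Matrix ι κ ℂ, (∀ x, HasDerivAt W (A x * W x + F x) x) →
      (∀ x, ‖W x‖ ≤ 1) → (∀ x, ‖F x‖ ≤ η) → ∀ x, ‖W x‖ ≤ 1 / 2) :
    APriori A κ (1 / η) := by
  intro W F B δ hW hB hF
  have hδ : 0 ≤ δ := (norm_nonneg _).trans (hF 0)
  set s := ⨆ x, ‖W x‖
  have hbdd : BddAbove (range fun x => ‖W x‖) := ⟨B, by rintro _ ⟨x, rfl⟩; exact hB x⟩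
  have hs : ∀ x, ‖W x‖ ≤ s := fun x => le_ciSup hbdd x
  suffices s ≤ 1 / η * δ from fun x => (hs x).trans this
  by_contra hlt
  rw [not_le] at hlt
  have hs0 : 0 < s := lt_of_le_of_lt (by positivity) hlt
  have h1 := h (fun x => s⁻¹ • W x) (fun x => s⁻¹ • F x)
    (fun x => ((hW x).const_smul s⁻¹).congr_deriv (by rw [smul_add, Matrix.mul_smul]))
    (fun x => by
      rw [norm_smul, Real.norm_of_nonneg (inv_nonneg.2 hs0.le), inv_mul_le_iff₀ hs0, mul_one]
      exact hs x)
    (fun x => by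
      rw [norm_smul, Real.norm_of_nonneg (inv_nonneg.2 hs0.le), inv_mul_le_iff₀ hs0]
      refine (hF x).trans ?_
      rw [one_div, inv_mul_lt_iff₀ hη] at hlt
      linarith)
  have h2 : s ≤ s / 2 := ciSup_le fun x => by
    have := h1 x
    rw [norm_smul, Real.norm_of_nonneg (inv_nonneg.2 hs0.le), inv_mul_le_iff₀ hs0] at this
    linarith
  linarith

namespace APriori

variable {A : ℝ → Matrix ι ι ℂ} {C : ℝ}

/-- A forcing term proportional to `‖W‖` is moved to the left-hand side after taking suprema; this
is legitimate because `W` is bounded beforehand. -/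
theorem absorb (hA : APriori A κ C) {k : ℝ} (hk : 0 ≤ k) (hCk : C * k ≤ 1 / 2)
    {W F : ℝ → Matrix ι κ ℂ} {B δ : ℝ} (hW : ∀ x, HasDerivAt W (A x * W x + F x) x)
    (hB : ∀ x, ‖W x‖ ≤ B) (hF : ∀ x, ‖F x‖ ≤ δ + k * ‖W x‖) (x : ℝ) : ‖W x‖ ≤ 2 * C * δ := by
  set s := ⨆ x, ‖W x‖
  have hbdd : BddAbove (range fun x => ‖W x‖) := ⟨B, by rintro _ ⟨x, rfl⟩; exact hB x⟩
  have hs : ∀ x, ‖W x‖ ≤ s := fun x => le_ciSup hbdd x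
  have h1 := hA W F B (δ + k * s) hW hB fun x => (hF x).trans (by gcongr; exact hs x)
  have h2 : s ≤ C * (δ + k * s) := ciSup_le h1
  have hs0 : 0 ≤ s := (norm_nonneg _).trans (hs 0)
  have h3 : C * k * s ≤ 1 / 2 * s := by gcongr
  refine (hs x).trans ?_
  linarith

/-- Robustness: the change of coefficient matrix is treated as a forcing `(A' - A) W` and absorbed.
-/
theorem perturb (hA : APriori A κ C) {k : ℝ} (hk : 0 ≤ k) (hCk : C * k ≤ 1 / 2)
    {A' : ℝ → Matrix ι ι ℂ} (h : ∀ x, ‖A' x - A x‖ ≤ k) : APriori A' κ (2 * C) := by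
  intro W F B δ hW hB hF
  refine hA.absorb hk hCk (F := fun x => F x + (A' x - A x) * W x)
    (fun x => (hW x).congr_deriv ?_) hB fun x => ?_
  · rw [Matrix.sub_mul]; abel
  · refine (norm_add_le _ _).trans (add_le_add (hF x) ((Matrix.linfty_opNorm_mul _ _).trans ?_))
    gcongr
    exact h x

/-- `g W` solves the same equation with the additional forcing `g' W`. A weight with small
logarithmic derivative is therefore harmless, as long as `g W` is known to be bounded. -/
theorem weighted (hA : APriori A κ C) {k₁ k₂ : ℝ} (hk₁ : 0 ≤ k₁) (hk₂ : 0 ≤ k₂)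
    (hCk : C * (k₁ + k₂) ≤ 1 / 2) {W F : ℝ → Matrix ι κ ℂ} {B δ : ℝ}
    (hW : ∀ x, HasDerivAt W (A x * W x + F x) x) {g g' : ℝ → ℝ} (hg : ∀ x, HasDerivAt g (g' x) x)
    (hg0 : ∀ x, 0 < g x) (hg' : ∀ x, |g' x| ≤ k₁ * g x) (hB : ∀ x, ‖g x • W x‖ ≤ B)
    (hF : ∀ x, ‖g x • F x‖ ≤ δ + k₂ * ‖g x • W x‖) (x : ℝ) : g x * ‖W x‖ ≤ 2 * C * δ := by
  have := hA.absorb (add_nonneg hk₁ hk₂) hCk (W := fun x => g x • W x)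
    (F := fun x => g' x • W x + g x • F x) (B := B) (δ := δ)
    (fun x => ((hg x).smul (hW x)).congr_deriv ?_) hB (fun x => ?_) x
  · rwa [norm_smul, Real.norm_of_nonneg (hg0 x).le] at this
  · rw [smul_add, Matrix.mul_smul]; abel
  · refine (norm_add_le _ _).trans ?_
    have h1 : ‖g' x • W x‖ ≤ k₁ * ‖g x • W x‖ := by
      rw [norm_smul, norm_smul, Real.norm_of_nonneg (hg0 x).le, Real.norm_eq_abs, ← mul_assoc]
      gcongr
      exact hg' x
    linarith [hF x]

/-- Exponentially localized forcing produces exponentially localized bounded solutions. -/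
theorem exp_localized (hA : APriori A κ C) (hC : 0 ≤ C) {k : ℝ} (hk : 0 ≤ k)
    (hCk : C * k ≤ 1 / 2) {W F : ℝ → Matrix ι κ ℂ} {B δ y : ℝ} (hδ : 0 ≤ δ)
    (hW : ∀ x, HasDerivAt W (A x * W x + F x) x) (hB : ∀ x, ‖W x‖ ≤ B)
    (hF : ∀ x, ‖F x‖ ≤ δ * Real.exp (-k * |x - y|)) (x : ℝ) :
    ‖W x‖ ≤ 2 * C * (δ * Real.exp k) * Real.exp (-k * |x - y|) := by
  -- A smooth replacement for `|x - y|`: it lies between `|x - y|` and `1 + |x - y|` and has slope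
  -- at most one. The upper bound costs the factor `exp k`.
  set s : ℝ → ℝ := fun x => √(1 + (x - y) ^ 2) with hs
  have hsq : ∀ x, 0 < 1 + (x - y) ^ 2 := fun x => by positivity
  have hs' : ∀ x, HasDerivAt s ((x - y) / s x) x := fun x => by
    have h1 : HasDerivAt (fun x : ℝ => 1 + (x - y) ^ 2) (2 * (x - y)) x := by
      have := (((hasDerivAt_id x).sub_const y).pow 2).const_add 1
      simpa using this
    exact (h1.sqrt (hsq x).ne').congr_deriv (by
      simp only [hs]; rw [mul_div_mul_left _ _ two_ne_zero])
  have hs1 : ∀ x, |x - y| ≤ s x := fun x => Real.abs_le_sqrt (by linarith)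
  have hs2 : ∀ x, s x ≤ 1 + |x - y| := fun x => by
    rw [hs, Real.sqrt_le_left (by positivity)]
    nlinarith [abs_nonneg (x - y), sq_abs (x - y)]
  have hs0 : ∀ x, 0 < s x := fun x => Real.sqrt_pos.2 (hsq x)
  -- The weight `1 / (exp (-k s) + r)` is bounded by `1 / r`, so the weighted solution is bounded a
  -- priori; the resulting estimate does not degenerate as `r → 0`.
  have key : ∀ r > 0, ‖W x‖ ≤ 2 * C * (δ * Real.exp k) * (Real.exp (-k * s x) + r) := by
    intro r hr
    have hpos : ∀ x, 0 < Real.exp (-k * s x) + r := fun x => by positivity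
    have h := hA.weighted hk le_rfl (k₁ := k) (k₂ := 0) (by simpa using hCk) hW
      (g := fun x => (Real.exp (-k * s x) + r)⁻¹)
      (g' := fun x => -(Real.exp (-k * s x) * (-k * ((x - y) / s x))) /
        (Real.exp (-k * s x) + r) ^ 2) (B := r⁻¹ * B) (δ := δ * Real.exp k)
      (fun x => (((hs' x).const_mul (-k)).exp.add_const r).inv (hpos x).ne')
      (fun x => inv_pos.2 (hpos x)) (fun x => ?_) (fun x => ?_) (fun x => ?_) x
    · rwa [inv_mul_le_iff₀ (hpos x), mul_comm] at h
    · have h1 : |(x - y) / s x| ≤ 1 := by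
        rw [abs_div, abs_of_pos (hs0 x), div_le_one (hs0 x)]; exact hs1 x
      rw [abs_div, abs_neg, abs_mul, abs_mul, abs_neg, abs_of_nonneg hk, Real.abs_exp,
        abs_of_pos (pow_pos (hpos x) 2), div_le_iff₀ (pow_pos (hpos x) 2)]
      have h2 : k * (Real.exp (-k * s x) + r)⁻¹ * (Real.exp (-k * s x) + r) ^ 2
          = (Real.exp (-k * s x) + r) * (k * 1) := by
        field_simp [(hpos x).ne']
      rw [h2]
      gcongr
      linarith
    · rw [norm_smul, Real.norm_of_nonneg (inv_pos.2 (hpos x)).le]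
      have hB0 : 0 ≤ B := (norm_nonneg _).trans (hB 0)
      gcongr
      · linarith [Real.exp_pos (-k * s x)]
      · exact hB x
    · rw [norm_smul, Real.norm_of_nonneg (inv_pos.2 (hpos x)).le, zero_mul, add_zero,
        inv_mul_le_iff₀ (hpos x)]
      refine (hF x).trans ?_
      have h1 : Real.exp (-k * |x - y|) ≤ Real.exp k * Real.exp (-k * s x) := by
        rw [← Real.exp_add, Real.exp_le_exp]
        nlinarith [hs2 x]
      have h2 : δ * Real.exp (-k * |x - y|) ≤ δ * (Real.exp k * Real.exp (-k * s x)) := by gcongr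
      have h3 : 0 ≤ r * (δ * Real.exp k) := by positivity
      linarith
  have h1 : Tendsto (fun r : ℝ => 2 * C * (δ * Real.exp k) * (Real.exp (-k * s x) + r)) (𝓝[>] 0)
      (𝓝 (2 * C * (δ * Real.exp k) * (Real.exp (-k * s x) + 0))) :=
    ((Continuous.tendsto (by fun_prop) 0)).mono_left nhdsWithin_le_nhds
  have h2 := ge_of_tendsto h1 (eventually_mem_nhdsWithin.mono fun r hr => key r hr)
  refine h2.trans ?_
  rw [add_zero]
  have h3 := mul_le_mul_of_nonneg_left (hs1 x) hk
  gcongr 2 * C * (δ * Real.exp k) * Real.exp ?_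
  linarith

end APriori

end APriori


/-! ### Limits of solutions -/

section Limits

variable {ι κ J : Type*} [Fintype ι] [Fintype κ]

/-- Locally uniform convergence of functions of a real variable. -/
def LocUnif {E : Type*} [NormedAddCommGroup E] (l : Filter J) (Ak : J → ℝ → E) (A : ℝ → E) : Prop :=
  ∀ R : ℝ, ∀ t > 0, ∀ᶠ j in l, ∀ x, |x| ≤ R → ‖Ak j x - A x‖ ≤ t

theorem tendsto_matrixODE {l : Filter J} {Ak : J → ℝ → Matrix ι ι ℂ} {A : ℝ → Matrix ι ι ℂ}
    (hA : Continuous A) (hAk : LocUnif l Ak A) {Fk : J → ℝ → Matrix ι κ ℂ}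
    {F : ℝ → Matrix ι κ ℂ} (hFk : LocUnif l Fk F) {Wk : J → ℝ → Matrix ι κ ℂ}
    {W : ℝ → Matrix ι κ ℂ} (hWk : ∀ᶠ j in l, ∀ x, HasDerivAt (Wk j) (Ak j x * Wk j x + Fk j x) x)
    (hW : ∀ x, HasDerivAt W (A x * W x + F x) x)
    (h0 : Tendsto (fun j => Wk j 0) l (𝓝 (W 0))) (x : ℝ) :
    Tendsto (fun j => Wk j x) l (𝓝 (W x)) := by
  have hWc : Continuous W := continuous_iff_continuousAt.2 fun x => (hW x).continuousAt
  obtain ⟨M, hM⟩ := (isCompact_Icc (a := -|x|) (b := |x|)).exists_bound_of_continuousOn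
    hA.continuousOn
  obtain ⟨B, hB⟩ := (isCompact_Icc (a := -|x|) (b := |x|)).exists_bound_of_continuousOn
    hWc.continuousOn
  have hM0 : 0 ≤ M := (norm_nonneg _).trans (hM 0 (by simp))
  have hB0 : 0 ≤ B := (norm_nonneg _).trans (hB 0 (by simp))
  replace h0 := tendsto_iff_norm_sub_tendsto_zero.1 h0
  refine tendsto_iff_norm_sub_tendsto_zero.2 ?_
  rw [Metric.tendsto_nhds] at h0 ⊢
  intro t ht
  obtain ⟨s, hs, hst⟩ : ∃ s > 0, (s + (s * B + s) * |x|) * Real.exp ((M + 1) * |x|) < t := by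
    have : Tendsto (fun s : ℝ => (s + (s * B + s) * |x|) * Real.exp ((M + 1) * |x|)) (𝓝[>] 0)
        (𝓝 ((0 + (0 * B + 0) * |x|) * Real.exp ((M + 1) * |x|))) :=
      (Continuous.tendsto (by fun_prop) 0).mono_left nhdsWithin_le_nhds
    have h1 := this.eventually_lt_const (u := t) (by simpa using ht)
    obtain ⟨s, h2, h3⟩ := (h1.and eventually_mem_nhdsWithin).exists
    exact ⟨s, h3, h2⟩
  filter_upwards [h0 s hs, hAk |x| (min s 1) (by positivity), hFk |x| s hs, hWk]
    with j hj0 hjA hjF hjW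
  have hd := gronwall_two_sided (w := fun y => Wk j y - W y) (M := M + 1) (δ := s * B + s)
    (R := |x|) (by positivity) (by positivity) (fun y => (hjW y).sub (hW y)) (fun y hy => ?_)
    x le_rfl
  · rw [Real.dist_0_eq_abs, abs_of_nonneg (norm_nonneg _)] at hj0 ⊢
    refine hd.trans_lt (lt_of_le_of_lt ?_ hst)
    gcongr
  · have hy' := abs_le.1 hy
    have e : Ak j y * Wk j y + Fk j y - (A y * W y + F y)
        = Ak j y * (Wk j y - W y) + ((Ak j y - A y) * W y + (Fk j y - F y)) := by
      rw [Matrix.mul_sub, Matrix.sub_mul]; abel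
    rw [e]
    have hA1 : ‖Ak j y‖ ≤ M + 1 := by
      have h1 := norm_le_norm_add_norm_sub' (Ak j y) (A y)
      linarith [hM y hy', hjA y hy, min_le_right s 1]
    have t1 : ‖Ak j y * (Wk j y - W y)‖ ≤ (M + 1) * ‖Wk j y - W y‖ :=
      (Matrix.linfty_opNorm_mul _ _).trans (by gcongr)
    have t2 : ‖(Ak j y - A y) * W y‖ ≤ s * B :=
      (Matrix.linfty_opNorm_mul _ _).trans (by
        gcongr
        · exact (hjA y hy).trans (min_le_left _ _)
        · exact hB y hy')
    exact (norm_add_le _ _).trans (add_le_add t1 ((norm_add_le _ _).trans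
      (add_le_add t2 (hjF y hy))))

/-- Initial values in a bounded set of a finite-dimensional space converge along any ultrafilter,
which replaces the extraction of subsequences; continuous dependence does the rest. -/
theorem exists_ultralimit_solution {l : Ultrafilter J} {Ak : J → ℝ → Matrix ι ι ℂ}
    {A : ℝ → Matrix ι ι ℂ} (hA : Continuous A) (hAk : LocUnif l Ak A)
    {Fk : J → ℝ → Matrix ι κ ℂ} {F : ℝ → Matrix ι κ ℂ} (hF : Continuous F)
    (hFk : LocUnif l Fk F) {Wk : J → ℝ → Matrix ι κ ℂ}
    (hWk : ∀ᶠ j in (l : Filter J), ∀ x, HasDerivAt (Wk j) (Ak j x * Wk j x + Fk j x) x) {B : ℝ}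
    (hB : ∀ᶠ j in (l : Filter J), ‖Wk j 0‖ ≤ B) :
    ∃ W : ℝ → Matrix ι κ ℂ, (∀ x, HasDerivAt W (A x * W x + F x) x) ∧
      ∀ x, Tendsto (fun j => Wk j x) l (𝓝 (W x)) := by
  have : ProperSpace (Matrix ι κ ℂ) := FiniteDimensional.proper ℂ _
  obtain ⟨Ξ, -, hΞ⟩ := (isCompact_closedBall (0 : Matrix ι κ ℂ) B).ultrafilter_le_nhds'
    (l.map fun j => Wk j 0) (by
      change ∀ᶠ j in (l : Filter J), Wk j 0 ∈ Metric.closedBall 0 B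
      filter_upwards [hB] with j hj
      simpa using hj)
  obtain ⟨W, hW0, hW⟩ := exists_matrixODE hA hF 0 Ξ
  exact ⟨W, hW, tendsto_matrixODE hA hAk hFk hWk hW (by rw [hW0]; exact hΞ)⟩

/-- Normalized approximate bounded solutions converge to a nonzero bounded solution of the
limit equation. -/
theorem exists_bounded_solution_of_approx {l : Ultrafilter J} {Ak : J → ℝ → Matrix ι ι ℂ}
    {A : ℝ → Matrix ι ι ℂ} (hA : Continuous A) (hAk : LocUnif l Ak A)
    {Wk Fk : J → ℝ → Matrix ι κ ℂ} {η : J → ℝ} (hη : Tendsto η l (𝓝 0))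
    (hWk : ∀ j x, HasDerivAt (Wk j) (Ak j x * Wk j x + Fk j x) x)
    (h1 : ∀ j x, ‖Wk j x‖ ≤ 1) (hF : ∀ j x, ‖Fk j x‖ ≤ η j) (h2 : ∀ j, 1 / 2 < ‖Wk j 0‖) :
    ∃ W : ℝ → Matrix ι κ ℂ, (∀ x, HasDerivAt W (A x * W x) x) ∧ (∀ x, ‖W x‖ ≤ 1) ∧ W ≠ 0 := by
  obtain ⟨W, hW, hlim⟩ := exists_ultralimit_solution hA hAk (F := fun _ => 0) continuous_const
    (fun R t ht => by
      filter_upwards [hη.eventually (gt_mem_nhds ht)] with j hj x _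
      rw [sub_zero]
      exact (hF j x).trans hj.le) (Eventually.of_forall hWk)
    (Eventually.of_forall fun j => h1 j 0)
  refine ⟨W, fun x => by simpa using hW x, fun x => ?_, fun h => ?_⟩
  · exact le_of_tendsto (hlim x).norm (Eventually.of_forall fun j => h1 j x)
  · have := ge_of_tendsto (hlim 0).norm (Eventually.of_forall fun j => (h2 j).le)
    rw [h] at this
    norm_num at this

end Limits

/-! ### Constant coefficients -/

section Constant

variable {ι κ : Type*} [Fintype ι] [Fintype κ]

/-- The solutions are multiples of `exp (μ x)`, whose modulus takes every positive value when `μ` is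
off the imaginary axis. -/
theorem eq_zero_of_bounded_of_hasDerivAt_smul {μ : ℂ} (hμ : μ.re ≠ 0) {Z : ℝ → Matrix ι κ ℂ}
    (hZ : ∀ x, HasDerivAt Z (μ • Z x) x) {B : ℝ} (hB : ∀ x, ‖Z x‖ ≤ B) : Z = 0 := by
  have key : ∀ x, Z x = Complex.exp (μ * x) • Z 0 := by
    have hd : ∀ x : ℝ, HasDerivAt (fun x : ℝ => Complex.exp (-(μ * x)) • Z x) 0 x := fun x => by
      have h1 : HasDerivAt (fun x : ℝ => Complex.exp (-(μ * x)))
          (Complex.exp (-(μ * x)) * -(μ * 1)) x :=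
        ((Complex.ofRealCLM.hasDerivAt (x := x)).const_mul μ).neg.cexp
      refine (h1.smul (hZ x)).congr_deriv ?_
      rw [smul_smul, ← add_smul]
      ring_nf
      simp
    intro x
    have h := is_const_of_deriv_eq_zero (fun x => (hd x).differentiableAt)
      (fun x => (hd x).deriv) x 0
    simp only [Complex.ofReal_zero, mul_zero, neg_zero, Complex.exp_zero, one_smul] at h
    rw [← h, smul_smul, ← Complex.exp_add]
    simp
  have h0 : Z 0 = 0 := by
    by_contra hne
    have hpos : 0 < ‖Z 0‖ := norm_pos_iff.2 hne
    have hb : ∀ t : ℝ, Real.exp t * ‖Z 0‖ ≤ B := fun t => by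
      have := hB (t / μ.re)
      rw [key, norm_smul, Complex.norm_exp] at this
      have e : (μ * ((t / μ.re : ℝ) : ℂ)).re = t := by
        rw [Complex.re_mul_ofReal]; field_simp
      rwa [e] at this
    have h1 := hb (B / ‖Z 0‖)
    have h2 := Real.add_one_le_exp (B / ‖Z 0‖)
    have h3 : (B / ‖Z 0‖ + 1) * ‖Z 0‖ ≤ B := (by gcongr : _ ≤ _).trans h1
    rw [add_mul, div_mul_cancel₀ _ hpos.ne'] at h3
    linarith
  funext x
  rw [key, h0, smul_zero]; rfl

variable [DecidableEq ι]

open Polynomial in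
-- Cayley–Hamilton instead of the Jordan form: a product of factors `A - μ` over all characteristic
-- roots annihilates `W`. Factors are removed one at a time: if `(A - μ) Q W = 0`, then `Z = Q W` is
-- bounded and solves `Z' = μ Z`, so it vanishes, and `Q` already annihilates `W`.
theorem eq_zero_of_bounded_of_hyperbolic {A : Matrix ι ι ℂ}
    (hA : ∀ μ ∈ spectrum ℂ A, μ.re ≠ 0) {W : ℝ → Matrix ι κ ℂ}
    (hW : ∀ x, HasDerivAt W (A * W x) x) {B : ℝ} (hB : ∀ x, ‖W x‖ ≤ B) : W = 0 := by
  have key : ∀ s : Multiset ℂ, (∀ μ ∈ s, μ.re ≠ 0) → ∀ W : ℝ → Matrix ι κ ℂ,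
      (∀ x, HasDerivAt W (A * W x) x) → (∃ B, ∀ x, ‖W x‖ ≤ B) →
      (∀ x, aeval A (s.map fun μ => X - C μ).prod * W x = 0) → W = 0 := by
    intro s
    induction s using Multiset.induction_on with
    | empty =>
      intro _ W _ _ h
      funext x
      simpa using h x
    | cons μ s ih =>
      rintro hs W hW ⟨B, hB⟩ h
      set Q := aeval A (s.map fun μ => X - C μ).prod with hQ
      have hcomm : Q * A = A * Q := by
        have := Commute.all (s.map fun μ => X - C μ).prod (X : ℂ[X])
        have := congrArg (aeval A) this.eq
        simpa using this
      refine ih (fun ν hν => hs ν (Multiset.mem_cons_of_mem hν)) W hW ⟨B, hB⟩ fun x => ?_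
      have hZ : ∀ x, HasDerivAt (fun x => Q * W x) (A * (Q * W x)) x := fun x => by
        refine (hasDerivAt_matrix_mul (hasDerivAt_const x Q) (hW x)).congr_deriv ?_
        rw [Matrix.zero_mul, zero_add, ← Matrix.mul_assoc, hcomm, Matrix.mul_assoc]
      have hZ' : ∀ x, A * (Q * W x) = μ • (Q * W x) := fun x => by
        have := h x
        rw [Multiset.map_cons, Multiset.prod_cons, map_mul, ← hQ, map_sub, aeval_X, aeval_C,
          Matrix.mul_assoc, Matrix.sub_mul, Algebra.algebraMap_eq_smul_one, Matrix.smul_mul,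
          Matrix.one_mul] at this
        exact sub_eq_zero.1 this
      have := eq_zero_of_bounded_of_hasDerivAt_smul (hs μ (Multiset.mem_cons_self _ _))
        (fun x => (hZ x).congr_deriv (hZ' x)) (B := ‖Q‖ * B) fun x =>
          (Matrix.linfty_opNorm_mul _ _).trans (by gcongr; exact hB x)
      exact congrFun this x
  refine key A.charpoly.roots (fun μ hμ => hA μ ?_) W hW ⟨B, hB⟩ fun x => ?_
  · rw [Matrix.mem_spectrum_iff_isRoot_charpoly]
    exact (mem_roots'.1 hμ).2
  · have h := (IsAlgClosed.splits A.charpoly).eq_prod_roots_of_monic A.charpoly_monic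
    rw [← h, Matrix.aeval_self_charpoly, Matrix.zero_mul]

/-- If every constant failed, normalized solutions with forcing at most `1/(j+1)`, translated to be
larger than `1/2` at the origin, would have a nonzero bounded limit solving the homogeneous
equation. -/
theorem exists_apriori_of_hyperbolic (κ : Type*) [Fintype κ] {A : Matrix ι ι ℂ}
    (hA : ∀ μ ∈ spectrum ℂ A, μ.re ≠ 0) : ∃ C, 0 ≤ C ∧ APriori (fun _ => A) κ C := by
  by_contra hcon
  push Not at hcon
  have h : ∀ j : ℕ, ∃ W F : ℝ → Matrix ι κ ℂ, (∀ x, HasDerivAt W (A * W x + F x) x) ∧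
      (∀ x, ‖W x‖ ≤ 1) ∧ (∀ x, ‖F x‖ ≤ 1 / ((j : ℝ) + 1)) ∧ 1 / 2 < ‖W 0‖ := by
    intro j
    have hj : (0 : ℝ) < 1 / ((j : ℝ) + 1) := by positivity
    by_contra hno
    push Not at hno
    refine hcon _ (by positivity) (apriori_of_normalized hj fun W F hW h1 hF x => ?_)
    have := hno (fun s => W (s + x)) (fun s => F (s + x))
      (fun s => (hW (s + x)).comp_add_const s x) (fun s => h1 _) (fun s => hF _)
    simpa using this
  choose W F hW h1 hF h2 using h
  obtain ⟨Z, hZ, hZ1, hZ0⟩ := exists_bounded_solution_of_approx (l := hyperfilter ℕ)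
    (Ak := fun _ _ => A) (A := fun _ => A) continuous_const
    (fun R t ht => Eventually.of_forall fun j x _ => by simpa using ht.le)
    (tendsto_one_div_add_atTop_nhds_zero_nat.mono_left Nat.hyperfilter_le_atTop) hW h1 hF h2
  exact hZ0 (eq_zero_of_bounded_of_hyperbolic hA hZ hZ1)

end Constant


/-! ### Periodic solutions and bounded solutions on the line -/

section Periodic

variable {ι κ : Type*} [Fintype ι] [Fintype κ]

theorem periodic_of_eq {A : ℝ → Matrix ι ι ℂ} (hA : Continuous A) {T : ℝ}
    (hAT : ∀ x, A (x + T) = A x) {F W : ℝ → Matrix ι κ ℂ} (hFT : ∀ x, F (x + T) = F x)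
    (hW : ∀ x, HasDerivAt W (A x * W x + F x) x) (h : W T = W 0) (x : ℝ) : W (x + T) = W x := by
  have := matrixODE_unique hA (F := F) (W := fun s => W (s + T)) (Z := W)
    (fun s => by
      have := (hW (s + T)).comp_add_const s T
      rwa [hAT, hFT] at this) hW (y := 0) (by simpa using h)
  exact congrFun this x

theorem exists_bound_of_periodic {E : Type*} [NormedAddCommGroup E] {f : ℝ → E}
    (hf : Continuous f) {T : ℝ} (hT : T ≠ 0) (hfT : ∀ x, f (x + T) = f x) :
    ∃ B, ∀ x, ‖f x‖ ≤ B := by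
  obtain ⟨B, hB⟩ := (Function.Periodic.isBounded_of_continuous (f := f) hfT hT hf).exists_norm_le
  exact ⟨B, fun x => hB _ (mem_range_self x)⟩

/-- Fredholm alternative for periodic systems. -/
theorem exists_periodic_solution {A : ℝ → Matrix ι ι ℂ} (hA : Continuous A) {T : ℝ} (hT : T ≠ 0)
    (hAT : ∀ x, A (x + T) = A x) {C : ℝ} (hap : APriori A κ C) {F : ℝ → Matrix ι κ ℂ}
    (hF : Continuous F) (hFT : ∀ x, F (x + T) = F x) :
    ∃ W : ℝ → Matrix ι κ ℂ, (∀ x, HasDerivAt W (A x * W x + F x) x) ∧ ∀ x, W (x + T) = W x := by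
  classical
  obtain ⟨Wp, hWp0, hWp⟩ := exists_matrixODE hA hF 0 0
  -- A solution is periodic exactly when its initial value `Ξ` satisfies `T(T,0) Ξ - Ξ = -Wp T`. The
  -- a priori estimate with zero forcing makes this linear map injective, hence surjective in finite
  -- dimension.
  let Φ : Matrix ι κ ℂ →ₗ[ℂ] Matrix ι κ ℂ :=
    { toFun := fun Ξ => evolution A T 0 * Ξ - Ξ
      map_add' := fun a b => by rw [Matrix.mul_add]; abel
      map_smul' := fun c a => by rw [Matrix.mul_smul, RingHom.id_apply, smul_sub] }
  have hinj : Function.Injective Φ := by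
    rw [injective_iff_map_eq_zero]
    intro Ξ hΞ
    have hsol : ∀ x, HasDerivAt (fun s => evolution A s 0 * Ξ)
        (A x * (evolution A x 0 * Ξ) + 0) x := fun x => by
      rw [add_zero]; exact hasDerivAt_evolution_mul hA x 0 Ξ
    have hper := periodic_of_eq hA hAT (F := fun _ => 0) (fun _ => rfl) hsol (by
      rw [evolution_self hA, Matrix.one_mul]; exact sub_eq_zero.1 hΞ)
    obtain ⟨B, hB⟩ := exists_bound_of_periodic (f := fun s => evolution A s 0 * Ξ)
      (continuous_iff_continuousAt.2 fun x => (hsol x).continuousAt) hT hper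
    have := hap _ (fun _ => 0) B 0 hsol hB (fun _ => by simp) 0
    simpa [evolution_self hA] using this
  obtain ⟨Ξ, hΞ⟩ := (LinearMap.injective_iff_surjective.1 hinj) (-Wp T)
  have hΞ' : evolution A T 0 * Ξ - Ξ = -Wp T := hΞ
  have hW : ∀ x, HasDerivAt (fun s => evolution A s 0 * Ξ + Wp s)
      (A x * (evolution A x 0 * Ξ + Wp x) + F x) x := fun x => by
    refine ((hasDerivAt_evolution_mul hA x 0 Ξ).add (hWp x)).congr_deriv ?_
    rw [Matrix.mul_add, add_assoc]
  refine ⟨_, hW, periodic_of_eq hA hAT hFT hW ?_⟩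
  rw [evolution_self hA, Matrix.one_mul, hWp0, add_zero]
  rw [sub_eq_iff_eq_add] at hΞ'
  rw [hΞ']; abel

/-- The periodic function takes only values of `f`, so bounds that are uniform on the line, in
particular closeness to a constant matrix, survive periodization. -/
theorem exists_periodization {X : Type*} [TopologicalSpace X] {L : ℝ} (hL : 0 < L) {f : ℝ → X}
    (hf : Continuous f) (h : f (-L) = f L) : ∃ g : ℝ → X, Continuous g ∧
      (∀ x, g (x + 2 * L) = g x) ∧ (∀ x, |x| ≤ L → g x = f x) ∧ ∀ x, ∃ y, g x = f y := by
  have : Fact (0 < 2 * L) := ⟨by positivity⟩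
  have hL' : -L + 2 * L = L := by ring
  refine ⟨fun x => AddCircle.liftIco (2 * L) (-L) f (x : AddCircle (2 * L)), ?_, ?_, ?_, ?_⟩
  · exact (AddCircle.liftIco_continuous (by rwa [hL']) hf.continuousOn).comp
      (AddCircle.continuous_mk' _)
  · intro x
    simp
  · intro x hx
    have hx' := abs_le.1 hx
    rcases eq_or_lt_of_le hx'.2 with rfl | hlt
    · have e : ((x : ℝ) : AddCircle (2 * x)) = ((-x : ℝ) : AddCircle (2 * x)) := by
        rw [← AddCircle.coe_add_period (2 * x) (-x), hL']
      simp only [e]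
      rw [AddCircle.liftIco_coe_apply ⟨le_rfl, by linarith⟩, h]
    · exact AddCircle.liftIco_coe_apply ⟨hx'.1, by rwa [hL']⟩
  · intro x
    exact ⟨_, rfl⟩

/-- For even coefficients close to a constant with an a priori estimate, compactly supported
forcing has a bounded response. -/
theorem exists_bounded_solution {A : ℝ → Matrix ι ι ℂ} (hA : Continuous A)
    (hev : ∀ x, A (-x) = A x) {A₀ : Matrix ι ι ℂ} {C k : ℝ} (hk : 0 ≤ k)
    (hCk : C * k ≤ 1 / 2) (hap : APriori (fun _ => A₀) κ C) (hAk : ∀ x, ‖A x - A₀‖ ≤ k)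
    {F : ℝ → Matrix ι κ ℂ} (hF : Continuous F) {R δ : ℝ} (hR : ∀ x, R ≤ |x| → F x = 0)
    (hδ : ∀ x, ‖F x‖ ≤ δ) :
    ∃ W : ℝ → Matrix ι κ ℂ, (∀ x, HasDerivAt W (A x * W x + F x) x) ∧
      ∀ x, ‖W x‖ ≤ 2 * C * δ := by
  -- Cells of half-length `|R| + 1 + j` exhaust the line. Evenness of `A` and the vanishing of `F`
  -- for `|x| ≥ R` let both be periodized continuously, and the periodic solutions have a common
  -- bound, so they have an ultralimit.
  have hL : ∀ j : ℕ, (0 : ℝ) < |R| + 1 + j := fun j => by positivity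
  choose Ak hAk1 hAk2 hAk3 hAk4 using fun j : ℕ => exists_periodization (hL j) hA (hev _)
  choose Fk hFk1 hFk2 hFk3 hFk4 using fun j : ℕ => exists_periodization (hL j) hF (by
    have h1 : R ≤ |(|R| + 1 + j)| := by
      rw [abs_of_pos (hL j)]
      have : (0 : ℝ) ≤ j := Nat.cast_nonneg j
      linarith [le_abs_self R]
    rw [hR _ h1, hR _ (by rwa [abs_neg])])
  have hapk : ∀ j, APriori (Ak j) κ (2 * C) := fun j => hap.perturb hk hCk fun x => by
    obtain ⟨y, hy⟩ := hAk4 j x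
    rw [hy]; exact hAk y
  choose Wk hWk hWkp using fun j => exists_periodic_solution (hAk1 j)
    (mul_pos two_pos (hL j)).ne' (hAk2 j) (hapk j) (hFk1 j) (hFk2 j)
  have hWb : ∀ j x, ‖Wk j x‖ ≤ 2 * C * δ := fun j => by
    obtain ⟨B, hB⟩ := exists_bound_of_periodic
      (continuous_iff_continuousAt.2 fun x => (hWk j x).continuousAt)
      (mul_pos two_pos (hL j)).ne' (hWkp j)
    refine hapk j _ _ B δ (hWk j) hB fun x => ?_
    obtain ⟨y, hy⟩ := hFk4 j x
    rw [hy]; exact hδ y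
  have hev : ∀ S : ℝ, ∀ᶠ j : ℕ in hyperfilter ℕ, ∀ x, |x| ≤ S → |x| ≤ |R| + 1 + j := fun S => by
    have : ∀ᶠ j : ℕ in atTop, S ≤ j := (tendsto_natCast_atTop_atTop).eventually_ge_atTop S
    filter_upwards [this.filter_mono Nat.hyperfilter_le_atTop] with j hj x hx
    linarith [abs_nonneg R]
  obtain ⟨W, hW, hlim⟩ := exists_ultralimit_solution (l := hyperfilter ℕ) (Ak := Ak) (Fk := Fk)
    (Wk := Wk) hA
    (fun S t ht => (hev S).mono fun j hj x hx => by
      rw [hAk3 j x (hj x hx), sub_self, norm_zero]; exact ht.le) hF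
    (fun S t ht => (hev S).mono fun j hj x hx => by
      rw [hFk3 j x (hj x hx), sub_self, norm_zero]; exact ht.le)
    (Eventually.of_forall hWk) (Eventually.of_forall fun j => hWb j 0)
  exact ⟨W, hW, fun x => le_of_tendsto (hlim x).norm (Eventually.of_forall fun j => hWb j x)⟩

end Periodic

/-! ### Exponential dichotomies -/

section Dichotomy

variable {ι : Type*} [Fintype ι] [DecidableEq ι]

theorem exists_smooth_step : ∃ θ θ' : ℝ → ℝ, (∀ x, HasDerivAt θ (θ' x) x) ∧ Continuous θ' ∧
    (∀ x ≤ 0, θ x = 0) ∧ (∀ x, 1 ≤ x → θ x = 1) ∧ (∀ x, 0 ≤ θ x ∧ θ x ≤ 1) ∧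
    (∀ x, x ∉ Icc (0 : ℝ) 1 → θ' x = 0) ∧ ∃ Θ, ∀ x, |θ' x| ≤ Θ := by
  have hd : Differentiable ℝ Real.smoothTransition :=
    (Real.smoothTransition.contDiff (n := 1)).differentiable one_ne_zero
  have hc : Continuous (deriv Real.smoothTransition) :=
    (Real.smoothTransition.contDiff (n := 1)).continuous_deriv_one
  have hz : ∀ x, x ∉ Icc (0 : ℝ) 1 → deriv Real.smoothTransition x = 0 := by
    intro x hx
    rw [mem_Icc, not_and_or, not_le, not_le] at hx
    rcases hx with hx | hx
    · have : Real.smoothTransition =ᶠ[𝓝 x] fun _ => 0 := by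
        filter_upwards [gt_mem_nhds hx] with y hy
        exact Real.smoothTransition.zero_of_nonpos (le_of_lt hy)
      rw [this.deriv_eq, deriv_const]
    · have : Real.smoothTransition =ᶠ[𝓝 x] fun _ => 1 := by
        filter_upwards [lt_mem_nhds hx] with y hy
        exact Real.smoothTransition.one_of_one_le (le_of_lt hy)
      rw [this.deriv_eq, deriv_const]
  obtain ⟨Θ, hΘ⟩ := (isCompact_Icc (a := (0 : ℝ)) (b := 1)).exists_bound_of_continuousOn
    hc.continuousOn
  refine ⟨Real.smoothTransition, deriv Real.smoothTransition, fun x => (hd x).hasDerivAt, hc,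
    fun x hx => Real.smoothTransition.zero_of_nonpos hx,
    fun x hx => Real.smoothTransition.one_of_one_le hx,
    fun x => ⟨Real.smoothTransition.nonneg x, Real.smoothTransition.le_one x⟩, hz, Θ, fun x => ?_⟩
  by_cases hx : x ∈ Icc (0 : ℝ) 1
  · exact hΘ x hx
  · rw [hz x hx, abs_zero]
    exact (norm_nonneg _).trans (hΘ 0 (by simp))

/-- The dichotomy projection on the line is determined by boundedness at both ends. -/
theorem eq_of_bounded_both_ends {A : ℝ → Matrix ι ι ℂ} (hA : Continuous A) {C : ℝ}
    (hap : APriori A ι C) {y : ℝ} {P Q : Matrix ι ι ℂ} {B : ℝ}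
    (hP : ∀ x, y ≤ x → ‖evolution A x y * P‖ ≤ B)
    (hP' : ∀ x, x ≤ y → ‖evolution A x y * (1 - P)‖ ≤ B)
    (hQ : ∀ x, y ≤ x → ‖evolution A x y * Q‖ ≤ B)
    (hQ' : ∀ x, x ≤ y → ‖evolution A x y * (1 - Q)‖ ≤ B) : P = Q := by
  have := hap (fun x => evolution A x y * (P - Q)) (fun _ => 0) (B + B) 0
    (fun x => by rw [add_zero]; exact hasDerivAt_evolution_mul hA x y _) (fun x => ?_)
    (fun _ => by simp) y
  · rw [evolution_self hA, Matrix.one_mul, mul_zero] at this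
    exact sub_eq_zero.1 (norm_le_zero_iff.1 this)
  · rcases le_total y x with h | h
    · rw [Matrix.mul_sub]
      exact (norm_sub_le _ _).trans (add_le_add (hP x h) (hQ x h))
    · have e : P - Q = (1 - Q) - (1 - P) := by abel
      rw [e, Matrix.mul_sub]
      exact (norm_sub_le _ _).trans (add_le_add (hQ' x h) (hP' x h))

/-- The Green's function is built from bounded solutions. For a step `θ` rising on `[0, 1]`, let `W
y` be the bounded response to `θ'(x - y) T(x, y)`, which is exponentially localized near `y`. Then
`θ(x - y) T(x, y) - W y` is a homogeneous solution starting at `-W y y`. With `P y = 1 + W y y` this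
shows that `T P` decays forward, where `θ` is eventually `1`, and `T (1 - P)` decays backward, where
`θ` is `0`. -/
theorem exists_dichotomy_line {A : ℝ → Matrix ι ι ℂ} (hA : Continuous A) {M : ℝ}
    (hM : ∀ x, ‖A x‖ ≤ M) {C : ℝ} (hC : 0 ≤ C) (hap : APriori A ι C)
    (hex : ∀ (F : ℝ → Matrix ι ι ℂ), Continuous F → (∃ R, ∀ x, R ≤ |x| → F x = 0) →
      ∃ W : ℝ → Matrix ι ι ℂ, (∀ x, HasDerivAt W (A x * W x + F x) x) ∧ ∃ B, ∀ x, ‖W x‖ ≤ B) :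
    ∃ K μ P, HasExpDichotomy A univ K μ P := by
  obtain ⟨θ, θ', hθ, hθc, hθ0, hθ1, hθb, hθs, Θ, hΘ⟩ := exists_smooth_step
  have hΘ0 : 0 ≤ Θ := (abs_nonneg _).trans (hΘ 0)
  set N := ‖(1 : Matrix ι ι ℂ)‖ * Real.exp (M * 1) with hN
  have hN0 : 0 ≤ N := by positivity
  set k := 1 / (2 * (C + 1)) with hk
  have hk0 : 0 < k := by positivity
  have hCk : C * k ≤ 1 / 2 := by
    rw [hk, mul_one_div, div_le_div_iff₀ (by positivity) two_pos]; linarith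
  set F : ℝ → ℝ → Matrix ι ι ℂ := fun y x => θ' (x - y) • evolution A x y with hF
  have hFc : ∀ y, Continuous (F y) := fun y =>
    (hθc.comp (continuous_id.sub continuous_const)).smul (continuous_evolution hA y)
  have hFs : ∀ y x, x - y ∉ Icc (0 : ℝ) 1 → F y x = 0 := fun y x h => by
    simp only [hF]; rw [hθs _ h, zero_smul]
  choose W hW hWb using fun y => hex (F y) (hFc y) ⟨|y| + 2, fun x hx => hFs y x fun h => by
    have h1 : |x| ≤ |y| + 1 := by
      have : x = y + (x - y) := by ring
      rw [this]
      exact (abs_add_le _ _).trans (by gcongr; rw [abs_of_nonneg h.1]; exact h.2)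
    linarith⟩
  set K₀ := 2 * C * (Θ * N * Real.exp k * Real.exp k) with hK₀
  have hK₀0 : 0 ≤ K₀ := by positivity
  have hWe : ∀ y x, ‖W y x‖ ≤ K₀ * Real.exp (-k * |x - y|) := fun y x => by
    obtain ⟨B, hB⟩ := hWb y
    refine hap.exp_localized hC hk0.le hCk (by positivity) (hW y) hB (fun x => ?_) x
    by_cases h : x - y ∈ Icc (0 : ℝ) 1
    · have h1 : 1 ≤ Real.exp k * Real.exp (-k * |x - y|) := by
        rw [← Real.exp_add]
        refine Real.one_le_exp ?_
        rw [abs_of_nonneg h.1]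
        nlinarith [h.2]
      have h2 : ‖F y x‖ ≤ Θ * N := by
        simp only [hF]
        rw [norm_smul]
        gcongr
        · exact hΘ _
        · exact norm_evolution_le hA hM (by rw [abs_of_nonneg h.1]; exact h.2)
      have h3 : Θ * N * 1 ≤ Θ * N * (Real.exp k * Real.exp (-k * |x - y|)) := by gcongr
      linarith
    · rw [hFs y x h, norm_zero]; positivity
  have hH : ∀ x y, evolution A x y * (-W y y) = θ (x - y) • evolution A x y - W y x := by
    intro x y
    have h := eq_evolution_mul hA (W := fun x => θ (x - y) • evolution A x y - W y x)
      (fun x => ?_) x y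
    · rw [h]; simp [hθ0 0 le_rfl]
    · refine ((((hθ (x - y)).comp_sub_const x y).smul (hasDerivAt_evolution hA x y)).sub
        (hW y x)).congr_deriv ?_
      simp only [hF]
      rw [Matrix.mul_sub, Matrix.mul_smul]; abel
  have hst : ∀ x y, y ≤ x → ‖evolution A x y * (1 + W y y)‖ ≤
      (N * Real.exp k + K₀ + 1) * Real.exp (-k * (x - y)) := by
    intro x y hxy
    have e : evolution A x y * (1 + W y y) = (1 - θ (x - y)) • evolution A x y + W y x := by
      have := hH x y
      rw [Matrix.mul_neg] at this
      rw [Matrix.mul_add, Matrix.mul_one, sub_smul, one_smul, ← neg_neg (evolution A x y * W y y),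
        this]
      abel
    rw [e]
    refine (norm_add_le _ _).trans ?_
    have h1 := hWe y x
    rw [abs_of_nonneg (sub_nonneg.2 hxy)] at h1
    have h2 : ‖(1 - θ (x - y)) • evolution A x y‖ ≤ N * Real.exp k * Real.exp (-k * (x - y)) := by
      rcases le_total (x - y) 1 with h | h
      · have h3 : 1 ≤ Real.exp k * Real.exp (-k * (x - y)) := by
          rw [← Real.exp_add]
          exact Real.one_le_exp (by nlinarith)
        have h4 : ‖(1 - θ (x - y)) • evolution A x y‖ ≤ 1 * N := by
          rw [norm_smul]
          gcongr
          · rw [Real.norm_of_nonneg] <;> linarith [(hθb (x - y)).1, (hθb (x - y)).2]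
          · exact norm_evolution_le hA hM (by rw [abs_of_nonneg (sub_nonneg.2 hxy)]; exact h)
        have h5 : N * 1 ≤ N * (Real.exp k * Real.exp (-k * (x - y))) := by gcongr
        linarith
      · rw [hθ1 _ h, sub_self, zero_smul, norm_zero]; positivity
    have h6 := Real.exp_pos (-k * (x - y))
    nlinarith
  have hun : ∀ x y, x ≤ y → ‖evolution A x y * (1 - (1 + W y y))‖ ≤
      (N * Real.exp k + K₀ + 1) * Real.exp (-k * (y - x)) := by
    intro x y hxy
    have e : (1 : Matrix ι ι ℂ) - (1 + W y y) = -W y y := by abel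
    rw [e, hH, hθ0 _ (sub_nonpos.2 hxy), zero_smul, zero_sub, norm_neg]
    refine (hWe y x).trans ?_
    rw [abs_sub_comm, abs_of_nonneg (sub_nonneg.2 hxy)]
    gcongr
    linarith [mul_nonneg hN0 (Real.exp_pos k).le]
  set K := N * Real.exp k + K₀ + 1 with hK
  have hK0 : 0 < K := by positivity
  have hst' : ∀ y x, y ≤ x → ‖evolution A x y * (1 + W y y)‖ ≤ K := fun y x h =>
    (hst x y h).trans (mul_le_of_le_one_right hK0.le (Real.exp_le_one_iff.2 (by nlinarith)))
  have hun' : ∀ y x, x ≤ y → ‖evolution A x y * (1 - (1 + W y y))‖ ≤ K := fun y x h =>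
    (hun x y h).trans (mul_le_of_le_one_right hK0.le (Real.exp_le_one_iff.2 (by nlinarith)))
  -- Being bounded in both directions determines the matrix. Idempotence and commutation with the
  -- evolution follow, since `P * P` and the transported projection have the same property.
  have huniq : ∀ y Q B, (∀ x, y ≤ x → ‖evolution A x y * Q‖ ≤ B) →
      (∀ x, x ≤ y → ‖evolution A x y * (1 - Q)‖ ≤ B) → Q = 1 + W y y := fun y Q B h1 h2 =>
    eq_of_bounded_both_ends hA hap (B := max B K) (fun x hx => (h1 x hx).trans (le_max_left _ _))
      (fun x hx => (h2 x hx).trans (le_max_left _ _))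
      (fun x hx => (hst' y x hx).trans (le_max_right _ _))
      (fun x hx => (hun' y x hx).trans (le_max_right _ _))
  have hcont : ∀ y (Q : Matrix ι ι ℂ), Continuous fun x => evolution A x y * Q := fun y Q =>
    continuous_iff_continuousAt.2 fun x => (hasDerivAt_evolution_mul hA x y Q).continuousAt
  refine ⟨K, k, fun y => 1 + W y y, hK0, hk0, fun y _ => ?_, fun x _ y _ => ?_,
    fun x _ y _ h => hst x y h, fun x _ y _ h => hun x y h⟩
  · set P := 1 + W y y with hP
    refine huniq y (P * P) (max (K * ‖P‖) (K * (‖(1 : Matrix ι ι ℂ)‖ + ‖P‖)))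
      (fun x hx => ?_) fun x hx => ?_
    · rw [← Matrix.mul_assoc]
      exact ((Matrix.linfty_opNorm_mul _ _).trans (by gcongr; exact hst' y x hx)).trans
        (le_max_left _ _)
    · have e : (1 : Matrix ι ι ℂ) - P * P = (1 - P) * (1 + P) := by noncomm_ring
      rw [e, ← Matrix.mul_assoc]
      refine ((Matrix.linfty_opNorm_mul _ _).trans ?_).trans (le_max_right _ _)
      gcongr
      · exact hun' y x hx
      · exact norm_add_le _ _
  · set Q := evolution A y x * ((1 + W x x) * evolution A x y) with hQ
    have e1 : ∀ z, evolution A z y * Q = evolution A z x * (1 + W x x) * evolution A x y := by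
      intro z
      rw [hQ, ← Matrix.mul_assoc, evolution_mul_evolution hA, Matrix.mul_assoc]
    have e2 : ∀ z, evolution A z y * (1 - Q)
        = evolution A z x * (1 - (1 + W x x)) * evolution A x y := by
      intro z
      rw [Matrix.mul_sub, e1, Matrix.mul_one, Matrix.mul_sub, Matrix.sub_mul, Matrix.mul_one,
        evolution_mul_evolution hA]
    obtain ⟨B₁, hB₁⟩ := (isCompact_uIcc (a := x) (b := y)).exists_bound_of_continuousOn
      (hcont y Q).continuousOn
    obtain ⟨B₂, hB₂⟩ := (isCompact_uIcc (a := x) (b := y)).exists_bound_of_continuousOn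
      (hcont y (1 - Q)).continuousOn
    have hQeq : Q = 1 + W y y := by
      refine huniq y Q (max (K * ‖evolution A x y‖) (max B₁ B₂)) (fun z hz => ?_) fun z hz => ?_
      · rcases le_total x z with h | h
        · rw [e1]
          exact ((Matrix.linfty_opNorm_mul _ _).trans (by gcongr; exact hst' x z h)).trans
            (le_max_left _ _)
        · exact (hB₁ z (mem_uIcc.2 (Or.inr ⟨hz, h⟩))).trans
            ((le_max_left _ _).trans (le_max_right _ _))
      · rcases le_total z x with h | h
        · rw [e2]
          exact ((Matrix.linfty_opNorm_mul _ _).trans (by gcongr; exact hun' x z h)).trans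
            (le_max_left _ _)
        · exact (hB₂ z (mem_uIcc.2 (Or.inl ⟨h, hz⟩))).trans
            ((le_max_right _ _).trans (le_max_right _ _))
    rw [← hQeq, hQ, evolution_mul_cancel hA]

theorem HasExpDichotomy.mono {A : ℝ → Matrix ι ι ℂ} {J : Set ℝ} {K K' μ μ' : ℝ}
    {P : ℝ → Matrix ι ι ℂ} (h : HasExpDichotomy A J K μ P) (hK : K ≤ K') (hμ' : 0 < μ')
    (hμ : μ' ≤ μ) : HasExpDichotomy A J K' μ' P where
  K_pos := h.K_pos.trans_le hK
  μ_pos := hμ'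
  proj := h.proj
  comm := h.comm
  stable x hx y hy hxy := (h.stable x hx y hy hxy).trans (by
    have := h.K_pos.trans_le hK
    have := sub_nonneg.2 hxy
    gcongr)
  unstable x hx y hy hxy := (h.unstable x hx y hy hxy).trans (by
    have := h.K_pos.trans_le hK
    have := sub_nonneg.2 hxy
    gcongr)

/-- A solution bounded on the right half-line starts in the range of the projection. -/
theorem HasExpDichotomy.proj_mul_eq {κ : Type*} [Fintype κ] {A : ℝ → Matrix ι ι ℂ}
    (hA : Continuous A) {K μ : ℝ} {P : ℝ → Matrix ι ι ℂ} (h : HasExpDichotomy A (Ici 0) K μ P)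
    {W : ℝ → Matrix ι κ ℂ} (hW : ∀ x, HasDerivAt W (A x * W x) x) {B : ℝ}
    (hB : ∀ x, ‖W x‖ ≤ B) : P 0 * W 0 = W 0 := by
  have h1 : ∀ x, 0 ≤ x → ‖(1 - P 0) * W 0‖ ≤ K * Real.exp (-μ * x) * B := fun x hx => by
    have e : (1 - P 0) * W 0 = evolution A 0 x * (1 - P x) * W x := by
      rw [eq_evolution_mul hA hW 0 x, Matrix.mul_sub, ← h.comm 0 self_mem_Ici x hx, Matrix.mul_one,
        Matrix.sub_mul, Matrix.sub_mul, Matrix.one_mul, Matrix.mul_assoc]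
    rw [e]
    refine (Matrix.linfty_opNorm_mul _ _).trans ?_
    have h2 := h.unstable 0 self_mem_Ici x hx hx
    rw [sub_zero] at h2
    have := h.K_pos
    gcongr
    exact hB x
  have h2 : Tendsto (fun x : ℝ => K * Real.exp (-μ * x) * B) atTop (𝓝 (K * 0 * B)) := by
    refine ((Real.tendsto_exp_atBot.comp ?_).const_mul K).mul_const B
    exact tendsto_id.const_mul_atTop_of_neg (neg_neg_of_pos h.μ_pos)
  have h3 := ge_of_tendsto h2 ((eventually_ge_atTop 0).mono h1)
  rw [mul_zero, zero_mul, norm_le_zero_iff, Matrix.sub_mul, Matrix.one_mul, sub_eq_zero] at h3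
  exact h3.symm

theorem evolution_neg {A : ℝ → Matrix ι ι ℂ} (hA : Continuous A) (x y : ℝ) :
    evolution (fun s => -A (-s)) x y = evolution A (-x) (-y) := by
  have hB : Continuous fun s => -A (-s) := by fun_prop
  have := eq_evolution_mul hB (W := fun s => evolution A (-s) (-y)) (fun s => ?_) x y
  · rw [this, evolution_self hA, Matrix.mul_one]
  · exact (hasDerivAt_comp_neg (hasDerivAt_evolution hA (-s) (-y))).congr_deriv
      (Matrix.neg_mul _ _).symm

/-- Time reversal exchanges decay and growth, so the projection is replaced by its complement. -/
theorem HasExpDichotomy.reflect {A : ℝ → Matrix ι ι ℂ} (hA : Continuous A) {K μ : ℝ}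
    {P : ℝ → Matrix ι ι ℂ} (h : HasExpDichotomy (fun s => -A (-s)) (Ici 0) K μ P) :
    HasExpDichotomy A (Iic 0) K μ fun x => 1 - P (-x) := by
  have hm : ∀ x ∈ Iic (0 : ℝ), -x ∈ Ici (0 : ℝ) := fun x hx => by simpa using hx
  have hT : ∀ x y, evolution A x y = evolution (fun s => -A (-s)) (-x) (-y) := fun x y => by
    rw [evolution_neg hA, neg_neg, neg_neg]
  refine ⟨h.K_pos, h.μ_pos, fun x hx => ?_, fun x hx y hy => ?_, fun x hx y hy hxy => ?_,
    fun x hx y hy hxy => ?_⟩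
  · have := h.proj _ (hm x hx)
    rw [Matrix.sub_mul, Matrix.mul_sub, Matrix.mul_sub, this]; simp
  · have := h.comm _ (hm x hx) _ (hm y hy)
    rw [hT, Matrix.sub_mul, Matrix.mul_sub, this]; simp
  · rw [hT]
    have := h.unstable _ (hm x hx) _ (hm y hy) (by linarith)
    rwa [neg_sub_neg] at this
  · rw [hT, sub_sub_cancel]
    have := h.stable _ (hm x hx) _ (hm y hy) (by linarith)
    rwa [neg_sub_neg] at this

theorem rank_conj {Q T T' : Matrix ι ι ℂ} (h : T * T' = 1) : (T * Q * T').rank = Q.rank := by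
  have h' : T' * T = 1 := mul_eq_one_comm.1 h
  refine le_antisymm ((Matrix.rank_mul_le_left _ _).trans (Matrix.rank_mul_le_right _ _)) ?_
  have e : Q = T' * (T * Q * T') * T := by
    rw [show T' * (T * Q * T') * T = (T' * T) * Q * (T' * T) by noncomm_ring, h', one_mul, mul_one]
  conv_lhs => rw [e]
  exact (Matrix.rank_mul_le_left _ _).trans (Matrix.rank_mul_le_right _ _)

/-- A system on the right half-line that is asymptotic to a hyperbolic constant system and is
reversible has an exponential dichotomy whose stable and unstable ranks agree. -/
theorem exists_dichotomy_halfline {A : ℝ → Matrix ι ι ℂ} (hA : Continuous A) {M : ℝ}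
    (hM : ∀ x, ‖A x‖ ≤ M) {A₀ : Matrix ι ι ℂ} (hlim : Tendsto A atTop (𝓝 A₀))
    (hhyp : ∀ μ ∈ spectrum ℂ A₀, μ.re ≠ 0) {σ : Matrix ι ι ℂ}
    (hσ : σ * σ = 1) (hσA : ∀ x, σ * A x * σ = -A x) :
    ∃ K μ P, HasExpDichotomy A (Ici 0) K μ P ∧ (P 0).rank = (1 - P 0).rank := by
  obtain ⟨C, hC, hap⟩ := exists_apriori_of_hyperbolic ι hhyp
  set k := 1 / (2 * (C + 1)) with hk
  have hk0 : 0 < k := by positivity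
  have hCk : C * k ≤ 1 / 2 := by
    rw [hk, mul_one_div, div_le_div_iff₀ (by positivity) two_pos]; linarith
  obtain ⟨X, hX0, hX⟩ : ∃ X : ℝ, 0 ≤ X ∧ ∀ x, X ≤ x → ‖A x - A₀‖ ≤ k := by
    have h1 := (tendsto_iff_norm_sub_tendsto_zero.1 hlim).eventually_le_const hk0
    obtain ⟨X, hX⟩ := eventually_atTop.1 h1
    exact ⟨max X 0, le_max_right _ _, fun x hx => hX x ((le_max_left _ _).trans hx)⟩
  -- Freezing the coefficients on `[-X, X]` and reflecting gives a system that is even, uniformly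
  -- close to `A₀`, and equal to the original for `x ≥ X`. Evenness is needed both for periodization
  -- and for the symmetry below.
  set At : ℝ → Matrix ι ι ℂ := fun x => A (max |x| X) with hAt
  have hAtc : Continuous At := by fun_prop
  have hAtk : ∀ x, ‖At x - A₀‖ ≤ k := fun x => hX _ (le_max_right _ _)
  have hapt : APriori At ι (2 * C) := hap.perturb hk0.le hCk hAtk
  obtain ⟨K, μ, P, hP⟩ := exists_dichotomy_line hAtc (M := ‖A₀‖ + k)
    (fun x => by
      have := norm_le_norm_add_norm_sub' (At x) A₀
      linarith [hAtk x]) (by positivity) hapt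
    (fun F hF ⟨R, hR⟩ => by
      obtain ⟨δ, hδ⟩ : ∃ δ, ∀ x, ‖F x‖ ≤ δ := by
        obtain ⟨δ, hδ⟩ := (isCompact_Icc (a := -|R|) (b := |R|)).exists_bound_of_continuousOn
          hF.continuousOn
        refine ⟨δ, fun x => ?_⟩
        by_cases hx : |x| ≤ |R|
        · exact hδ x (abs_le.1 hx)
        · rw [hR x ((le_abs_self R).trans (not_le.1 hx).le), norm_zero]
          exact (norm_nonneg _).trans (hδ 0 (by simp))
      obtain ⟨W, hW, hWb⟩ := exists_bounded_solution hAtc (fun x => by simp [hAt]) hk0.le hCk hap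
        hAtk hF hR hδ
      exact ⟨W, hW, _, hWb⟩)
  -- Since `At` is even and `σ` anticommutes with it, conjugation by `σ` implements time reversal.
  have hsym : ∀ x, evolution At (-x) 0 = σ * evolution At x 0 * σ := by
    intro x
    have h := eq_evolution_mul hAtc (W := fun s => σ * evolution At (-s) 0 * σ) (fun s => ?_) x 0
    · rw [neg_zero, evolution_self hAtc, Matrix.mul_one, hσ, Matrix.mul_one] at h
      rw [← h]
      rw [show σ * (σ * evolution At (-x) 0 * σ) * σ = (σ * σ) * evolution At (-x) 0 * (σ * σ) by
        noncomm_ring, hσ, one_mul, mul_one]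
    · have h1 : HasDerivAt (fun s => evolution At (-s) 0) (-(At s * evolution At (-s) 0)) s := by
        have e : At (-s) = At s := by simp [hAt]
        exact (hasDerivAt_comp_neg (hasDerivAt_evolution hAtc (-s) 0)).congr_deriv (by rw [e])
      have h2 := hasDerivAt_matrix_mul (hasDerivAt_matrix_mul (hasDerivAt_const s σ) h1)
        (hasDerivAt_const s σ)
      refine h2.congr_deriv ?_
      have e : σ * At s = -(At s * σ) := by
        have := congrArg (· * σ) (hσA (max |s| X))
        simp only [Matrix.mul_assoc, hσ, Matrix.mul_one] at this
        rw [this, Matrix.neg_mul]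
      simp only [Matrix.zero_mul, zero_add, Matrix.mul_zero, add_zero, Matrix.mul_neg,
        Matrix.neg_mul]
      rw [← Matrix.mul_assoc σ (At s), e]
      simp only [Matrix.neg_mul, neg_neg, Matrix.mul_assoc]
  have hle : ∀ {a b : ℝ}, a ≤ b → K * Real.exp (-μ * (b - a)) ≤ K := fun h =>
    mul_le_of_le_one_right hP.K_pos.le (Real.exp_le_one_iff.2 (by nlinarith [hP.μ_pos]))
  -- Conjugation by `σ` interchanges solutions bounded on the right and on the left, so by
  -- uniqueness it carries `P 0` to its complement; equality of ranks is a consequence.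
  have hP0 : P 0 = 1 - σ * P 0 * σ := by
    have hb : ∀ Q : Matrix ι ι ℂ, ‖Q‖ ≤ K → ‖σ * Q * σ‖ ≤ ‖σ‖ * K * ‖σ‖ := fun Q hQ =>
      (Matrix.linfty_opNorm_mul _ _).trans (by
        gcongr
        exact (Matrix.linfty_opNorm_mul _ _).trans (by gcongr))
    have e : ∀ x (Q : Matrix ι ι ℂ), evolution At x 0 * (σ * Q * σ)
        = σ * (evolution At (-x) 0 * Q) * σ := fun x Q => by
      rw [hsym x]
      rw [show σ * (σ * evolution At x 0 * σ * Q) * σ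
        = (σ * σ) * evolution At x 0 * (σ * Q * σ) by noncomm_ring, hσ, one_mul]
    have e1 : (1 : Matrix ι ι ℂ) - σ * P 0 * σ = σ * (1 - P 0) * σ := by
      rw [Matrix.mul_sub, Matrix.sub_mul, Matrix.mul_one, hσ]
    refine eq_of_bounded_both_ends hAtc hapt (y := 0) (B := max K (‖σ‖ * K * ‖σ‖))
      (fun x hx => ((hP.stable x trivial 0 trivial hx).trans (hle hx)).trans (le_max_left _ _))
      (fun x hx => ((hP.unstable x trivial 0 trivial hx).trans (hle hx)).trans (le_max_left _ _))
      (fun x hx => ?_) fun x hx => ?_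
    · rw [e1, e]
      exact (hb _ ((hP.unstable (-x) trivial 0 trivial (by linarith)).trans
        (hle (by linarith)))).trans (le_max_right _ _)
    · rw [sub_sub_cancel, e]
      exact (hb _ ((hP.stable (-x) trivial 0 trivial (by linarith)).trans
        (hle (by linarith)))).trans (le_max_right _ _)
  have hrank0 : (P 0).rank = (1 - P 0).rank := by
    have : 1 - P 0 = σ * P 0 * σ := by
      rw [sub_eq_iff_eq_add, add_comm, ← sub_eq_iff_eq_add]; exact hP0.symm
    rw [this, rank_conj hσ]
  have hTeq₀ : ∀ x, X ≤ x → evolution A x X = evolution At x X := by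
    intro x hx
    have h := gronwall_forward (w := fun s => evolution A (s + X) X - evolution At (s + X) X)
      (M := M) (δ := 0) (R := x - X) ((norm_nonneg _).trans (hM 0)) le_rfl
      (fun s _ => ((hasDerivAt_evolution hA (s + X) X).comp_add_const s X).sub
        ((hasDerivAt_evolution hAtc (s + X) X).comp_add_const s X)) (fun s hs => ?_) (x - X)
      ⟨sub_nonneg.2 hx, le_rfl⟩
    · simpa [evolution_self hA, evolution_self hAtc, sub_eq_zero] using h
    · have e : At (s + X) = A (s + X) := by
        simp only [hAt]
        rw [abs_of_nonneg (add_nonneg hs.1 hX0), max_eq_left (by linarith [hs.1])]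
      rw [e, ← Matrix.mul_sub, add_zero]
      exact (Matrix.linfty_opNorm_mul _ _).trans (by gcongr; exact hM _)
  have hTeq₁ : ∀ x, X ≤ x → evolution A X x = evolution At X x := by
    intro x hx
    have h1 := evolution_mul_evolution hA X x X
    have h2 := evolution_mul_evolution hAtc x X x
    rw [evolution_self hA, hTeq₀ x hx] at h1
    rw [evolution_self hAtc] at h2
    exact left_inv_eq_right_inv h1 h2
  have hTeq : ∀ x y, X ≤ x → X ≤ y → evolution A x y = evolution At x y := fun x y hx hy => by
    rw [← evolution_mul_evolution hA x X y, hTeq₀ x hx, hTeq₁ y hy, evolution_mul_evolution hAtc]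
  set N := ‖(1 : Matrix ι ι ℂ)‖ * Real.exp (M * X) with hN
  have hdist : ∀ x : ℝ, 0 ≤ x → |max x X - x| ≤ X := fun x hx => by
    rcases le_total x X with h | h
    · rw [max_eq_right h, abs_of_nonneg (by linarith)]; linarith
    · rw [max_eq_left h, sub_self, abs_zero]; exact hX0
  -- The projection at `X` is transported by the original evolution, which makes commutation hold
  -- everywhere on the half-line.
  set PA : ℝ → Matrix ι ι ℂ := fun x => evolution A x X * P X * evolution A X x with hPA
  have hproj := hP.proj X trivial
  have hPe : ∀ x, X ≤ x → PA x = P x := fun x hx => by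
    simp only [hPA]
    rw [hTeq₀ x hx, hTeq₁ x hx, ← hP.comm x trivial X trivial, Matrix.mul_assoc,
      evolution_mul_evolution hAtc, evolution_self hAtc, Matrix.mul_one]
  have hcomm : ∀ x y, PA x * evolution A x y = evolution A x y * PA y := fun x y => by
    simp only [hPA, Matrix.mul_assoc]
    rw [evolution_mul_evolution hA, ← Matrix.mul_assoc (evolution A x y),
      evolution_mul_evolution hA]
  -- On `[0, ∞)` the outer two factors cover distances at most `X` and are bounded by `N`; the
  -- middle one belongs to the frozen system and carries the decay.
  have hdec : ∀ x y, evolution A x y = evolution A x (max x X) *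
      evolution At (max x X) (max y X) * evolution A (max y X) y := fun x y => by
    rw [← hTeq _ _ (le_max_right _ _) (le_max_right _ _), evolution_mul_evolution hA,
      evolution_mul_evolution hA]
  have hPcomm : ∀ y, evolution A (max y X) y * PA y = P (max y X) * evolution A (max y X) y :=
    fun y => by rw [← hcomm, hPe _ (le_max_right _ _)]
  have hbound : ∀ x y (Q : Matrix ι ι ℂ) (b : ℝ), 0 ≤ x → 0 ≤ y → ‖Q‖ ≤ b →
      ‖evolution A x (max x X) * Q * evolution A (max y X) y‖ ≤ N * b * N :=
    fun x y Q b hx hy hQ => by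
      have h1 : ‖evolution A x (max x X)‖ ≤ N :=
        norm_evolution_le hA hM (by rw [abs_sub_comm]; exact hdist x hx)
      have h2 : ‖evolution A (max y X) y‖ ≤ N := norm_evolution_le hA hM (hdist y hy)
      refine (Matrix.linfty_opNorm_mul _ _).trans ?_
      have hN0 : 0 ≤ N := (norm_nonneg _).trans h1
      have hb0 : 0 ≤ b := (norm_nonneg _).trans hQ
      gcongr
      exact (Matrix.linfty_opNorm_mul _ _).trans (by gcongr)
  have hmax : ∀ x y : ℝ, 0 ≤ x → 0 ≤ y → x - y - X ≤ max x X - max y X := fun x y hx hy => by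
    have : max y X ≤ y + X := max_le (by linarith) (by linarith)
    linarith [le_max_left x X]
  have hfin : ∀ x y : ℝ, 0 ≤ x → 0 ≤ y →
      N * (K * Real.exp (-μ * (max x X - max y X))) * N
        ≤ (N * N * K * Real.exp (μ * X) + 1) * Real.exp (-μ * (x - y)) := fun x y hx hy => by
    have h1 : Real.exp (-μ * (max x X - max y X)) ≤ Real.exp (μ * X) * Real.exp (-μ * (x - y)) := by
      rw [← Real.exp_add, Real.exp_le_exp]
      nlinarith [hmax x y hx hy, hP.μ_pos]
    have hK := hP.K_pos
    have h2 : N * N * K * Real.exp (-μ * (max x X - max y X))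
        ≤ N * N * K * (Real.exp (μ * X) * Real.exp (-μ * (x - y))) := by
      have hNN : 0 ≤ N * N := mul_self_nonneg N
      gcongr
    nlinarith [Real.exp_pos (-μ * (x - y))]
  refine ⟨N * N * K * Real.exp (μ * X) + 1, μ, PA, ⟨?_, hP.μ_pos, fun x _ => ?_,
    fun x _ y _ => hcomm x y, fun x hx y hy hxy => ?_, fun x hx y hy hxy => ?_⟩, ?_⟩
  · have := hP.K_pos
    have hNN : 0 ≤ N * N := mul_self_nonneg N
    positivity
  · simp only [hPA, Matrix.mul_assoc]
    rw [evolution_mul_cancel hA, ← Matrix.mul_assoc (P X), hproj]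
  · rw [hdec x y, Matrix.mul_assoc, hPcomm, ← Matrix.mul_assoc,
      Matrix.mul_assoc (evolution A x (max x X))]
    refine (hbound x y _ _ hx hy (hP.stable _ trivial _ trivial (max_le_max hxy le_rfl))).trans
      (hfin x y hx hy)
  · have e : evolution A (max y X) y * (1 - PA y)
        = (1 - P (max y X)) * evolution A (max y X) y := by
      rw [Matrix.mul_sub, hPcomm, Matrix.sub_mul, Matrix.mul_one, Matrix.one_mul]
    rw [hdec x y, Matrix.mul_assoc, e, ← Matrix.mul_assoc,
      Matrix.mul_assoc (evolution A x (max x X))]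
    refine (hbound x y _ _ hx hy (hP.unstable _ trivial _ trivial (max_le_max hxy le_rfl))).trans
      (hfin y x hy hx)
  · have hinv : ∀ x y, evolution A x y * evolution A y x = 1 := fun x y => by
      rw [evolution_mul_evolution hA, evolution_self hA]
    have hinv' : ∀ x y, evolution At x y * evolution At y x = 1 := fun x y => by
      rw [evolution_mul_evolution hAtc, evolution_self hAtc]
    have e1 : 1 - PA 0 = evolution A 0 X * (1 - P X) * evolution A X 0 := by
      rw [Matrix.mul_sub, Matrix.sub_mul, Matrix.mul_one, hinv]
    have e2 : P X = evolution At X 0 * P 0 * evolution At 0 X := by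
      rw [← hP.comm X trivial 0 trivial, Matrix.mul_assoc, hinv', Matrix.mul_one]
    have e3 : 1 - P X = evolution At X 0 * (1 - P 0) * evolution At 0 X := by
      rw [Matrix.mul_sub, Matrix.sub_mul, Matrix.mul_one, hinv', e2]
    rw [e1, rank_conj (hinv 0 X), rank_conj (hinv 0 X), e3, rank_conj (hinv' X 0), e2,
      rank_conj (hinv' X 0), hrank0]

end Dichotomy


/-! ### Factorization of the Floquet determinant -/

section Factorization

theorem hasDerivAt_matrix_iff {a b : Type*} [Fintype a] [Fintype b] {A : ℝ → Matrix a b ℂ}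
    {A' : Matrix a b ℂ} {x : ℝ} :
    HasDerivAt A A' x ↔ ∀ i j, HasDerivAt (fun s => A s i j) (A' i j) x :=
  hasDerivAt_pi.trans (forall_congr' fun _ => hasDerivAt_pi)

theorem fromBlocks_sub_fromBlocks {a b c d : Type*} (A A' : Matrix a c ℂ) (B B' : Matrix a d ℂ)
    (C C' : Matrix b c ℂ) (D D' : Matrix b d ℂ) :
    Matrix.fromBlocks A B C D - Matrix.fromBlocks A' B' C' D'
      = Matrix.fromBlocks (A - A') (B - B') (C - C') (D - D') := by
  ext (i | i) (j | j) <;> rfl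

variable {a b : Type*} [Fintype a] [Fintype b] [DecidableEq a] [DecidableEq b]

/-- The lower left block solves the homogeneous equation of `D` with zero initial value and so
vanishes; the diagonal blocks then decouple. The block `Q` is irrelevant for determinants. -/
theorem evolution_fromBlocks_zero {A : ℝ → Matrix a a ℂ} {B : ℝ → Matrix a b ℂ}
    {D : ℝ → Matrix b b ℂ} (hA : Continuous A) (hB : Continuous B) (hD : Continuous D) (x y : ℝ) :
    ∃ Q : Matrix a b ℂ, evolution (fun s => Matrix.fromBlocks (A s) (B s) 0 (D s)) x y
      = Matrix.fromBlocks (evolution A x y) Q 0 (evolution D x y) := by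
  set M : ℝ → Matrix (a ⊕ b) (a ⊕ b) ℂ := fun s => Matrix.fromBlocks (A s) (B s) 0 (D s) with hM
  have hMc : Continuous M := hA.matrix_fromBlocks hB continuous_const hD
  set T := fun s => evolution M s y with hT
  have hT0 : T y = 1 := evolution_self hMc y
  have hTd : ∀ s, HasDerivAt T (M s * T s) s := fun s => hasDerivAt_evolution hMc s y
  have hblk : ∀ s, M s * T s = Matrix.fromBlocks
      (A s * (T s).toBlocks₁₁ + B s * (T s).toBlocks₂₁)
      (A s * (T s).toBlocks₁₂ + B s * (T s).toBlocks₂₂)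
      (D s * (T s).toBlocks₂₁) (D s * (T s).toBlocks₂₂) := fun s => by
    conv_lhs => rw [← Matrix.fromBlocks_toBlocks (T s)]
    rw [hM, Matrix.fromBlocks_multiply]
    simp
  have h21 : ∀ s, (T s).toBlocks₂₁ = 0 := by
    intro s
    have h := eq_evolution_mul hD (W := fun s => (T s).toBlocks₂₁) (fun s => ?_) s y
    · rw [h, hT0, ← Matrix.fromBlocks_one, Matrix.toBlocks_fromBlocks₂₁, Matrix.mul_zero]
    · have h1 := hTd s
      rw [hblk] at h1
      exact hasDerivAt_matrix_iff.2 fun i j => hasDerivAt_matrix_iff.1 h1 (Sum.inr i) (Sum.inl j)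
  have h22 : ∀ s, (T s).toBlocks₂₂ = evolution D s y := by
    intro s
    have h := eq_evolution_mul hD (W := fun s => (T s).toBlocks₂₂) (fun s => ?_) s y
    · rw [h, hT0, ← Matrix.fromBlocks_one, Matrix.toBlocks_fromBlocks₂₂, Matrix.mul_one]
    · have h1 := hTd s
      rw [hblk] at h1
      exact hasDerivAt_matrix_iff.2 fun i j => hasDerivAt_matrix_iff.1 h1 (Sum.inr i) (Sum.inr j)
  have h11 : ∀ s, (T s).toBlocks₁₁ = evolution A s y := by
    intro s
    have h := eq_evolution_mul hA (W := fun s => (T s).toBlocks₁₁) (fun s => ?_) s y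
    · rw [h, hT0, ← Matrix.fromBlocks_one, Matrix.toBlocks_fromBlocks₁₁, Matrix.mul_one]
    · have h1 := hTd s
      rw [hblk, h21, Matrix.mul_zero, add_zero] at h1
      exact hasDerivAt_matrix_iff.2 fun i j => hasDerivAt_matrix_iff.1 h1 (Sum.inl i) (Sum.inl j)
  refine ⟨(T x).toBlocks₁₂, ?_⟩
  rw [← h11 x, ← h22 x, ← h21 x, Matrix.fromBlocks_toBlocks]

/-- A periodic solution of the Riccati equation block-triangularizes a linear system and factors
its Floquet determinant. -/
theorem floquetDet_fromBlocks {A₁₁ : ℝ → Matrix a a ℂ} {A₁₂ : ℝ → Matrix a b ℂ}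
    {A₂₁ : ℝ → Matrix b a ℂ} {A₂₂ : ℝ → Matrix b b ℂ} (h₁₁ : Continuous A₁₁)
    (h₁₂ : Continuous A₁₂) (h₂₁ : Continuous A₂₁) (h₂₂ : Continuous A₂₂)
    {W : ℝ → Matrix b a ℂ}
    (hW : ∀ x, HasDerivAt W (A₂₂ x * W x - W x * A₁₁ x - W x * A₁₂ x * W x + A₂₁ x) x)
    {L : ℝ} (hL : W L = W (-L)) (γ : ℂ) :
    floquetDet (fun x => Matrix.fromBlocks (A₁₁ x) (A₁₂ x) (A₂₁ x) (A₂₂ x)) L γ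
      = floquetDet (fun x => A₁₁ x + A₁₂ x * W x) L γ
        * floquetDet (fun x => A₂₂ x - W x * A₁₂ x) L γ := by
  have hWc : Continuous W := continuous_iff_continuousAt.2 fun x => (hW x).continuousAt
  have hs : Continuous fun x => A₁₁ x + A₁₂ x * W x := h₁₁.add (h₁₂.matrix_mul hWc)
  have hf : Continuous fun x => A₂₂ x - W x * A₁₂ x := h₂₂.sub (hWc.matrix_mul h₁₂)
  set M : ℝ → Matrix (a ⊕ b) (a ⊕ b) ℂ := fun x =>
    Matrix.fromBlocks (A₁₁ x) (A₁₂ x) (A₂₁ x) (A₂₂ x) with hM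
  set N : ℝ → Matrix (a ⊕ b) (a ⊕ b) ℂ := fun x =>
    Matrix.fromBlocks (A₁₁ x + A₁₂ x * W x) (A₁₂ x) 0 (A₂₂ x - W x * A₁₂ x) with hN
  have hMc : Continuous M := h₁₁.matrix_fromBlocks h₁₂ h₂₁ h₂₂
  have hNc : Continuous N := hs.matrix_fromBlocks h₁₂ continuous_const hf
  -- The Riccati equation says exactly that `H' = M H - H N`, so `H` conjugates the two evolutions.
  set H : ℝ → Matrix (a ⊕ b) (a ⊕ b) ℂ := fun x => Matrix.fromBlocks 1 0 (W x) 1 with hH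
  have hHdet : ∀ x, (H x).det = 1 := fun x => by simp [hH]
  have hH' : ∀ x, HasDerivAt H (M x * H x - H x * N x) x := by
    intro x
    have e : M x * H x - H x * N x = Matrix.fromBlocks 0 0
        (A₂₂ x * W x - W x * A₁₁ x - W x * A₁₂ x * W x + A₂₁ x) 0 := by
      simp only [hM, hH, hN, Matrix.fromBlocks_multiply, fromBlocks_sub_fromBlocks]
      congr 1
      · simp
      · simp
      · simp only [Matrix.mul_one, Matrix.mul_zero, Matrix.mul_add,
          Matrix.mul_assoc]
        abel
      · simp
    rw [e, hasDerivAt_matrix_iff]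
    rintro (i | i) (j | j)
    · exact hasDerivAt_const x _
    · exact hasDerivAt_const x _
    · exact hasDerivAt_matrix_iff.1 (hW x) i j
    · exact hasDerivAt_const x _
  have hconj : ∀ x y, evolution M x y * H y = H x * evolution N x y := by
    intro x y
    have h := eq_evolution_mul hMc (W := fun s => H s * evolution N s y) (fun s => ?_) x y
    · rw [h, evolution_self hNc, Matrix.mul_one]
    · refine (hasDerivAt_matrix_mul (hH' s) (hasDerivAt_evolution hNc s y)).congr_deriv ?_
      rw [Matrix.sub_mul, Matrix.mul_assoc, Matrix.mul_assoc, sub_add_cancel]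
  have hHL : H L = H (-L) := by simp only [hH, hL]
  obtain ⟨Q₁, hQ₁⟩ := evolution_fromBlocks_zero hs h₁₂ hf 0 (-L)
  obtain ⟨Q₂, hQ₂⟩ := evolution_fromBlocks_zero hs h₁₂ hf 0 L
  -- Periodicity enters here: the same matrix `H L` can be moved through both evolution operators.
  have key : (evolution M 0 (-L) - γ • evolution M 0 L) * H L
      = H 0 * (evolution N 0 (-L) - γ • evolution N 0 L) := by
    rw [Matrix.sub_mul, Matrix.mul_sub, Matrix.smul_mul, Matrix.mul_smul, hconj 0 L, hHL,
      hconj 0 (-L)]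
  have hdet := congrArg Matrix.det key
  rw [Matrix.det_mul, Matrix.det_mul, hHdet, hHdet, mul_one, one_mul] at hdet
  have hN1 : evolution N 0 (-L) - γ • evolution N 0 L = Matrix.fromBlocks
      (evolution (fun x => A₁₁ x + A₁₂ x * W x) 0 (-L)
        - γ • evolution (fun x => A₁₁ x + A₁₂ x * W x) 0 L) (Q₁ - γ • Q₂) 0
      (evolution (fun x => A₂₂ x - W x * A₁₂ x) 0 (-L)
        - γ • evolution (fun x => A₂₂ x - W x * A₁₂ x) 0 L) := by
    rw [hN, hQ₁, hQ₂, Matrix.fromBlocks_smul, fromBlocks_sub_fromBlocks]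
    simp
  unfold floquetDet
  rw [hdet, hN1, Matrix.det_fromBlocks_zero₂₁]

end Factorization

/-! ### Zeros of the fast reduced Evans function -/

section FastZeros

variable {m n : ℕ}

theorem exists_matrix_span_col {p : Type*} [Fintype p] [DecidableEq p]
    {V : Submodule ℂ (p → ℂ)} (hV : Module.finrank ℂ V = n) :
    ∃ B : Matrix p (Fin n) ℂ, LinearIndependent ℂ B.col ∧ Submodule.span ℂ (range B.col) = V := by
  let b := Module.finBasisOfFinrankEq ℂ V hV
  refine ⟨Matrix.of fun i j => (b j : p → ℂ) i, ?_, ?_⟩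
  · exact b.linearIndependent.map' V.subtype (Submodule.ker_subtype V)
  · have h : range (Matrix.of fun i j => (b j : p → ℂ) i).col = V.subtype '' range b := by
      rw [← range_comp]; rfl
    rw [h, Submodule.span_image, b.span_eq, Submodule.map_top, Submodule.range_subtype]

/-- The ranks of complementary projections add up to `2n`; equal ranks are therefore `n`, the size
required for a square Evans matrix. -/
theorem rank_eq_of_rank_eq {P : Matrix (Fin n ⊕ Fin n) (Fin n ⊕ Fin n) ℂ} (hP : P * P = P)
    (h : P.rank = (1 - P).rank) : P.rank = n := by
  have h1 : P.mulVecLin.ker = (1 - P).mulVecLin.range := by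
    ext v
    simp only [LinearMap.mem_ker, LinearMap.mem_range, Matrix.mulVecLin_apply]
    constructor
    · intro hv
      exact ⟨v, by rw [Matrix.sub_mulVec, hv, Matrix.one_mulVec, sub_zero]⟩
    · rintro ⟨w, rfl⟩
      rw [Matrix.mulVec_mulVec, Matrix.mul_sub, Matrix.mul_one, hP, sub_self, Matrix.zero_mulVec]
  have h2 := LinearMap.finrank_range_add_finrank_ker P.mulVecLin
  rw [h1] at h2
  have h3 : P.rank + (1 - P).rank = n + n := by simpa [Matrix.rank] using h2
  omega

/-- A nonzero bounded solution of the homogeneous fast limit problem is a zero of the fast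
reduced Evans function. -/
theorem isFastReducedEvansValue_zero_of_bounded {S : RDSystem m n} {F : PulseFamily m n} {lam : ℂ}
    (hc : Continuous (F.A22lim S lam)) {M : ℝ} (hM : ∀ x, ‖F.A22lim S lam x‖ ≤ M)
    {A₀ : Matrix (Fin n ⊕ Fin n) (Fin n ⊕ Fin n) ℂ}
    (htop : Tendsto (F.A22lim S lam) atTop (𝓝 A₀)) (hbot : Tendsto (F.A22lim S lam) atBot (𝓝 A₀))
    (hhyp : ∀ μ ∈ spectrum ℂ A₀, μ.re ≠ 0) {κ : Type*} [Fintype κ]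
    {W : ℝ → Matrix (Fin n ⊕ Fin n) κ ℂ} (hW : ∀ x, HasDerivAt W (F.A22lim S lam x * W x) x)
    {B : ℝ} (hB : ∀ x, ‖W x‖ ≤ B) (hW0 : W ≠ 0) : F.IsFastReducedEvansValue S lam 0 := by
  set A := F.A22lim S lam with hA
  -- The coefficient matrix has only off-diagonal blocks, hence anticommutes with `diag(1, -1)`.
  set σ : Matrix (Fin n ⊕ Fin n) (Fin n ⊕ Fin n) ℂ := Matrix.fromBlocks 1 0 0 (-1) with hσ
  have hσσ : σ * σ = 1 := by simp [hσ, Matrix.fromBlocks_multiply]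
  have hσA : ∀ x, σ * A x * σ = -A x := fun x => by
    simp [hσ, hA, PulseFamily.A22lim, Matrix.fromBlocks_multiply, Matrix.fromBlocks_neg]
  have hcm : Continuous fun x => -A (-x) := by fun_prop
  obtain ⟨K₁, μ₁, P₁, hP₁, hr₁⟩ := exists_dichotomy_halfline hc hM htop hhyp hσσ hσA
  obtain ⟨K₂, μ₂, P₂, hP₂, hr₂⟩ := exists_dichotomy_halfline (A := fun x => -A (-x)) (A₀ := -A₀)
    (M := M) (σ := σ) hcm (fun x => by rw [norm_neg]; exact hM _)
    (hbot.comp tendsto_neg_atTop_atBot).neg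
    (fun μ hμ h => by
      rw [← spectrum.neg_eq, Set.mem_neg] at hμ
      exact hhyp _ hμ (by rw [Complex.neg_re, h, neg_zero])) hσσ
    (fun x => by rw [Matrix.mul_neg, Matrix.neg_mul, hσA])
  have hn₁ := rank_eq_of_rank_eq (hP₁.proj 0 self_mem_Ici) hr₁
  have hn₂ := rank_eq_of_rank_eq (hP₂.proj 0 self_mem_Ici) hr₂
  have hP₃ := hP₂.reflect hc
  set Q := (1 : Matrix (Fin n ⊕ Fin n) (Fin n ⊕ Fin n) ℂ) - P₂ (-0) with hQ
  have hk : Q.mulVecLin.ker = (P₂ 0).mulVecLin.range := by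
    have hp := hP₂.proj 0 self_mem_Ici
    rw [hQ, neg_zero]
    ext v
    simp only [LinearMap.mem_ker, LinearMap.mem_range, Matrix.mulVecLin_apply, Matrix.sub_mulVec,
      Matrix.one_mulVec, sub_eq_zero]
    exact ⟨fun h => ⟨v, h.symm⟩, by rintro ⟨w, rfl⟩; rw [Matrix.mulVec_mulVec, hp]⟩
  obtain ⟨Bp, hBp, hBp'⟩ := exists_matrix_span_col (n := n) (V := (P₁ 0).mulVecLin.range) hn₁
  obtain ⟨Bm, hBm, hBm'⟩ := exists_matrix_span_col (n := n) (V := Q.mulVecLin.ker)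
    (by rw [hk]; exact hn₂)
  refine ⟨max K₁ K₂, min μ₁ μ₂, P₁, fun x => 1 - P₂ (-x), Bp, Bm,
    hP₁.mono (le_max_left _ _) (lt_min hP₁.μ_pos hP₂.μ_pos) (min_le_left _ _),
    hP₃.mono (le_max_right _ _) (lt_min hP₁.μ_pos hP₂.μ_pos) (min_le_right _ _), hBp, hBp', hBm,
    hBm', ?_⟩
  have hw1 := hP₁.proj_mul_eq hc hW hB
  have hw2 : P₂ 0 * W 0 = W 0 := by
    have := hP₂.proj_mul_eq hcm (W := fun x => W (-x))
      (fun x => (hasDerivAt_comp_neg (hW (-x))).congr_deriv (Matrix.neg_mul _ _).symm)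
      (fun x => hB _)
    simpa using this
  obtain ⟨c, hcne⟩ : ∃ c, (fun i => W 0 i c) ≠ 0 := by
    by_contra hall
    push Not at hall
    refine hW0 (matrixODE_unique hc (F := fun _ => 0) (fun x => by simpa using hW x)
      (fun x => ?_) (y := 0) ?_)
    · refine (hasDerivAt_const (𝕜 := ℝ) x (0 : Matrix (Fin n ⊕ Fin n) κ ℂ)).congr_deriv ?_
      simp
    · ext i j
      exact congrFun (hall j) i
  set w : Fin n ⊕ Fin n → ℂ := fun i => W 0 i c with hw
  have hm1 : w ∈ LinearMap.range Bp.mulVecLin := by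
    rw [Matrix.range_mulVecLin, hBp']
    exact ⟨w, funext fun i => congrFun (congrFun hw1 i) c⟩
  have hm2 : w ∈ LinearMap.range Bm.mulVecLin := by
    rw [Matrix.range_mulVecLin, hBm', hk]
    exact ⟨w, funext fun i => congrFun (congrFun hw2 i) c⟩
  obtain ⟨u, hu⟩ := hm1
  obtain ⟨v, hv⟩ := hm2
  rw [Matrix.mulVecLin_apply] at hu hv
  -- A nonzero column `w` of `W 0` lies in both column spaces, `Bp u = w = Bm v`, so `(u, -v)` is a
  -- nonzero kernel vector.
  refine (Matrix.exists_mulVec_eq_zero_iff.1 ⟨Sum.elim u (-v), fun h => hcne ?_, ?_⟩).symm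
  · have hu0 : u = 0 := funext fun i => congrFun h (Sum.inl i)
    rw [← hu, hu0, Matrix.mulVec_zero]
  · rw [Matrix.fromCols_mulVec_sumElim, Matrix.mulVec_neg, hu, hv, add_neg_cancel]

end FastZeros


/-! ### Calculus near compact sets -/

section Calculus

/-- Derivative bounds on a compact thickening of `k` and the mean value inequality on each ball;
neither `Ω` nor `k` need be convex, because one of the two points is the centre of the ball. -/
theorem exists_lipschitz_near_compact {X Y : Type*} [NormedAddCommGroup X] [NormedSpace ℝ X]
    [ProperSpace X] [NormedAddCommGroup Y] [NormedSpace ℝ Y] {f : X → Y} {Ω k : Set X}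
    (hΩ : IsOpen Ω) (hf : ContDiffOn ℝ 1 f Ω) (hk : IsCompact k) (hsub : k ⊆ Ω) :
    ∃ r > 0, ∃ M, 0 ≤ M ∧ ∀ z' ∈ k, ∀ z, ‖z - z'‖ ≤ r →
      z ∈ Ω ∧ ‖f z - f z'‖ ≤ M * ‖z - z'‖ ∧ ‖f z‖ ≤ M := by
  obtain ⟨r, hr, hrΩ⟩ := hk.exists_cthickening_subset_open hΩ hsub
  have hc : IsCompact (Metric.cthickening r k) := hk.cthickening
  obtain ⟨M₁, hM₁⟩ := hc.exists_bound_of_continuousOn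
    ((hf.continuousOn_fderiv_of_isOpen hΩ le_rfl).mono hrΩ)
  obtain ⟨M₂, hM₂⟩ := hc.exists_bound_of_continuousOn (hf.continuousOn.mono hrΩ)
  refine ⟨r, hr, max (max M₁ M₂) 0, le_max_right _ _, fun z' hz' z hz => ?_⟩
  have hball : Metric.closedBall z' r ⊆ Metric.cthickening r k :=
    Metric.closedBall_subset_cthickening hz' r
  have hzb : z ∈ Metric.closedBall z' r := by rwa [mem_closedBall_iff_norm]
  refine ⟨hrΩ (hball hzb), ?_,
    (hM₂ z (hball hzb)).trans ((le_max_right _ _).trans (le_max_left _ _))⟩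
  exact (convex_closedBall z' r).norm_image_sub_le_of_norm_fderiv_le
    (fun y hy => (hf.differentiableOn one_ne_zero).differentiableAt
      (hΩ.mem_nhds (hrΩ (hball hy))))
    (fun y hy => (hM₁ y (hball hy)).trans ((le_max_left _ _).trans (le_max_left _ _)))
    (Metric.mem_closedBall_self hr.le) hzb

/-- The complexified matrix of the restriction of a linear map along `i`. -/
noncomputable def jacCLM {X : Type*} [NormedAddCommGroup X] [NormedSpace ℝ X]
    [FiniteDimensional ℝ X] {a b : ℕ} (i : (Fin a → ℝ) →L[ℝ] X) :
    (X →L[ℝ] (Fin b → ℝ)) →L[ℝ] Matrix (Fin b) (Fin a) ℂ :=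
  LinearMap.toContinuousLinearMap
    { toFun := fun f => cx (LinearMap.toMatrix' ((f.comp i : (Fin a → ℝ) →L[ℝ] (Fin b → ℝ)) :
        (Fin a → ℝ) →ₗ[ℝ] (Fin b → ℝ)))
      map_add' := fun f g => by
        ext p q
        simp [cx, LinearMap.toMatrix'_apply]
      map_smul' := fun c f => by
        ext p q
        simp [cx, LinearMap.toMatrix'_apply] }

/-- A partial Jacobian is a fixed linear image of the full derivative, so it loses only one order of
smoothness. The base point `w` is left free so that one statement covers both the `u` and the `v`
slot. -/
theorem contDiffOn_cx_jac {X : Type*} [NormedAddCommGroup X] [NormedSpace ℝ X]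
    [FiniteDimensional ℝ X] {a b : ℕ} (i : (Fin a → ℝ) →L[ℝ] X) {f : X → (Fin b → ℝ)} {Ω : Set X}
    (hΩ : IsOpen Ω) (hf : ContDiffOn ℝ 2 f Ω) {c : X → Matrix (Fin b) (Fin a) ℂ}
    (hc : ∀ z ∈ Ω, ∃ w : Fin a → ℝ, c z = cx (jac (fun w' => f (z + i (w' - w))) w)) :
    ContDiffOn ℝ 1 c Ω := by
  have h1 : ContDiffOn ℝ 1 (fun z => jacCLM i (fderiv ℝ f z)) Ω :=
    (jacCLM i).contDiff.comp_contDiffOn (hf.fderiv_of_isOpen hΩ (by norm_num))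
  refine h1.congr fun z hz => ?_
  obtain ⟨w, hw⟩ := hc z hz
  have hfz : HasFDerivAt f (fderiv ℝ f z) (z + i (w - w)) := by
    simpa using ((hf.differentiableOn two_ne_zero).differentiableAt (hΩ.mem_nhds hz)).hasFDerivAt
  have hi : HasFDerivAt (fun w' => z + i (w' - w)) i w := by
    have h2 : HasFDerivAt (fun w' => i (w' - w)) i w := by
      have := i.hasFDerivAt.comp w ((hasFDerivAt_id w).sub_const w)
      simpa [Function.comp_def] using this
    exact h2.const_add z
  have h3 : HasFDerivAt (fun w' => f (z + i (w' - w))) ((fderiv ℝ f z).comp i) w :=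
    hfz.comp w hi
  rw [hw, jac, h3.fderiv]
  rfl

theorem norm_fromBlocks_lower_le {a b c d : Type*} [Fintype a] [Fintype b] [Fintype c] [Fintype d]
    (C : Matrix b c ℂ) : ‖(Matrix.fromBlocks 0 0 C 0 : Matrix (a ⊕ b) (c ⊕ d) ℂ)‖ ≤ ‖C‖ := by
  rw [← coe_nnnorm, ← coe_nnnorm, NNReal.coe_le_coe, Matrix.linfty_opNNNorm_def]
  refine Finset.sup_le fun i _ => ?_
  rcases i with i | i
  · simp
  · rw [Matrix.linfty_opNNNorm_def]
    simp only [Fintype.sum_sum_type, Matrix.fromBlocks_apply₂₁, Matrix.fromBlocks_apply₂₂,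
      Matrix.zero_apply, nnnorm_zero, Finset.sum_const_zero, add_zero]
    exact Finset.le_sup (f := fun i => ∑ j, ‖C i j‖₊) (Finset.mem_univ i)

end Calculus

/-! ### Coefficients of the linear stability problem -/

namespace RDSystem

variable {m n : ℕ}

/-- The domain of the interaction terms. -/
def dom (S : RDSystem m n) : Set ((Fin m → ℝ) × (Fin n → ℝ) × ℝ) := S.U ×ˢ S.V ×ˢ S.I

/-- `∂ᵤG`, complexified. -/
noncomputable def GU (S : RDSystem m n) (z : (Fin m → ℝ) × (Fin n → ℝ) × ℝ) :
    Matrix (Fin n) (Fin m) ℂ := cx (jac (fun u => S.G u z.2.1 z.2.2) z.1)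

/-- `∂ᵥG`, complexified. -/
noncomputable def GV (S : RDSystem m n) (z : (Fin m → ℝ) × (Fin n → ℝ) × ℝ) :
    Matrix (Fin n) (Fin n) ℂ := cx (jac (fun v => S.G z.1 v z.2.2) z.2.1)

/-- `∂ᵤH₁`, complexified. -/
noncomputable def H₁U (S : RDSystem m n) (z : (Fin m → ℝ) × (Fin n → ℝ) × ℝ) :
    Matrix (Fin m) (Fin m) ℂ := cx (jac (fun u => S.H₁ u z.2.1 z.2.2) z.1)

/-- `∂ᵥH₁`, complexified. -/
noncomputable def H₁V (S : RDSystem m n) (z : (Fin m → ℝ) × (Fin n → ℝ) × ℝ) :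
    Matrix (Fin m) (Fin n) ℂ := cx (jac (fun v => S.H₁ z.1 v z.2.2) z.2.1)

/-- `∂ᵤH₂`, complexified. -/
noncomputable def H₂U (S : RDSystem m n) (z : (Fin m → ℝ) × (Fin n → ℝ) × ℝ) :
    Matrix (Fin m) (Fin m) ℂ := cx (jac (fun u => S.H₂ u z.2.1) z.1)

/-- `∂ᵥH₂`, complexified. -/
noncomputable def H₂V (S : RDSystem m n) (z : (Fin m → ℝ) × (Fin n → ℝ) × ℝ) :
    Matrix (Fin m) (Fin n) ℂ := cx (jac (fun v => S.H₂ z.1 v) z.2.1)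

/-- All first derivatives of the interaction terms. -/
noncomputable def jet (S : RDSystem m n) (z : (Fin m → ℝ) × (Fin n → ℝ) × ℝ) :=
  (S.GU z, S.GV z, S.H₁U z, S.H₁V z, S.H₂U z, S.H₂V z)

variable {S : RDSystem m n}

theorem S1.isOpen_dom (h : S.S1) : IsOpen S.dom := h.U_open.prod (h.V_open.prod h.I_open)

theorem S1.H₂_C2' (h : S.S1) :
    ContDiffOn ℝ 2 (fun z : (Fin m → ℝ) × (Fin n → ℝ) × ℝ => S.H₂ z.1 z.2.1) S.dom := by
  have h1 : ContDiff ℝ 2 fun z : (Fin m → ℝ) × (Fin n → ℝ) × ℝ => (z.1, z.2.1) := by fun_prop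
  exact h.H₂_C2.comp h1.contDiffOn fun z hz => ⟨hz.1, hz.2.1⟩

theorem S1.contDiffOn_jet (h : S.S1) : ContDiffOn ℝ 1 S.jet S.dom := by
  have hu : ∀ {b : ℕ} {f : (Fin m → ℝ) × (Fin n → ℝ) × ℝ → (Fin b → ℝ)}, ContDiffOn ℝ 2 f S.dom →
      ContDiffOn ℝ 1 (fun z => cx (jac (fun u => f (u, z.2.1, z.2.2)) z.1)) S.dom :=
    fun {b f} hf => contDiffOn_cx_jac (ContinuousLinearMap.inl ℝ _ _) h.isOpen_dom hf
      fun z _ => ⟨z.1, by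
        congr 2; funext w; congr 1
        simp [Prod.ext_iff]⟩
  have hv : ∀ {b : ℕ} {f : (Fin m → ℝ) × (Fin n → ℝ) × ℝ → (Fin b → ℝ)}, ContDiffOn ℝ 2 f S.dom →
      ContDiffOn ℝ 1 (fun z => cx (jac (fun v => f (z.1, v, z.2.2)) z.2.1)) S.dom :=
    fun {b f} hf => contDiffOn_cx_jac ((ContinuousLinearMap.inr ℝ _ _).comp
      (ContinuousLinearMap.inl ℝ _ _)) h.isOpen_dom hf
      fun z _ => ⟨z.2.1, by
        congr 2; funext w; congr 1
        simp [Prod.ext_iff]⟩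
  exact (hu h.G_C2).prodMk ((hv h.G_C2).prodMk ((hu h.H₁_C2).prodMk ((hv h.H₁_C2).prodMk
    ((hu h.H₂_C2').prodMk (hv h.H₂_C2')))))

end RDSystem


/-! ### The spectral gap -/

namespace RDSystem

variable {m n : ℕ} {S : RDSystem m n}

theorem S1.continuousOn_GV_zero (h : S.S1) :
    ContinuousOn (fun u => S.GV (u, 0, 0)) S.U := by
  have h1 : ContinuousOn S.GV S.dom := (h.contDiffOn_jet.continuousOn.snd).fst
  exact h1.comp (by fun_prop) fun u hu => ⟨hu, h.zero_mem_V, h.zero_mem_I⟩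

theorem S1.continuousOn_jac_zero (h : S.S1) :
    ContinuousOn (fun u => jac (fun v => S.G u v 0) 0) S.U := by
  refine continuousOn_pi.2 fun i => continuousOn_pi.2 fun j => ?_
  have h1 : ContinuousOn (fun u => (S.GV (u, 0, 0) i j).re) S.U :=
    Complex.continuous_re.comp_continuousOn
      ((continuous_apply_apply (ρ := fun (_ _ : Fin n) => ℂ) i j).comp_continuousOn
        h.continuousOn_GV_zero)
  exact h1

/-- A matrix and its symmetric part have the same quadratic form, which is positive on unit vectors
and hence bounded below on the compact product with a sphere; homogeneity extends the bound. -/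
theorem exists_pos_form (h1 : S.S1) (h2 : S.S2) {K : Set (Fin m → ℝ)} (hK : IsCompact K)
    (hKU : K ⊆ S.U) : ∃ g > 0, ∀ u ∈ K, ∀ a : Fin n → ℝ,
      g * (a ⬝ᵥ a) ≤ a ⬝ᵥ (jac (fun v => S.G u v 0) 0).mulVec a := by
  have hpos : ∀ u ∈ S.U, ∀ a : Fin n → ℝ, a ≠ 0 →
      0 < a ⬝ᵥ (jac (fun v => S.G u v 0) 0).mulVec a := by
    intro u hu a ha
    have := (h2 u hu).dotProduct_mulVec_pos ha
    rw [Matrix.smul_mulVec, dotProduct_smul, Matrix.add_mulVec, dotProduct_add,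
      Matrix.conjTranspose_eq_transpose_of_trivial, Matrix.mulVec_transpose, star_trivial,
      dotProduct_comm a (Matrix.vecMul _ _), ← Matrix.dotProduct_mulVec] at this
    simp only [smul_eq_mul] at this
    linarith
  have hsph : IsCompact (K ×ˢ Metric.sphere (0 : Fin n → ℝ) 1) := hK.prod (isCompact_sphere _ _)
  have hcont : ContinuousOn (fun z : (Fin m → ℝ) × (Fin n → ℝ) =>
      z.2 ⬝ᵥ (jac (fun v => S.G z.1 v 0) 0).mulVec z.2) (K ×ˢ Metric.sphere 0 1) := by
    have hj : ContinuousOn (fun z : (Fin m → ℝ) × (Fin n → ℝ) => jac (fun v => S.G z.1 v 0) 0)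
        (K ×ˢ Metric.sphere 0 1) :=
      h1.continuousOn_jac_zero.comp continuousOn_fst fun z hz => hKU hz.1
    have : Continuous fun w : Matrix (Fin n) (Fin n) ℝ × (Fin n → ℝ) =>
        w.2 ⬝ᵥ w.1.mulVec w.2 :=
      continuous_snd.dotProduct (continuous_fst.matrix_mulVec continuous_snd)
    exact this.comp_continuousOn (hj.prodMk continuousOn_snd)
  obtain ⟨g, hg, hgb⟩ : ∃ g > 0, ∀ u ∈ K, ∀ a ∈ Metric.sphere (0 : Fin n → ℝ) 1,
      g ≤ a ⬝ᵥ (jac (fun v => S.G u v 0) 0).mulVec a := by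
    rcases (K ×ˢ Metric.sphere (0 : Fin n → ℝ) 1).eq_empty_or_nonempty with he | hne
    · refine ⟨1, one_pos, fun u hu a ha => ?_⟩
      exact absurd (mk_mem_prod hu ha) (by rw [he]; exact notMem_empty _)
    · obtain ⟨z, hz, hmin⟩ := hsph.exists_isMinOn hne hcont
      refine ⟨_, hpos z.1 (hKU hz.1) z.2 fun h0 => ?_, fun u hu a ha => hmin (mk_mem_prod hu ha)⟩
      have := hz.2
      rw [h0] at this
      simp at this
  -- The sphere is that of the sup norm, so passing to the Euclidean square costs a factor `n`; `n +
  -- 1` keeps the divisor positive.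
  refine ⟨g / (n + 1), by positivity, fun u hu a => ?_⟩
  rcases eq_or_ne a 0 with rfl | ha
  · simp
  have hna : 0 < ‖a‖ := norm_pos_iff.2 ha
  have h3 := hgb u hu (‖a‖⁻¹ • a) (by simp [norm_smul, hna.ne'])
  rw [Matrix.mulVec_smul, smul_dotProduct, dotProduct_smul, smul_eq_mul, smul_eq_mul, ← mul_assoc,
    ← mul_inv, ← div_eq_inv_mul, le_div_iff₀ (by positivity)] at h3
  have h4 : a ⬝ᵥ a ≤ (n + 1) * (‖a‖ * ‖a‖) := by
    have : a ⬝ᵥ a ≤ ∑ _i : Fin n, ‖a‖ * ‖a‖ := Finset.sum_le_sum fun i _ => by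
      have h5 := norm_le_pi_norm a i
      rw [← abs_mul_abs_self (a i)]
      exact mul_self_le_mul_self (abs_nonneg _) h5
    simp only [Finset.sum_const, Finset.card_univ, Fintype.card_fin, nsmul_eq_mul] at this
    nlinarith
  calc g / (n + 1) * (a ⬝ᵥ a) ≤ g / (n + 1) * ((n + 1) * (‖a‖ * ‖a‖)) := by gcongr
    _ = g * (‖a‖ * ‖a‖) := by field_simp
    _ ≤ _ := h3

theorem re_star_dotProduct_cx_mulVec (J : Matrix (Fin n) (Fin n) ℝ) (a : Fin n → ℂ) :
    (star a ⬝ᵥ (cx J).mulVec a).re = (fun i => (a i).re) ⬝ᵥ J.mulVec (fun i => (a i).re)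
      + (fun i => (a i).im) ⬝ᵥ J.mulVec (fun i => (a i).im) := by
  simp only [dotProduct, Matrix.mulVec, cx, Matrix.map_apply, Pi.star_apply, Complex.re_sum,
    Finset.mul_sum, ← Finset.sum_add_distrib]
  refine Finset.sum_congr rfl fun i _ => Finset.sum_congr rfl fun j _ => ?_
  simp

/-- An eigenvector `(a, b)` for `μ` satisfies `b = μ D₂ a` and `(J + λ) a = μ² D₂ a`. Pairing with
`a` and taking real parts gives `(g + Λ) |a|² ≤ (Re μ)² d |a|²`, with `g` a lower bound of the form
and `d` an upper bound of `D₂`. Hence `Λ₀ = g` works. -/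
theorem exists_spectralGap (h1 : S.S1) (h2 : S.S2) {K : Set (Fin m → ℝ)} (hK : IsCompact K)
    (hKU : K ⊆ S.U) : ∃ Lam₀ > 0, S.SpectralGap K Lam₀ := by
  obtain ⟨g, hg, hform⟩ := exists_pos_form h1 h2 hK hKU
  set d := 1 + ∑ i, S.d₂ i with hd
  have hsum : 0 ≤ ∑ i, S.d₂ i := Finset.sum_nonneg fun i _ => (S.d₂_pos i).le
  have hd0 : 0 < d := by positivity
  have hdi : ∀ i, S.d₂ i ≤ d := fun i => by
    have := Finset.single_le_sum (fun j _ => (S.d₂_pos j).le) (Finset.mem_univ i)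
    linarith
  refine ⟨g, hg, fun Lam hLam => ⟨√((g + Lam) / d), Real.sqrt_pos.2 ?_, ?_⟩⟩
  · have : 0 < g + Lam := by linarith [hLam.1]
    positivity
  intro u hu lam hlam μ hμ
  rw [← Matrix.spectrum_toLin', ← Module.End.hasEigenvalue_iff_mem_spectrum] at hμ
  obtain ⟨w, hw⟩ := hμ.exists_hasEigenvector
  have hw0 := hw.2
  have hwe := hw.apply_eq_smul
  rw [Matrix.toLin'_apply] at hwe
  set a : Fin n → ℂ := fun i => w (Sum.inl i) with ha
  set b : Fin n → ℂ := fun i => w (Sum.inr i) with hb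
  have hw' : w = Sum.elim a b := by
    funext i; rcases i with i | i <;> rfl
  set J := jac (fun v => S.G u v 0) 0 with hJ
  rw [hw', asympMatrix, Matrix.fromBlocks_mulVec] at hwe
  have e1 : ∀ i, ((S.d₂ i : ℂ))⁻¹ * b i = μ * a i := fun i => by
    have := congrFun hwe (Sum.inl i)
    simpa [cx, D₂inv, Matrix.mulVec_diagonal, Matrix.diagonal_map, Matrix.mulVec, dotProduct,
      Matrix.diagonal_apply, apply_ite, Finset.sum_ite_eq] using this
  have e2 : ∀ i, (cx J).mulVec a i + lam * a i = μ * b i := fun i => by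
    have := congrFun hwe (Sum.inr i)
    simpa [Matrix.add_mulVec, Matrix.smul_mulVec, hJ] using this
  have e3 : ∀ i, b i = μ * (S.d₂ i * a i) := fun i => by
    have hdne : (S.d₂ i : ℂ) ≠ 0 := by exact_mod_cast (S.d₂_pos i).ne'
    have := e1 i
    field_simp at this
    linear_combination this
  have ha0 : a ≠ 0 := fun h => hw0 (by
    rw [hw']
    funext i
    rcases i with i | i
    · exact congrFun h i
    · simp [e3, h])
  have hsq : star a ⬝ᵥ (cx J).mulVec a + lam * ((∑ i, ‖a i‖ ^ 2 : ℝ) : ℂ)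
      = μ ^ 2 * ((∑ i, S.d₂ i * ‖a i‖ ^ 2 : ℝ) : ℂ) := by
    push_cast
    rw [Finset.mul_sum, Finset.mul_sum, dotProduct, ← Finset.sum_add_distrib]
    refine Finset.sum_congr rfl fun i _ => ?_
    have h5 := e2 i
    rw [e3 i] at h5
    have h6 : star a i * a i = (‖a i‖ : ℂ) ^ 2 := Complex.conj_mul' (a i)
    rw [← h6]
    linear_combination (star a i) * h5
  have hre := congrArg Complex.re hsq
  rw [Complex.add_re, Complex.re_mul_ofReal, Complex.re_mul_ofReal, re_star_dotProduct_cx_mulVec]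
    at hre
  set N := ∑ i, ‖a i‖ ^ 2 with hN
  have hN0 : 0 < N := by
    obtain ⟨i, hi⟩ := Function.ne_iff.1 ha0
    have hi' : 0 < ‖a i‖ := norm_pos_iff.2 hi
    exact Finset.sum_pos' (fun j _ => by positivity) ⟨i, Finset.mem_univ i, by positivity⟩
  have hNeq : N = (fun i => (a i).re) ⬝ᵥ (fun i => (a i).re)
      + (fun i => (a i).im) ⬝ᵥ (fun i => (a i).im) := by
    rw [hN, dotProduct, dotProduct, ← Finset.sum_add_distrib]
    refine Finset.sum_congr rfl fun i _ => ?_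
    rw [Complex.sq_norm, Complex.normSq_apply]
  have hdN : ∑ i, S.d₂ i * ‖a i‖ ^ 2 ≤ d * N := by
    rw [hN, Finset.mul_sum]
    exact Finset.sum_le_sum fun i _ => by gcongr; exact hdi i
  have hdN0 : 0 ≤ ∑ i, S.d₂ i * ‖a i‖ ^ 2 :=
    Finset.sum_nonneg fun i _ => mul_nonneg (S.d₂_pos i).le (sq_nonneg _)
  have h7 := hform u hu fun i => (a i).re
  have h8 := hform u hu fun i => (a i).im
  have hmu : (μ ^ 2).re ≤ μ.re ^ 2 := by
    rw [pow_two, Complex.mul_re]; nlinarith [sq_nonneg μ.im]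
  have h9 : (g + Lam) * N ≤ μ.re ^ 2 * (d * N) := by
    have h10 : g * N + lam.re * N ≤ (μ ^ 2).re * ∑ i, S.d₂ i * ‖a i‖ ^ 2 := by
      rw [← hre]
      have : g * N = g * ((fun i => (a i).re) ⬝ᵥ (fun i => (a i).re))
        + g * ((fun i => (a i).im) ⬝ᵥ (fun i => (a i).im)) := by rw [hNeq]; ring
      linarith
    have h11 : (μ ^ 2).re * ∑ i, S.d₂ i * ‖a i‖ ^ 2 ≤ μ.re ^ 2 * (d * N) := by
      gcongr
    nlinarith
  refine Real.sqrt_le_iff.2 ⟨abs_nonneg _, ?_⟩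
  rw [sq_abs, div_le_iff₀ hd0]
  nlinarith

/-- The gap is assumed for `Re λ > Λ` only, while limits of spectral parameters may lie on the line
`Re λ = Λ`; since `(-Λ₀, 0)` is open, a slightly smaller bound covers it. -/
theorem SpectralGap.re_ne_zero {K : Set (Fin m → ℝ)} {Lam₀ Lam : ℝ} (h : S.SpectralGap K Lam₀)
    (hLam : Lam ∈ Ioo (-Lam₀) 0) {u : Fin m → ℝ} (hu : u ∈ K) {lam : ℂ} (hlam : Lam ≤ lam.re) :
    ∀ μ ∈ spectrum ℂ (S.asympMatrix u lam), μ.re ≠ 0 := by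
  intro μ hμ h0
  obtain ⟨Lam', h1, h2⟩ := exists_between hLam.1
  obtain ⟨c, hc, hgap⟩ := h Lam' ⟨h1, h2.trans hLam.2⟩
  have := hgap u hu lam (h2.trans_le hlam) μ hμ
  rw [h0, abs_zero] at this
  linarith

end RDSystem


/-! ### Estimates for the periodic pulse -/

namespace PulseFamily

variable {m n : ℕ} {S : RDSystem m n} {F : PulseFamily m n}

theorem S3.tendsto_L (h : F.S3 S) : Tendsto F.L (𝓝[>] 0) atTop := by
  have h1 : Tendsto (fun ε : ℝ => ε⁻¹ * (ε * F.L ε)) (𝓝[>] 0) atTop :=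
    tendsto_inv_nhdsGT_zero.atTop_mul_pos h.Lc₀_pos h.period
  refine h1.congr' ?_
  filter_upwards [eventually_mem_nhdsWithin] with ε hε
  rw [← mul_assoc, inv_mul_cancel₀ (ne_of_gt hε), one_mul]

theorem norm_vq_le_infDist (hne : S.slowManifold.Nonempty) (z : Phase m n) :
    ‖z.2.2.1‖ ≤ Metric.infDist z S.slowManifold ∧ ‖z.2.2.2‖ ≤ Metric.infDist z S.slowManifold := by
  constructor
  · refine (Metric.le_infDist hne).2 fun y hy => ?_
    rw [dist_eq_norm]
    have h := (norm_fst_le _).trans ((norm_snd_le _).trans (norm_snd_le (z - y)))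
    simpa [hy.2.1] using h
  · refine (Metric.le_infDist hne).2 fun y hy => ?_
    rw [dist_eq_norm]
    have h := (norm_snd_le _).trans ((norm_snd_le _).trans (norm_snd_le (z - y)))
    simpa [hy.2.2] using h

/-- Uniform bounds on the pulse and on the slow variation of its `u`-component. -/
structure Bounds (F : PulseFamily m n) (Ls βs P : ℝ) (ε : ℝ) : Prop where
  pos : 0 < ε
  one_le_L : 1 ≤ F.L ε
  v_le : ∀ x, |x| ≤ 2 * F.L ε →
    ‖F.v ε x‖ ≤ Ls * Real.exp (-βs * min |x| (2 * F.L ε - |x|))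
  q_le : ∀ x, |x| ≤ 2 * F.L ε →
    ‖F.q ε x‖ ≤ Ls * Real.exp (-βs * min |x| (2 * F.L ε - |x|))
  u_lip : ∀ x y, ‖F.u ε x - F.u ε y‖ ≤ ε * P * |x - y|
  periodic : ∀ x, F.phi ε (x + 2 * F.L ε) = F.phi ε x

theorem Bounds.v_le' {Ls βs P ε x : ℝ} (h : F.Bounds Ls βs P ε) (hx : |x| ≤ F.L ε) :
    ‖F.v ε x‖ ≤ Ls * Real.exp (-βs * |x|) := by
  have := h.v_le x (by linarith [h.one_le_L])
  rwa [min_eq_left (by linarith)] at this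

theorem Bounds.q_le' {Ls βs P ε x : ℝ} (h : F.Bounds Ls βs P ε) (hx : |x| ≤ F.L ε) :
    ‖F.q ε x‖ ≤ Ls * Real.exp (-βs * |x|) := by
  have := h.q_le x (by linarith [h.one_le_L])
  rwa [min_eq_left (by linarith)] at this

/-- Every point is congruent to one in the fundamental cell `[-L, L]`. -/
theorem Bounds.exists_cell {Ls βs P ε : ℝ} (h : F.Bounds Ls βs P ε) (x : ℝ) :
    ∃ (y : ℝ) (k : ℤ), |y| ≤ F.L ε ∧ x = y + k * (2 * F.L ε) ∧
      ∀ s, F.phi ε (s + k * (2 * F.L ε)) = F.phi ε s := by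
  have hL : 0 < 2 * F.L ε := by linarith [h.one_le_L]
  have hp : Function.Periodic (F.phi ε) (2 * F.L ε) := h.periodic
  refine ⟨toIcoMod hL (-F.L ε) x, toIcoDiv hL (-F.L ε) x, ?_, ?_, fun s => hp.int_mul _ s⟩
  · have := toIcoMod_mem_Ico hL (-F.L ε) x
    rw [abs_le]
    exact ⟨this.1, by linarith [this.2]⟩
  · have := toIcoMod_add_toIcoDiv_zsmul hL (-F.L ε) x
    rw [zsmul_eq_mul] at this
    exact this.symm

/-- Periodicity moves the decay estimates from `[0, 2L]` to `|x| ≤ 2L`, leaving room for windows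
that protrude from the fundamental cell. The slow variation of `u` holds because `u' = ε D₁⁻¹ p` and
`p` stays near a compact slow orbit. The slow orbit is kept for the choice of a compact set in `U`.
-/
theorem S3.exists_bounds (h : F.S3 S) : ∃ Ls > 0, ∃ βs > 0, ∃ P, 0 ≤ P ∧
    (∀ᶠ ε in 𝓝[>] (0 : ℝ), F.Bounds Ls βs P ε) ∧ ∃ us : ℝ → (Fin m → ℝ), ∃ b, 0 ≤ b ∧
      ContinuousOn us (Icc 0 b) ∧ MapsTo us (Icc 0 b) S.U ∧
      ∀ᶠ ε in 𝓝[>] (0 : ℝ), ∀ x ∈ Icc 0 (2 * F.L ε), ε * x ∈ Icc 0 b ∧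
        ‖F.u ε x - us (ε * x)‖ ≤ Ls * max ε (Real.exp (-βs * min x (2 * F.L ε - x))) := by
  obtain ⟨Ls, hLs, βs, hβs, us, ps, ⟨a, b, ha, hb, hus⟩, hev⟩ := h.slow
  -- A compact interval `[0, b']` inside the domain of the slow orbit that still contains `ε x` for
  -- `x ∈ [0, 2L]`, because `2 ε L` tends to `2 Lc₀ < b'`.
  obtain ⟨b', hb'1, hb'2⟩ := exists_between hb
  have hb'0 : 0 ≤ b' := by linarith [h.Lc₀_pos]
  have hsub : Icc 0 b' ⊆ Ioo a b := fun y hy => ⟨ha.trans_le hy.1, hy.2.trans_lt hb'2⟩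
  have husc : ContinuousOn us (Icc 0 b') := fun y hy =>
    (hus y (hsub hy)).2.1.continuousAt.continuousWithinAt
  have hpsc : ContinuousOn ps (Icc 0 b') := fun y hy =>
    (hus y (hsub hy)).2.2.continuousAt.continuousWithinAt
  obtain ⟨B, hB⟩ := isCompact_Icc.exists_bound_of_continuousOn hpsc
  have hB0 : 0 ≤ B := (norm_nonneg _).trans (hB 0 ⟨le_rfl, hb'0⟩)
  have hεL : ∀ᶠ ε in 𝓝[>] (0 : ℝ), 2 * (ε * F.L ε) ≤ b' :=
    (h.period.const_mul 2).eventually_le_const hb'1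
  have hε1 : ∀ᶠ ε in 𝓝[>] (0 : ℝ), ε ≤ 1 :=
    (eventually_le_nhds one_pos).filter_mono nhdsWithin_le_nhds
  have hne : S.slowManifold.Nonempty := ⟨(F.u₀, 0, 0, 0), h.u₀_mem, rfl, rfl⟩
  refine ⟨Ls, hLs, βs, hβs, ‖S.D₁inv‖ * (B + Ls), by positivity, ?_, us, b', hb'0, husc,
    fun y hy => (hus y (hsub hy)).1, ?_⟩
  · filter_upwards [hev, h.periodic, h.solution, hεL, hε1, h.tendsto_L.eventually_ge_atTop 1,
      eventually_mem_nhdsWithin] with ε hε hper hsol hεL hε1 hL hpos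
    have hpos : 0 < ε := hpos
    have hcell : ∀ x, |x| ≤ 2 * F.L ε → ∃ y ∈ Icc 0 (2 * F.L ε), F.phi ε x = F.phi ε y ∧
        min y (2 * F.L ε - y) = min |x| (2 * F.L ε - |x|) := by
      intro x hx
      rcases le_total 0 x with h0 | h0
      · rw [abs_of_nonneg h0] at hx ⊢
        exact ⟨x, ⟨h0, hx⟩, rfl, rfl⟩
      · rw [abs_of_nonpos h0] at hx ⊢
        refine ⟨x + 2 * F.L ε, ⟨by linarith, by linarith⟩, (hper x).symm, ?_⟩
        rw [min_comm]
        congr 1 <;> ring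
    have hp : ∀ x, ‖F.p ε x‖ ≤ B + Ls := by
      intro x
      obtain ⟨y, hy, hxy⟩ := Function.Periodic.exists_mem_Ico₀ (f := F.phi ε)
        (c := 2 * F.L ε) hper (by linarith) x
      have e : F.p ε x = F.p ε y := congrArg (fun z : Phase m n => z.2.1) hxy
      have hy' : y ∈ Icc 0 (2 * F.L ε) := Ico_subset_Icc_self hy
      have h2 := (hε y hy').2
      have h3 : ‖F.p ε y - ps (ε * y)‖ ≤
          ‖F.phi ε y - (us (ε * y), ps (ε * y), 0, 0)‖ :=
        (norm_fst_le _).trans (norm_snd_le (F.phi ε y - (us (ε * y), ps (ε * y), 0, 0)))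
      have h4 : Ls * max ε (Real.exp (-βs * min y (2 * F.L ε - y))) ≤ Ls * 1 := by
        gcongr
        refine max_le hε1 (Real.exp_le_one_iff.2 ?_)
        have : 0 ≤ min y (2 * F.L ε - y) := le_min hy'.1 (by linarith [hy'.2])
        nlinarith
      have h5 := hB (ε * y) ⟨mul_nonneg hpos.le hy'.1, by nlinarith [hy'.2]⟩
      have h6 := norm_le_norm_add_norm_sub' (F.p ε y) (ps (ε * y))
      rw [e]
      linarith
    refine ⟨hpos, hL, fun x hx => ?_, fun x hx => ?_, fun x y => ?_, hper⟩
    · obtain ⟨y, hy, hxy, hmin⟩ := hcell x hx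
      rw [← hmin]
      have e : F.v ε x = F.v ε y := congrArg (fun z : Phase m n => z.2.2.1) hxy
      rw [e]
      exact (norm_vq_le_infDist hne (F.phi ε y)).1.trans (hε y hy).1
    · obtain ⟨y, hy, hxy, hmin⟩ := hcell x hx
      rw [← hmin]
      have e : F.q ε x = F.q ε y := congrArg (fun z : Phase m n => z.2.2.2) hxy
      rw [e]
      exact (norm_vq_le_infDist hne (F.phi ε y)).2.trans (hε y hy).1
    · have := convex_univ.norm_image_sub_le_of_norm_hasDerivWithin_le (f := F.u ε)
        (C := ε * (‖S.D₁inv‖ * (B + Ls))) (fun s _ => (hsol s).2.2.1.hasDerivWithinAt)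
        (fun s _ => ?_) (mem_univ y) (mem_univ x)
      · exact this
      · refine (Matrix.linfty_opNorm_mulVec _ _).trans ?_
        rw [norm_smul, Real.norm_of_nonneg hpos.le]
        have := hp s
        calc ‖S.D₁inv‖ * (ε * ‖F.p ε s‖) ≤ ‖S.D₁inv‖ * (ε * (B + Ls)) := by gcongr
          _ = _ := by ring
  · filter_upwards [hev, hεL, eventually_mem_nhdsWithin] with ε hε hεL hpos x hx
    have hpos : 0 < ε := hpos
    refine ⟨⟨mul_nonneg hpos.le hx.1, by nlinarith [hx.2]⟩, le_trans ?_ (hε x hx).2⟩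
    exact norm_fst_le (F.phi ε x - (us (ε * x), ps (ε * x), 0, 0))

theorem S3.exists_initial (h : F.S3 S) : ∃ C, 0 ≤ C ∧ ∀ᶠ ε in 𝓝[>] (0 : ℝ),
    ‖F.u ε 0 - F.u₀‖ ≤ C * ε ∧ ‖F.p ε 0 - F.p₀‖ ≤ C * ε ∧
    ‖(F.v ε 0 - F.vh 0, F.q ε 0 - F.qh 0)‖ ≤ C * ε := by
  obtain ⟨C, hC⟩ := h.initial
  refine ⟨|C|, abs_nonneg C, ?_⟩
  filter_upwards [hC, eventually_mem_nhdsWithin] with ε hε hpos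
  have hpos : 0 < ε := hpos
  have hε' : ‖F.phi ε 0 - (F.u₀, F.p₀, F.vh 0, F.qh 0)‖ ≤ |C| * ε :=
    hε.trans (by gcongr; exact le_abs_self C)
  refine ⟨(norm_fst_le _).trans hε', ((norm_fst_le _).trans (norm_snd_le _)).trans hε', ?_⟩
  exact ((norm_snd_le _).trans (norm_snd_le _)).trans hε'

/-- Within distance `X` of a pulse, `u` has moved only `O(ε)` from `u₀`; farther away it is close to
the slow orbit. A small closed thickening of both is compact and inside `U`. -/
theorem S3.exists_slowCompactum (h1 : S.S1) (h : F.S3 S) : ∃ K, F.IsSlowCompactum S K := by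
  obtain ⟨Ls, hLs, βs, hβs, P, hP, hbd, us, b, hb, husc, husU, hev⟩ := h.exists_bounds
  obtain ⟨C, hC, hini⟩ := h.exists_initial
  have hk : IsCompact (insert F.u₀ (us '' Icc 0 b)) :=
    (isCompact_Icc.image_of_continuousOn husc).insert _
  have hkU : insert F.u₀ (us '' Icc 0 b) ⊆ S.U :=
    insert_subset h.u₀_mem (image_subset_iff.2 husU)
  obtain ⟨r, hr, hrU⟩ := hk.exists_cthickening_subset_open h1.U_open hkU
  obtain ⟨X, hX0, hX⟩ : ∃ X : ℝ, 0 ≤ X ∧ Ls * Real.exp (-βs * X) ≤ r := by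
    have : Tendsto (fun X : ℝ => Ls * Real.exp (-βs * X)) atTop (𝓝 (Ls * 0)) :=
      (Real.tendsto_exp_atBot.comp (tendsto_id.const_mul_atTop_of_neg (neg_neg_of_pos hβs))).const_mul
        Ls
    rw [mul_zero] at this
    obtain ⟨X, h2, h3⟩ := ((this.eventually_le_const hr).and (eventually_ge_atTop 0)).exists
    exact ⟨X, h3, h2⟩
  have hsmall : ∀ c : ℝ, ∀ᶠ ε in 𝓝[>] (0 : ℝ), c * ε ≤ r := fun c => by
    have : Tendsto (fun ε : ℝ => c * ε) (𝓝[>] 0) (𝓝 (c * 0)) :=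
      (Continuous.tendsto (by fun_prop) 0).mono_left nhdsWithin_le_nhds
    exact this.eventually_le_const (by simpa using hr)
  refine ⟨Metric.cthickening r (insert F.u₀ (us '' Icc 0 b)), hk.cthickening, hrU,
    Metric.self_subset_cthickening _ (mem_insert _ _), ?_⟩
  filter_upwards [hbd, hev, hini, hsmall Ls, hsmall (P * X + C)] with ε hbd hev hini hs1 hs2 x
  obtain ⟨y, hy, hxy⟩ := Function.Periodic.exists_mem_Ico₀ (f := F.phi ε)
    (c := 2 * F.L ε) hbd.periodic (by linarith [hbd.one_le_L]) x
  have e : F.u ε x = F.u ε y := congrArg (fun z : Phase m n => z.1) hxy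
  rw [e]
  have hnear : ∀ s, |s| ≤ X → ‖F.u ε s - F.u₀‖ ≤ r := fun s hs => by
    have h2 := hbd.u_lip s 0
    rw [sub_zero] at h2
    have h3 : ε * P * |s| ≤ ε * P * X := by
      have := hbd.pos
      gcongr
    have h4 := norm_sub_le_norm_sub_add_norm_sub (F.u ε s) (F.u ε 0) F.u₀
    nlinarith [hini.1]
  have hu₀ : ∀ s, |s| ≤ X → F.u ε s ∈ Metric.cthickening r (insert F.u₀ (us '' Icc 0 b)) :=
    fun s hs => Metric.closedBall_subset_cthickening (mem_insert _ _) r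
      (by rw [mem_closedBall_iff_norm]; exact hnear s hs)
  rcases le_total y X with h2 | h2
  · exact hu₀ y (by rwa [abs_of_nonneg hy.1])
  rcases le_total (2 * F.L ε - y) X with h3 | h3
  · have e2 : F.u ε y = F.u ε (y - 2 * F.L ε) := by
      have := hbd.periodic (y - 2 * F.L ε)
      rw [sub_add_cancel] at this
      exact congrArg (fun z : Phase m n => z.1) this
    rw [e2]
    exact hu₀ _ (by rw [abs_of_nonpos (by linarith [hy.2])]; linarith)
  · have h4 := hev y (Ico_subset_Icc_self hy)
    refine Metric.closedBall_subset_cthickening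
      (mem_insert_of_mem _ (mem_image_of_mem us h4.1)) r ?_
    rw [mem_closedBall_iff_norm]
    refine h4.2.trans ?_
    rw [mul_max_of_nonneg _ _ hLs.le]
    refine max_le hs1 (le_trans ?_ hX)
    gcongr Ls * Real.exp ?_
    nlinarith [le_min h2 h3]

end PulseFamily


/-! ### Convergence to the homoclinic pulse -/

theorem tendsto_rpow_nhdsGT_zero {a : ℝ} (ha : 0 < a) :
    Tendsto (fun ε : ℝ => ε ^ a) (𝓝[>] 0) (𝓝 0) := by
  have := (Real.continuousAt_rpow_const 0 a (Or.inr ha.le)).tendsto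
  rw [Real.zero_rpow ha.ne'] at this
  exact this.mono_left nhdsWithin_le_nhds

theorem eventually_mul_rpow_lt {a c r : ℝ} (ha : 0 < a) (hr : 0 < r) :
    ∀ᶠ ε in 𝓝[>] (0 : ℝ), c * ε ^ a < r := by
  have := (tendsto_rpow_nhdsGT_zero ha).const_mul c
  rw [mul_zero] at this
  exact this.eventually_lt_const hr

/-- A continuous function cannot cross a barrier that it stays strictly below. -/
theorem le_of_bootstrap {g : ℝ → ℝ} (hg : Continuous g) {R b r : ℝ} (hbr : b < r)
    (h : ∀ s, s ≤ R → (∀ x, |x| < s → g x ≤ r) → ∀ x, |x| ≤ s → g x ≤ b) :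
    ∀ x, |x| ≤ R → g x ≤ b := by
  refine h R le_rfl fun x hx => ?_
  by_contra hcon
  rw [not_le] at hcon
  -- The exit point closest to the origin: before it the barrier `r` is respected, so the improved
  -- bound `b < r` holds at the exit point itself.
  have hE : IsCompact (Icc (-R) R ∩ g ⁻¹' Ici r) :=
    isCompact_Icc.inter_right (isClosed_Ici.preimage hg)
  obtain ⟨x₀, hx₀, hmin⟩ := hE.exists_isMinOn ⟨x, abs_le.1 hx.le, hcon.le⟩
    continuous_abs.continuousOn
  have hx₀R : |x₀| ≤ R := abs_le.2 hx₀.1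
  have h1 := h |x₀| hx₀R (fun y hy => ?_) x₀ le_rfl
  · exact absurd (hx₀.2 : r ≤ g x₀) (not_le.2 (h1.trans_lt hbr))
  · by_contra hy'
    rw [not_le] at hy'
    have : |x₀| ≤ |y| := hmin ⟨abs_le.1 (hy.le.trans hx₀R), hy'.le⟩
    linarith

namespace PulseFamily

variable {m n : ℕ} {S : RDSystem m n} {F : PulseFamily m n}

theorem S3.continuous_vh (h : F.S3 S) : Continuous F.vh :=
  continuous_iff_continuousAt.2 fun x => (h.pulse x).2.1.continuousAt

theorem S3.isCompact_orbit (h : F.S3 S) : IsCompact (insert 0 (range F.vh)) := by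
  refine Tendsto.isCompact_insert_range_of_cocompact ?_ h.continuous_vh
  rw [cocompact_eq_atBot_atTop]
  exact h.homoclinic_bot.fst_nhds.sup h.homoclinic_top.fst_nhds

theorem S3.orbit_subset (h1 : S.S1) (h : F.S3 S) : insert 0 (range F.vh) ⊆ S.V :=
  insert_subset h1.zero_mem_V (range_subset_iff.2 fun x => (h.pulse x).1)

theorem norm_triple_sub_le {u u' : Fin m → ℝ} {v v' : Fin n → ℝ} {e e' a : ℝ}
    (hu : ‖u - u'‖ ≤ a) (hv : ‖v - v'‖ ≤ a) (he : |e - e'| ≤ a) :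
    ‖((u, v, e) : (Fin m → ℝ) × (Fin n → ℝ) × ℝ) - (u', v', e')‖ ≤ a :=
  norm_prod_le_iff.2 ⟨hu, norm_prod_le_iff.2 ⟨hv, he⟩⟩

/-- The pulse follows the homoclinic orbit on logarithmically long intervals. -/
theorem S3.exists_log_interval (h1 : S.S1) (h : F.S3 S) : ∃ C N : ℝ, 0 ≤ C ∧ 0 < N ∧
    ∀ᶠ ε in 𝓝[>] (0 : ℝ), ∀ x, |x| ≤ -Real.log ε / (2 * N) →
      ‖(F.v ε x - F.vh x, F.q ε x - F.qh x)‖ ≤ C * ε ^ (1 / 2 : ℝ) := by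
  obtain ⟨Ls, hLs, βs, hβs, P, hP, hbd, -⟩ := h.exists_bounds
  obtain ⟨C₀, hC₀, hini⟩ := h.exists_initial
  obtain ⟨r, hr, M, hM, hlip⟩ := exists_lipschitz_near_compact h1.isOpen_dom
    (h1.G_C2.of_le one_le_two)
    (isCompact_singleton.prod (h.isCompact_orbit.prod isCompact_singleton))
    (show {F.u₀} ×ˢ (insert 0 (range F.vh)) ×ˢ {(0 : ℝ)} ⊆ S.dom from
      prod_mono (singleton_subset_iff.2 h.u₀_mem)
        (prod_mono (h.orbit_subset h1) (singleton_subset_iff.2 h1.zero_mem_I)))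
  set N := M + ‖S.D₂inv‖ with hN
  have hN0 : 0 ≤ N := by positivity
  set C₁ := C₀ + M * (C₀ + P + 1) with hC₁
  have hC₁0 : 0 ≤ C₁ := by positivity
  refine ⟨C₁, N + 2, hC₁0, by positivity, ?_⟩
  have hε1 : ∀ᶠ ε in 𝓝[>] (0 : ℝ), ε < 1 :=
    (eventually_lt_nhds one_pos).filter_mono nhdsWithin_le_nhds
  filter_upwards [hbd, hini, hε1, h.solution,
    eventually_mul_rpow_lt (a := 1 / 2) (c := C₁) (by norm_num) hr,
    eventually_mul_rpow_lt (a := 1 / 2) (c := C₀ + P + 1) (by norm_num) hr]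
    with ε hbd hini hε1 hsol hs1 hs2
  have hε := hbd.pos
  -- `R` is chosen with `exp ((N + 2) R) = ε^(-1/2)`. Gronwall amplifies the error `O(ε)` by `exp (N
  -- R)`, the slow drift and the length contribute `(1 + R)²`, absorbed in `exp (2R)`, and `ε^(1/2)`
  -- is left over.
  set R := -Real.log ε / (2 * (N + 2)) with hR
  have hR0 : 0 ≤ R := div_nonneg (by linarith [Real.log_nonpos hε.le hε1.le]) (by positivity)
  have hexp : Real.exp ((N + 2) * R) = ε ^ (-(1 / 2) : ℝ) := by
    rw [Real.rpow_def_of_pos hε, hR]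
    congr 1
    field_simp
  have hmul : ε * ε ^ (-(1 / 2) : ℝ) = ε ^ (1 / 2 : ℝ) := by
    nth_rewrite 1 [← Real.rpow_one ε]
    rw [← Real.rpow_add hε]; norm_num
  have hR1 : 1 + R ≤ Real.exp R := by linarith [Real.add_one_le_exp R]
  have hRle : ε * (1 + R) ≤ ε ^ (1 / 2 : ℝ) := by
    rw [← hmul, ← hexp]
    gcongr
    exact hR1.trans (Real.exp_le_exp.2 (by nlinarith))
  have hu : ∀ x, |x| ≤ R → ‖F.u ε x - F.u₀‖ ≤ (C₀ + P) * (ε * (1 + R)) := fun x hx => by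
    have h2 := hbd.u_lip x 0
    rw [sub_zero] at h2
    have h3 := norm_sub_le_norm_sub_add_norm_sub (F.u ε x) (F.u ε 0) F.u₀
    have h4 : ε * P * |x| ≤ ε * P * R := by gcongr
    nlinarith [hini.1, mul_nonneg hC₀ (mul_nonneg hε.le hR0), mul_nonneg hP hε.le]
  have hder : ∀ x, HasDerivAt (fun x => (F.v ε x - F.vh x, F.q ε x - F.qh x))
      (S.D₂inv.mulVec (F.q ε x) - S.D₂inv.mulVec (F.qh x),
        S.G (F.u ε x) (F.v ε x) ε - S.G F.u₀ (F.vh x) 0) x := fun x =>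
    ((hsol x).2.2.2.2.1.sub (h.pulse x).2.1).prodMk ((hsol x).2.2.2.2.2.sub (h.pulse x).2.2)
  -- The Lipschitz bound for `G` is available only within distance `r` of the homoclinic orbit,
  -- hence the continuation argument.
  refine le_of_bootstrap (g := fun x => ‖(F.v ε x - F.vh x, F.q ε x - F.qh x)‖)
    (continuous_iff_continuousAt.2 fun x => (hder x).continuousAt).norm hs1 fun s hs hle x hx => ?_
  have hs0 : 0 ≤ s := (abs_nonneg x).trans hx
  have hgr := gronwall_two_sided_of_lt (M := N) (δ := M * ((C₀ + P + 1) * (ε * (1 + R)))) (R := s)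
    hN0 (by positivity) hder (fun y hy => ?_) x hx
  · refine hgr.trans ?_
    have h3 : Real.exp (N * s) ≤ Real.exp (N * R) := by gcongr
    have h4 : ‖(F.v ε 0 - F.vh 0, F.q ε 0 - F.qh 0)‖ + M * ((C₀ + P + 1) * (ε * (1 + R))) * s
        ≤ C₁ * (ε * (1 + R) ^ 2) := by
      have h5 : M * ((C₀ + P + 1) * (ε * (1 + R))) * s
          ≤ M * ((C₀ + P + 1) * (ε * (1 + R))) * (1 + R) := by gcongr; linarith
      have h6 : C₀ * ε ≤ C₀ * (ε * (1 + R) ^ 2) := by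
        gcongr
        exact le_mul_of_one_le_right hε.le (by nlinarith)
      have e : C₁ * (ε * (1 + R) ^ 2) = C₀ * (ε * (1 + R) ^ 2)
        + M * ((C₀ + P + 1) * (ε * (1 + R))) * (1 + R) := by rw [hC₁]; ring
      linarith [hini.2.2]
    have h7 : (1 + R) ^ 2 * Real.exp (N * R) ≤ Real.exp ((N + 2) * R) := by
      have e : Real.exp ((N + 2) * R) = Real.exp R ^ 2 * Real.exp (N * R) := by
        rw [← Real.exp_nat_mul, ← Real.exp_add]; congr 1; push_cast; ring
      rw [e]
      gcongr
    calc _ ≤ C₁ * (ε * (1 + R) ^ 2) * Real.exp (N * R) := by gcongr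
      _ = C₁ * (ε * ((1 + R) ^ 2 * Real.exp (N * R))) := by ring
      _ ≤ C₁ * (ε * Real.exp ((N + 2) * R)) := by gcongr
      _ = C₁ * ε ^ (1 / 2 : ℝ) := by rw [hexp, hmul]
  · set w := (F.v ε y - F.vh y, F.q ε y - F.qh y) with hw
    have hyR : |y| ≤ R := hy.le.trans hs
    have hwr : ‖w‖ ≤ r := hle y hy
    have hv : ‖F.v ε y - F.vh y‖ ≤ ‖w‖ := norm_fst_le w
    have hq : ‖F.q ε y - F.qh y‖ ≤ ‖w‖ := norm_snd_le w
    have hu' := hu y hyR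
    have hεR : ε ≤ ε * (1 + R) := le_mul_of_one_le_right hε.le (by linarith)
    have hsm : (C₀ + P + 1) * (ε * (1 + R)) ≤ r :=
      (mul_le_mul_of_nonneg_left hRle (by positivity)).trans hs2.le
    have hpos : 0 ≤ (C₀ + P) * (ε * (1 + R)) := by positivity
    have hclose : ‖((F.u ε y, F.v ε y, ε) : (Fin m → ℝ) × (Fin n → ℝ) × ℝ)
        - (F.u₀, F.vh y, 0)‖ ≤ max ‖w‖ ((C₀ + P + 1) * (ε * (1 + R))) := by
      refine norm_triple_sub_le ?_ (hv.trans (le_max_left _ _)) ?_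
      · refine le_trans ?_ (le_max_right _ _); linarith
      · rw [sub_zero, abs_of_pos hε]
        refine le_trans ?_ (le_max_right _ _); linarith
    have hL := (hlip (F.u₀, F.vh y, 0) ⟨rfl, mem_insert_of_mem _ (mem_range_self y), rfl⟩ _
      (hclose.trans (max_le hwr hsm))).2.1
    refine norm_prod_le_iff.2 ⟨?_, ?_⟩
    · rw [← Matrix.mulVec_sub]
      refine (Matrix.linfty_opNorm_mulVec S.D₂inv (F.q ε y - F.qh y)).trans ?_
      have h8 : ‖S.D₂inv‖ * ‖F.q ε y - F.qh y‖ ≤ N * ‖w‖ := by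
        gcongr
        linarith
      have : 0 ≤ M * ((C₀ + P + 1) * (ε * (1 + R))) := by positivity
      linarith
    · refine hL.trans ?_
      have h9 : max ‖w‖ ((C₀ + P + 1) * (ε * (1 + R))) ≤ ‖w‖ + (C₀ + P + 1) * (ε * (1 + R)) :=
        max_le (by linarith) (by linarith [norm_nonneg w])
      have h10 := mul_le_mul_of_nonneg_left (hclose.trans h9) hM
      have h11 : M * ‖w‖ ≤ N * ‖w‖ := by
        gcongr
        linarith [norm_nonneg S.D₂inv]
      linarith

/-- The homoclinic orbit inherits the exponential decay of the pulses. -/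
theorem S3.homoclinic_le (h1 : S.S1) (h : F.S3 S) {Ls βs P : ℝ}
    (hbd : ∀ᶠ ε in 𝓝[>] (0 : ℝ), F.Bounds Ls βs P ε) (x : ℝ) :
    ‖F.vh x‖ ≤ Ls * Real.exp (-βs * |x|) ∧ ‖F.qh x‖ ≤ Ls * Real.exp (-βs * |x|) := by
  obtain ⟨C, N, hC, hN, hev⟩ := h.exists_log_interval h1
  have hR : ∀ᶠ ε in 𝓝[>] (0 : ℝ), |x| ≤ -Real.log ε / (2 * N) := by
    have : Tendsto (fun ε : ℝ => -Real.log ε / (2 * N)) (𝓝[>] 0) atTop :=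
      (tendsto_neg_atBot_atTop.comp Real.tendsto_log_nhdsGT_zero).atTop_div_const (by positivity)
    exact this.eventually_ge_atTop _
  have hlim : Tendsto (fun ε : ℝ => Ls * Real.exp (-βs * |x|) + C * ε ^ (1 / 2 : ℝ)) (𝓝[>] 0)
      (𝓝 (Ls * Real.exp (-βs * |x|) + C * 0)) :=
    ((tendsto_rpow_nhdsGT_zero (by norm_num)).const_mul C).const_add _
  rw [mul_zero, add_zero] at hlim
  have key : ∀ᶠ ε in 𝓝[>] (0 : ℝ), ‖F.vh x‖ ≤ Ls * Real.exp (-βs * |x|) + C * ε ^ (1 / 2 : ℝ) ∧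
      ‖F.qh x‖ ≤ Ls * Real.exp (-βs * |x|) + C * ε ^ (1 / 2 : ℝ) := by
    filter_upwards [hbd, hev, hR, h.tendsto_L.eventually_ge_atTop |x|] with ε hbd hev hR hL
    have h2 := hev x hR
    have hv := (norm_fst_le _).trans h2
    have hq := (norm_snd_le _).trans h2
    have h3 := norm_le_norm_add_norm_sub (F.v ε x) (F.vh x)
    have h4 := norm_le_norm_add_norm_sub (F.q ε x) (F.qh x)
    exact ⟨by linarith [hbd.v_le' hL], by linarith [hbd.q_le' hL]⟩
  exact ⟨ge_of_tendsto hlim (key.mono fun _ h => h.1), ge_of_tendsto hlim (key.mono fun _ h => h.2)⟩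

theorem rpow_le_of_le {ε a b : ℝ} (hε : 0 < ε) (hε1 : ε ≤ 1) (h : a ≤ b) : ε ^ b ≤ ε ^ a :=
  Real.rpow_le_rpow_of_exponent_ge hε hε1 h

/-- Up to logarithmic time the pulse is compared with the homoclinic by Gronwall; after that both
are exponentially small, and at logarithmic time this already means a power of `ε`. The
`p`-component is then obtained by integrating its equation. -/
theorem S3.exists_pulseRate (h1 : S.S1) (h : F.S3 S) : ∃ βf ρ, F.IsPulseRate S βf ρ := by
  obtain ⟨Ls, hLs, βs, hβs, P, hP, hbd, -⟩ := h.exists_bounds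
  obtain ⟨C₀, hC₀, hini⟩ := h.exists_initial
  obtain ⟨C₁, N, hC₁, hN, hlog⟩ := h.exists_log_interval h1
  have hdec := h.homoclinic_le h1 hbd
  obtain ⟨r, hr, M, hM, hlip⟩ := exists_lipschitz_near_compact h1.isOpen_dom
    ((h1.H₁_C2.prodMk h1.H₂_C2').of_le one_le_two)
    (isCompact_singleton.prod (h.isCompact_orbit.prod isCompact_singleton))
    (show {F.u₀} ×ˢ (insert 0 (range F.vh)) ×ˢ {(0 : ℝ)} ⊆ S.dom from
      prod_mono (singleton_subset_iff.2 h.u₀_mem)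
        (prod_mono (h.orbit_subset h1) (singleton_subset_iff.2 h1.zero_mem_I)))
  -- `exp (-βs |y|) ≤ ε^(βs/(2N))` beyond the logarithmic interval explains the second entry.
  -- Integrating an error `ε^b` over length `ε^(-b/2)` leaves `ε^(b/2)`, so both exponents returned
  -- are `b / 2`.
  set b := min (1 / 4) (βs / (2 * N)) with hb
  have hb0 : 0 < b := by positivity
  have hb1 : b ≤ 1 / 4 := min_le_left _ _
  have hb2 : b ≤ βs / (2 * N) := min_le_right _ _
  set C₂ := C₁ + 2 * Ls + C₀ + P + 1 with hC₂
  have hC₂0 : 0 ≤ C₂ := by positivity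
  refine ⟨b / 2, b / 2, by positivity, by linarith, by positivity,
    C₂ + (C₀ + (M + M * C₂)), ?_⟩
  have hε1 : ∀ᶠ ε in 𝓝[>] (0 : ℝ), ε ≤ 1 :=
    (eventually_le_nhds one_pos).filter_mono nhdsWithin_le_nhds
  have hLρ : ∀ᶠ ε in 𝓝[>] (0 : ℝ), ε ^ (-(b / 2)) ≤ F.L ε := by
    have hev := h.period.eventually_const_lt (half_lt_self h.Lc₀_pos)
    have hev2 := eventually_mul_rpow_lt (a := 1 - b / 2) (c := 1) (by linarith)
      (half_pos h.Lc₀_pos)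
    filter_upwards [hev, hev2, eventually_mem_nhdsWithin] with ε h2 h3 hpos
    have hpos : 0 < ε := hpos
    have e : ε * ε ^ (-(b / 2)) = ε ^ (1 - b / 2) := by
      nth_rewrite 1 [← Real.rpow_one ε]
      rw [← Real.rpow_add hpos]; rfl
    nlinarith
  filter_upwards [hbd, hini, hlog, hε1, hLρ, h.solution,
    eventually_mul_rpow_lt (a := b) (c := C₂) hb0 hr] with ε hbd hini hlog hε1 hLρ hsol hs x hx
  have hε := hbd.pos
  have hεb : 0 ≤ ε ^ b := by positivity
  have hle1 : ε ≤ ε ^ b := by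
    simpa using rpow_le_of_le hε hε1 (by linarith : b ≤ 1)
  have hRone : 1 ≤ ε ^ (-(b / 2)) :=
    Real.one_le_rpow_of_pos_of_le_one_of_nonpos hε hε1 (by linarith)
  have hεR : ε * ε ^ (-(b / 2)) ≤ ε ^ b := by
    nth_rewrite 1 [← Real.rpow_one ε]
    rw [← Real.rpow_add hε]
    exact rpow_le_of_le hε hε1 (by linarith)
  have hbR : ε ^ b * ε ^ (-(b / 2)) = ε ^ (b / 2) := by
    rw [← Real.rpow_add hε]; congr 1; ring
  have hbb : ε ^ b ≤ ε ^ (b / 2) := rpow_le_of_le hε hε1 (by linarith)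
  have hw : ∀ y, |y| ≤ ε ^ (-(b / 2)) →
      ‖(F.v ε y - F.vh y, F.q ε y - F.qh y)‖ ≤ (C₁ + 2 * Ls) * ε ^ b := by
    intro y hy
    rcases le_total |y| (-Real.log ε / (2 * N)) with h2 | h2
    · refine (hlog y h2).trans ?_
      have h3 : ε ^ (1 / 2 : ℝ) ≤ ε ^ b := rpow_le_of_le hε hε1 (by linarith)
      have h4 : C₁ * ε ^ (1 / 2 : ℝ) ≤ C₁ * ε ^ b := by gcongr
      nlinarith
    · have h3 : Real.exp (-βs * |y|) ≤ ε ^ b := by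
        refine le_trans ?_ (rpow_le_of_le hε hε1 hb2)
        rw [Real.rpow_def_of_pos hε, Real.exp_le_exp]
        have h5 : -βs * |y| ≤ -βs * (-Real.log ε / (2 * N)) :=
          mul_le_mul_of_nonpos_left h2 (by linarith)
        refine h5.trans (le_of_eq ?_)
        field_simp
      have h4 : Ls * Real.exp (-βs * |y|) ≤ Ls * ε ^ b := by gcongr
      have hyL := hy.trans hLρ
      refine norm_prod_le_iff.2 ⟨(norm_sub_le _ _).trans ?_, (norm_sub_le _ _).trans ?_⟩
      · have := hbd.v_le' hyL
        nlinarith [(hdec y).1]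
      · have := hbd.q_le' hyL
        nlinarith [(hdec y).2]
  have hu : ∀ y, |y| ≤ ε ^ (-(b / 2)) → ‖F.u ε y - F.u₀‖ ≤ (C₀ + P) * ε ^ b := by
    intro y hy
    have h2 := hbd.u_lip y 0
    rw [sub_zero] at h2
    have h3 := norm_sub_le_norm_sub_add_norm_sub (F.u ε y) (F.u ε 0) F.u₀
    have h4 : ε * P * |y| ≤ P * (ε * ε ^ (-(b / 2))) := by
      calc ε * P * |y| ≤ ε * P * ε ^ (-(b / 2)) := by gcongr
        _ = _ := by ring
    have h5 : P * (ε * ε ^ (-(b / 2))) ≤ P * ε ^ b := by gcongr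
    have h6 : C₀ * ε ≤ C₀ * ε ^ b := by gcongr
    linarith [hini.1]
  have hclose : ∀ y, |y| ≤ ε ^ (-(b / 2)) → ‖((F.u ε y, F.v ε y, ε) :
      (Fin m → ℝ) × (Fin n → ℝ) × ℝ) - (F.u₀, F.vh y, 0)‖ ≤ C₂ * ε ^ b := by
    intro y hy
    refine norm_triple_sub_le ((hu y hy).trans ?_) (((norm_fst_le _).trans (hw y hy)).trans ?_) ?_
    · gcongr; linarith
    · gcongr; linarith
    · rw [sub_zero, abs_of_pos hε]
      refine hle1.trans (le_mul_of_one_le_left hεb ?_)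
      linarith
  have hcont : Continuous fun z => S.H₂ F.u₀ (F.vh z) :=
    h1.H₂_C2'.continuousOn.comp_continuous (f := fun z => (F.u₀, F.vh z, (0 : ℝ)))
      (continuous_const.prodMk (h.continuous_vh.prodMk continuous_const))
      fun z => ⟨h.u₀_mem, (h.pulse z).1, h1.zero_mem_I⟩
  have hpd : ∀ y, HasDerivAt (fun y => F.p ε y - (F.p₀ + ∫ z in (0 : ℝ)..y, S.H₂ F.u₀ (F.vh z)))
      (ε • S.H₁ (F.u ε y) (F.v ε y) ε + S.H₂ (F.u ε y) (F.v ε y) - S.H₂ F.u₀ (F.vh y)) y := fun y =>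
    (hsol y).2.2.2.1.sub ((intervalIntegral.integral_hasDerivAt_right
      (hcont.intervalIntegrable _ _) (hcont.stronglyMeasurableAtFilter _ _)
      hcont.continuousAt).const_add F.p₀)
  have hx' : |x| ≤ ε ^ (-(b / 2)) := abs_le.2 hx
  have hp := gronwall_two_sided (M := 0) (δ := (M + M * C₂) * ε ^ b) (R := ε ^ (-(b / 2))) le_rfl
    (by positivity) hpd (fun y hy => ?_) x hx'
  · have hp' : ‖F.p ε x - (F.p₀ + ∫ z in (0 : ℝ)..x, S.H₂ F.u₀ (F.vh z))‖
        ≤ (C₀ + (M + M * C₂)) * ε ^ (b / 2) := by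
      refine hp.trans ?_
      rw [zero_mul, Real.exp_zero, mul_one, mul_assoc, hbR, intervalIntegral.integral_same,
        add_zero, add_mul]
      have : C₀ * ε ≤ C₀ * ε ^ (b / 2) := by gcongr; exact hle1.trans hbb
      linarith [hini.2.1]
    have hwx := hw x hx'
    have hC : ∀ {c : ℝ}, c ≤ C₂ → 0 ≤ c → c * ε ^ b ≤ (C₂ + (C₀ + (M + M * C₂))) * ε ^ (b / 2) := by
      intro c hc hc0
      have h5 : 0 ≤ C₀ + (M + M * C₂) := by positivity
      have h6 : c ≤ C₂ + (C₀ + (M + M * C₂)) := by linarith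
      gcongr
    refine norm_prod_le_iff.2 ⟨(hu x hx').trans (hC (by linarith) (by positivity)),
      norm_prod_le_iff.2 ⟨hp'.trans ?_, norm_prod_le_iff.2 ⟨?_, ?_⟩⟩⟩
    · exact mul_le_mul_of_nonneg_right (by linarith) (by positivity)
    · exact ((norm_fst_le _).trans hwx).trans (hC (by linarith) (by positivity))
    · exact ((norm_snd_le _).trans hwx).trans (hC (by linarith) (by positivity))
  · obtain ⟨-, hL, hbnd⟩ := hlip (F.u₀, F.vh y, 0)
      ⟨rfl, mem_insert_of_mem _ (mem_range_self y), rfl⟩ (F.u ε y, F.v ε y, ε) ((hclose y hy).trans hs.le)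
    have hH1 : ‖S.H₁ (F.u ε y) (F.v ε y) ε‖ ≤ M := (norm_fst_le _).trans hbnd
    have hH2 : ‖S.H₂ (F.u ε y) (F.v ε y) - S.H₂ F.u₀ (F.vh y)‖ ≤ M * (C₂ * ε ^ b) :=
      ((norm_snd_le _).trans hL).trans (by gcongr; exact hclose y hy)
    rw [zero_mul, zero_add, add_sub_assoc]
    refine (norm_add_le _ _).trans ?_
    rw [norm_smul, Real.norm_of_nonneg hε.le]
    have : ε * ‖S.H₁ (F.u ε y) (F.v ε y) ε‖ ≤ ε ^ b * M := by gcongr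
    nlinarith

end PulseFamily


/-! ### Coefficients along the pulse -/

section Blocks

theorem norm_fromBlocks_upper_le {a b c d : Type*} [Fintype a] [Fintype b] [Fintype c] [Fintype d]
    (B : Matrix a d ℂ) : ‖(Matrix.fromBlocks 0 B 0 0 : Matrix (a ⊕ b) (c ⊕ d) ℂ)‖ ≤ ‖B‖ := by
  rw [← coe_nnnorm, ← coe_nnnorm, NNReal.coe_le_coe, Matrix.linfty_opNNNorm_def]
  refine Finset.sup_le fun i _ => ?_
  rcases i with i | i
  · rw [Matrix.linfty_opNNNorm_def]
    simp only [Fintype.sum_sum_type, Matrix.fromBlocks_apply₁₁, Matrix.fromBlocks_apply₁₂,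
      Matrix.zero_apply, nnnorm_zero, Finset.sum_const_zero, zero_add]
    exact Finset.le_sup (f := fun i => ∑ j, ‖B i j‖₊) (Finset.mem_univ i)
  · simp

theorem norm_fromBlocks_antidiag_le {a b c d : Type*} [Fintype a] [Fintype b] [Fintype c]
    [Fintype d] (B : Matrix a d ℂ) (C : Matrix b c ℂ) :
    ‖(Matrix.fromBlocks 0 B C 0 : Matrix (a ⊕ b) (c ⊕ d) ℂ)‖ ≤ ‖B‖ + ‖C‖ := by
  have e : (Matrix.fromBlocks 0 B C 0 : Matrix (a ⊕ b) (c ⊕ d) ℂ)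
      = Matrix.fromBlocks 0 B 0 0 + Matrix.fromBlocks 0 0 C 0 := by
    simp [Matrix.fromBlocks_add]
  rw [e]
  exact (norm_add_le _ _).trans
    (add_le_add (norm_fromBlocks_upper_le B) (norm_fromBlocks_lower_le C))

theorem norm_one_matrix_le {a : Type*} [Fintype a] [DecidableEq a] :
    ‖(1 : Matrix a a ℂ)‖ ≤ 1 := by
  rw [← Matrix.diagonal_one, Matrix.linfty_opNorm_diagonal]
  exact (pi_norm_le_iff_of_nonneg zero_le_one).2 fun i => by simp

variable {m n : ℕ}

/-- The fast coefficient matrix with `∂ᵥG` replaced by `B`. -/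
noncomputable def RDSystem.fastBlock (S : RDSystem m n) (B : Matrix (Fin n) (Fin n) ℂ) (lam : ℂ) :
    Matrix (Fin n ⊕ Fin n) (Fin n ⊕ Fin n) ℂ :=
  Matrix.fromBlocks 0 (cx S.D₂inv) (B + lam • 1) 0

theorem RDSystem.norm_fastBlock_sub_le (S : RDSystem m n) (B B' : Matrix (Fin n) (Fin n) ℂ)
    (lam lam' : ℂ) :
    ‖S.fastBlock B lam - S.fastBlock B' lam'‖ ≤ ‖B - B'‖ + ‖lam - lam'‖ := by
  have e : S.fastBlock B lam - S.fastBlock B' lam'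
      = Matrix.fromBlocks 0 0 ((B - B') + (lam - lam') • 1) 0 := by
    rw [fastBlock, fastBlock, fromBlocks_sub_fromBlocks, sub_self, sub_self, sub_smul]
    congr 1
    abel
  rw [e]
  refine (norm_fromBlocks_lower_le _).trans ((norm_add_le _ _).trans ?_)
  gcongr
  rw [norm_smul]
  exact mul_le_of_le_one_right (norm_nonneg _) norm_one_matrix_le

theorem RDSystem.norm_fastBlock_le (S : RDSystem m n) (B : Matrix (Fin n) (Fin n) ℂ) (lam : ℂ) :
    ‖S.fastBlock B lam‖ ≤ ‖cx S.D₂inv‖ + (‖B‖ + ‖lam‖) := by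
  refine (norm_fromBlocks_antidiag_le _ _).trans (add_le_add le_rfl ((norm_add_le _ _).trans ?_))
  gcongr
  rw [norm_smul]
  exact mul_le_of_le_one_right (norm_nonneg _) norm_one_matrix_le

theorem RDSystem.continuous_fastBlock (S : RDSystem m n) {X : Type*} [TopologicalSpace X]
    {B : X → Matrix (Fin n) (Fin n) ℂ} (hB : Continuous B) (lam : ℂ) :
    Continuous fun x => S.fastBlock (B x) lam :=
  continuous_const.matrix_fromBlocks continuous_const (hB.add continuous_const) continuous_const

end Blocks

section Region

/-- With `w = λ - ω`, the sector condition gives `cos (arg w) ≤ cos ϖ < 0`, so the lower bound on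
`Re w` limits `‖w‖`. -/
theorem exists_bound_regionZero (ω Lam : ℝ) {ϖ : ℝ} (hϖ : ϖ ∈ Ioo (Real.pi / 2) Real.pi) :
    ∃ R, ∀ lam ∈ regionZero ω ϖ Lam, ‖lam‖ ≤ R := by
  have hcos : Real.cos ϖ < 0 :=
    Real.cos_neg_of_pi_div_two_lt_of_lt hϖ.1 (by linarith [hϖ.2, Real.pi_pos])
  refine ⟨(ω - Lam) / (-Real.cos ϖ) + ‖(ω : ℂ)‖, fun lam hlam => ?_⟩
  set w := lam - (ω : ℂ) with hw
  have h1 : ‖w‖ * Real.cos w.arg = w.re := Complex.norm_mul_cos_arg w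
  have h2 : Real.cos w.arg ≤ Real.cos ϖ := by
    rw [← Real.cos_abs w.arg]
    exact Real.cos_le_cos_of_nonneg_of_le_pi (by linarith [hϖ.1, Real.pi_pos])
      (Complex.abs_arg_le_pi w) hlam.2.2.le
  have h3 : w.re = lam.re - ω := by simp [hw]
  have h4 : ‖w‖ * (-Real.cos ϖ) ≤ ω - Lam := by
    have := mul_le_mul_of_nonneg_left h2 (norm_nonneg w)
    linarith [hlam.1]
  have h5 : ‖w‖ ≤ (ω - Lam) / (-Real.cos ϖ) := (le_div_iff₀ (by linarith)).2 h4
  have h6 : ‖lam‖ ≤ ‖w‖ + ‖(ω : ℂ)‖ := by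
    have := norm_add_le w (ω : ℂ)
    simpa [hw] using this
  linarith

end Region

theorem LocUnif.translate {J E : Type*} [NormedAddCommGroup E] {l : Filter J} {f : ℝ → E}
    (hf : Continuous f) {xk : J → ℝ} {x : ℝ} (hx : Tendsto xk l (𝓝 x)) :
    LocUnif l (fun j s => f (s + xk j)) (fun s => f (s + x)) := by
  intro R t ht
  have huc :=
    (isCompact_Icc (a := -(R + |x| + 1)) (b := R + |x| + 1)).uniformContinuousOn_of_continuous
    hf.continuousOn
  rw [Metric.uniformContinuousOn_iff] at huc
  obtain ⟨d, hd, h⟩ := huc t ht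
  filter_upwards [Metric.tendsto_nhds.1 hx (min d 1) (by positivity)] with j hj s hs
  have h1 := lt_min_iff.1 hj
  rw [Real.dist_eq] at h1
  have h2 := abs_le.1 hs
  have h3 := abs_lt.1 h1.2
  have h4 := neg_abs_le x
  have h5 := le_abs_self x
  refine le_of_lt ?_
  rw [← dist_eq_norm]
  refine h _ ⟨by linarith, by linarith⟩ _ ⟨by linarith, by linarith⟩ ?_
  rw [Real.dist_eq]
  rw [add_sub_add_left_eq_sub]
  exact h1.1

namespace PulseFamily

variable {m n : ℕ} {S : RDSystem m n} {F : PulseFamily m n}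

/-- The arguments `(u, v, ε)` of the coefficients along the pulse. -/
def base (F : PulseFamily m n) (ε x : ℝ) : (Fin m → ℝ) × (Fin n → ℝ) × ℝ := (F.u ε x, F.v ε x, ε)

/-- The arguments `(u₀, v_h, 0)` of the coefficients along the homoclinic pulse. -/
def baseH (F : PulseFamily m n) (x : ℝ) : (Fin m → ℝ) × (Fin n → ℝ) × ℝ := (F.u₀, F.vh x, 0)

theorem A22_eq (ε x : ℝ) (lam : ℂ) : F.A22 S ε x lam = S.fastBlock (S.GV (F.base ε x)) lam := rfl

theorem A22lim_eq (x : ℝ) (lam : ℂ) : F.A22lim S lam x = S.fastBlock (S.GV (F.baseH x)) lam := rfl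

/-- Uniform control of the derivatives of the interaction terms along the pulse. -/
structure Coeff (F : PulseFamily m n) (S : RDSystem m n) (K : Set (Fin m → ℝ))
    (M βf ρ : ℝ) (ε : ℝ) : Prop where
  le_one : ε ≤ 1
  u_mem : ∀ x, F.u ε x ∈ K
  mem : ∀ x, F.base ε x ∈ S.dom
  continuous_base : Continuous (F.base ε)
  jet_le : ∀ x, ‖S.jet (F.base ε x)‖ ≤ M
  GU_le : ∀ x, ‖S.GU (F.base ε x)‖ ≤ M * ‖F.v ε x‖
  GV_sub_le : ∀ x, ‖S.GV (F.base ε x) - S.GV (F.u ε x, 0, 0)‖ ≤ M * (ε + ‖F.v ε x‖)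
  GU_near : ∀ x ∈ pulseRegion ρ ε, ‖S.GU (F.base ε x) - S.GU (F.baseH x)‖ ≤ M * ε ^ βf
  GV_near : ∀ x ∈ pulseRegion ρ ε, ‖S.GV (F.base ε x) - S.GV (F.baseH x)‖ ≤ M * ε ^ βf

/-- `G(·, 0, ε)` vanishes identically near `u`. This is what makes the forcing `𝒜₂₁` of the Riccati
equation decay with `v`. -/
theorem GU_zero (h1 : S.S1) {u : Fin m → ℝ} (hu : u ∈ S.U) {ε : ℝ} (hε : ε ∈ S.I) :
    S.GU (u, 0, ε) = 0 := by
  have h : (fun u => S.G u 0 ε) =ᶠ[𝓝 u] fun _ => 0 := by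
    filter_upwards [h1.U_open.mem_nhds hu] with w hw
    exact h1.G_zero w hw ε hε
  have : jac (fun u => S.G u 0 ε) u = 0 := by
    rw [jac, h.fderiv_eq]
    simp
  change cx (jac (fun u => S.G u 0 ε) u) = 0
  rw [this]
  ext i j
  simp [cx]

/-- For small `ε` the arguments of the coefficients stay near the compact product of `K`, the closed
homoclinic orbit and a parameter interval: in the pulse region by the pulse rate, elsewhere because
`v` is small. Lipschitz estimates for the first derivatives then compare with the homoclinic or with
`v = 0`. -/
theorem S3.exists_coeff (h1 : S.S1) (h : F.S3 S) {K : Set (Fin m → ℝ)}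
    (hK : F.IsSlowCompactum S K) {βf ρ : ℝ} (hrate : F.IsPulseRate S βf ρ) :
    ∃ M, 0 ≤ M ∧ (∀ᶠ ε in 𝓝[>] (0 : ℝ), F.Coeff S K M βf ρ ε) ∧
      ∀ x, ‖S.GV (F.baseH x)‖ ≤ M ∧ ‖S.GU (F.baseH x)‖ ≤ M * ‖F.vh x‖ := by
  obtain ⟨hKc, hKU, hu₀, hKu⟩ := hK
  obtain ⟨hβ0, hβ1, hρ, C, hC⟩ := hrate
  obtain ⟨Ls, hLs, βs, hβs, P, hP, hbd, -⟩ := h.exists_bounds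
  obtain ⟨e₀, he₀, hball⟩ := Metric.isOpen_iff.1 h1.I_open 0 h1.zero_mem_I
  have hI : Icc (-(e₀ / 2)) (e₀ / 2) ⊆ S.I := fun y hy => hball (by
    rw [Metric.mem_ball, Real.dist_0_eq_abs]
    exact (abs_le.2 hy).trans_lt (half_lt_self he₀))
  have hsub : K ×ˢ (insert 0 (range F.vh)) ×ˢ Icc (-(e₀ / 2)) (e₀ / 2) ⊆ S.dom :=
    prod_mono hKU (prod_mono (h.orbit_subset h1) hI)
  obtain ⟨r, hr, M₀, hM₀, hlip⟩ := exists_lipschitz_near_compact h1.isOpen_dom h1.contDiffOn_jet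
    (hKc.prod (h.isCompact_orbit.prod isCompact_Icc)) hsub
  -- The local Lipschitz constant is made global: at distance at least `r`, two values bounded by
  -- `M₀` differ by at most `2 M₀ ≤ (2 M₀ / r) ‖z - z'‖`. This matters because `v` need not be small
  -- in the bounds by `‖v‖`.
  set N := M₀ * (1 + 2 / r) with hN
  have hN0 : 0 ≤ N := by positivity
  have hMN : M₀ ≤ N := le_mul_of_one_le_right hM₀ (by
    have : 0 < 2 / r := by positivity
    linarith)
  have hk : ∀ z' ∈ K ×ˢ (insert 0 (range F.vh)) ×ˢ Icc (-(e₀ / 2)) (e₀ / 2),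
      ‖S.jet z'‖ ≤ M₀ := fun z' hz' => (hlip z' hz' z' (by simpa using hr.le)).2.2
  have hglob : ∀ z' ∈ K ×ˢ (insert 0 (range F.vh)) ×ˢ Icc (-(e₀ / 2)) (e₀ / 2),
      ∀ z, ‖S.jet z‖ ≤ M₀ → ‖S.jet z - S.jet z'‖ ≤ N * ‖z - z'‖ := by
    intro z' hz' z hz
    rcases le_total ‖z - z'‖ r with h2 | h2
    · exact ((hlip z' hz' z h2).2.1).trans (by gcongr)
    · have h3 : (1 : ℝ) ≤ ‖z - z'‖ / r := (one_le_div hr).2 h2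
      have h4 : M₀ * 2 * 1 ≤ M₀ * 2 * (‖z - z'‖ / r) := by gcongr
      have h5 : N * ‖z - z'‖ = M₀ * ‖z - z'‖ + M₀ * 2 * (‖z - z'‖ / r) := by
        rw [hN]; ring
      have h6 : 0 ≤ M₀ * ‖z - z'‖ := by positivity
      linarith [norm_sub_le (S.jet z) (S.jet z'), hk z' hz']
  have h0I : (0 : ℝ) ∈ Icc (-(e₀ / 2)) (e₀ / 2) := ⟨by linarith, by linarith⟩
  have hGU : ∀ z z', ‖S.GU z - S.GU z'‖ ≤ ‖S.jet z - S.jet z'‖ := fun z z' =>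
    norm_fst_le (S.jet z - S.jet z')
  have hGV : ∀ z z', ‖S.GV z - S.GV z'‖ ≤ ‖S.jet z - S.jet z'‖ := fun z z' =>
    (norm_fst_le _).trans (norm_snd_le (S.jet z - S.jet z'))
  have hNle : N ≤ N * (|C| + 1) := le_mul_of_one_le_right hN0 (by linarith [abs_nonneg C])
  refine ⟨N * (|C| + 1), by positivity, ?_, fun x => ?_⟩
  · have hsmall : ∀ᶠ ε in 𝓝[>] (0 : ℝ), Ls * Real.exp (-βs * ε ^ (-ρ)) ≤ r := by
      have t1 : Tendsto (fun ε : ℝ => Real.exp (-βs * ε ^ (-ρ))) (𝓝[>] 0) (𝓝 0) :=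
        Real.tendsto_exp_atBot.comp
          ((tendsto_rpow_neg_nhdsGT_zero (neg_lt_zero.2 hρ)).const_mul_atTop_of_neg
            (neg_lt_zero.2 hβs))
      have t2 := t1.const_mul Ls
      rw [mul_zero] at t2
      exact t2.eventually_le_const hr
    have hε1 : ∀ᶠ ε in 𝓝[>] (0 : ℝ), ε ≤ 1 ∧ ε ≤ e₀ / 2 :=
      ((eventually_le_nhds one_pos).and (eventually_le_nhds (half_pos he₀))).filter_mono
        nhdsWithin_le_nhds
    filter_upwards [hKu, hC, hbd, hsmall, hε1, h.solution,
      eventually_mul_rpow_lt (a := βf) (c := |C|) hβ0 hr] with ε hKu hC hbd hsm hε1 hsol hCr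
    have hε := hbd.pos
    have hεI : ε ∈ Icc (-(e₀ / 2)) (e₀ / 2) := ⟨by linarith, hε1.2⟩
    have hεβ : ε ≤ ε ^ βf := by
      simpa using rpow_le_of_le hε hε1.1 (by linarith : βf ≤ 1)
    have hβp : 0 ≤ ε ^ βf := by positivity
    have hC' : ∀ x ∈ pulseRegion ρ ε, ‖F.u ε x - F.u₀‖ ≤ |C| * ε ^ βf ∧
        ‖F.v ε x - F.vh x‖ ≤ |C| * ε ^ βf := fun x hx => by
      have h2 : ‖F.phi ε x - F.phiH S x‖ ≤ |C| * ε ^ βf :=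
        (hC x hx).trans (by gcongr; exact le_abs_self C)
      exact ⟨(norm_fst_le _).trans h2, ((norm_fst_le _).trans ((norm_snd_le _).trans
        (norm_snd_le _))).trans h2⟩
    have hnear : ∀ x, ∃ w ∈ insert 0 (range F.vh), ‖F.v ε x - w‖ ≤ r := by
      intro x
      obtain ⟨y, k, hy, hx, hper⟩ := hbd.exists_cell x
      have e : F.v ε x = F.v ε y := by
        rw [hx]; exact congrArg (fun z : Phase m n => z.2.2.1) (hper y)
      rw [e]
      by_cases hy' : y ∈ pulseRegion ρ ε
      · exact ⟨F.vh y, mem_insert_of_mem _ (mem_range_self y), (hC' y hy').2.trans hCr.le⟩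
      · refine ⟨0, mem_insert _ _, ?_⟩
        rw [sub_zero]
        have h3 : ε ^ (-ρ) ≤ |y| := by
          by_contra h4
          exact hy' (abs_le.1 (not_le.1 h4).le)
        refine (hbd.v_le' hy).trans (le_trans ?_ hsm)
        have h5 := mul_le_mul_of_nonneg_left h3 hβs.le
        gcongr Ls * Real.exp ?_
        linarith
    have hz : ∀ x, F.base ε x ∈ S.dom ∧ ‖S.jet (F.base ε x)‖ ≤ M₀ := by
      intro x
      obtain ⟨w, hw, hwr⟩ := hnear x
      have := hlip (F.u ε x, w, ε) ⟨hKu x, hw, hεI⟩ (F.base ε x)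
        (norm_triple_sub_le (by simpa using hr.le) hwr (by simpa using hr.le))
      exact ⟨this.1, this.2.2⟩
    have hnr : ∀ x ∈ pulseRegion ρ ε, ‖S.jet (F.base ε x) - S.jet (F.baseH x)‖
        ≤ N * (|C| + 1) * ε ^ βf := by
      intro x hx
      refine (hglob (F.baseH x) ⟨hu₀, mem_insert_of_mem _ (mem_range_self x), h0I⟩ _
        (hz x).2).trans ?_
      refine (mul_le_mul_of_nonneg_left (?_ : _ ≤ (|C| + 1) * ε ^ βf) hN0).trans
        (mul_assoc _ _ _).symm.le
      have h2 := hC' x hx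
      refine norm_triple_sub_le (h2.1.trans ?_) (h2.2.trans ?_) ?_
      · linarith
      · linarith
      · rw [sub_zero, abs_of_pos hε]
        have : 0 ≤ |C| * ε ^ βf := by positivity
        linarith
    refine ⟨hε1.1, hKu, fun x => (hz x).1, ?_, fun x => (hz x).2.trans (hMN.trans hNle),
      fun x => ?_, fun x => ?_, fun x hx => (hGU _ _).trans (hnr x hx),
      fun x hx => (hGV _ _).trans (hnr x hx)⟩
    · exact continuous_iff_continuousAt.2 fun x => (hsol x).2.2.1.continuousAt.prodMk
        ((hsol x).2.2.2.2.1.continuousAt.prodMk continuousAt_const)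
    · have h2 := (hGU _ _).trans (hglob (F.u ε x, 0, ε) ⟨hKu x, mem_insert _ _, hεI⟩ _ (hz x).2)
      rw [GU_zero h1 (hKU (hKu x)) (hI hεI), sub_zero] at h2
      refine h2.trans ?_
      gcongr
      exact norm_triple_sub_le (by simp) (by simp) (by simp)
    · refine ((hGV _ _).trans (hglob (F.u ε x, 0, 0) ⟨hKu x, mem_insert _ _, h0I⟩ _
        (hz x).2)).trans ?_
      gcongr
      refine norm_triple_sub_le ?_ ?_ ?_
      · rw [sub_self, norm_zero]; positivity
      · rw [sub_zero]; linarith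
      · rw [sub_zero, abs_of_pos hε]; linarith [norm_nonneg (F.v ε x)]
  · have hx : F.baseH x ∈ K ×ˢ (insert 0 (range F.vh)) ×ˢ Icc (-(e₀ / 2)) (e₀ / 2) :=
      ⟨hu₀, mem_insert_of_mem _ (mem_range_self x), h0I⟩
    constructor
    · exact (((norm_fst_le _).trans (norm_snd_le (S.jet (F.baseH x)))).trans (hk _ hx)).trans
        (hMN.trans hNle)
    · have h2 := (hGU _ _).trans (hglob (F.u₀, 0, 0) ⟨hu₀, mem_insert _ _, h0I⟩ _ (hk _ hx))
      rw [GU_zero h1 h.u₀_mem h1.zero_mem_I, sub_zero] at h2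
      refine h2.trans ?_
      gcongr
      exact norm_triple_sub_le (by simp) (by simp) (by simp)

end PulseFamily


/-! ### A uniform a priori estimate for the fast system -/

namespace PulseFamily

variable {m n : ℕ} {S : RDSystem m n} {F : PulseFamily m n}

theorem S3.continuous_baseH (h : F.S3 S) : Continuous F.baseH :=
  continuous_const.prodMk (h.continuous_vh.prodMk continuous_const)

theorem S3.baseH_mem (h1 : S.S1) (h : F.S3 S) (x : ℝ) : F.baseH x ∈ S.dom :=
  ⟨h.u₀_mem, (h.pulse x).1, h1.zero_mem_I⟩

theorem continuousOn_GV (h1 : S.S1) : ContinuousOn S.GV S.dom :=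
  (continuous_fst.comp continuous_snd).comp_continuousOn h1.contDiffOn_jet.continuousOn

theorem continuousOn_GU (h1 : S.S1) : ContinuousOn S.GU S.dom :=
  continuous_fst.comp_continuousOn h1.contDiffOn_jet.continuousOn

theorem S3.continuous_A22lim (h1 : S.S1) (h : F.S3 S) (lam : ℂ) : Continuous (F.A22lim S lam) :=
  S.continuous_fastBlock ((continuousOn_GV h1).comp_continuous h.continuous_baseH
    (h.baseH_mem h1)) lam

theorem S3.tendsto_A22lim (h1 : S.S1) (h : F.S3 S) (lam : ℂ) {l : Filter ℝ}
    (hl : Tendsto (fun x => (F.vh x, F.qh x)) l (𝓝 0)) :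
    Tendsto (F.A22lim S lam) l (𝓝 (S.asympMatrix F.u₀ lam)) := by
  have hmem : ((F.u₀, 0, 0) : (Fin m → ℝ) × (Fin n → ℝ) × ℝ) ∈ S.dom :=
    ⟨h.u₀_mem, h1.zero_mem_V, h1.zero_mem_I⟩
  have hv : Tendsto F.vh l (𝓝 0) := (continuous_fst.tendsto _).comp hl
  have hb : Tendsto F.baseH l (𝓝 (F.u₀, 0, 0)) :=
    tendsto_const_nhds.prodMk_nhds (hv.prodMk_nhds tendsto_const_nhds)
  have hG : Tendsto (fun x => S.GV (F.baseH x)) l (𝓝 (S.GV (F.u₀, 0, 0))) :=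
    (((continuousOn_GV h1).continuousAt (h1.isOpen_dom.mem_nhds hmem)).tendsto).comp hb
  exact ((S.continuous_fastBlock continuous_id lam).tendsto _).comp hG

/-- Off the zeros of the fast reduced Evans function the fast limit problem has no nonzero
bounded solution. -/
theorem S3.eq_zero_of_bounded (h1 : S.S1) (h : F.S3 S) {K : Set (Fin m → ℝ)}
    (hK : F.IsSlowCompactum S K) {βf ρ : ℝ} (hrate : F.IsPulseRate S βf ρ) {Lam₀ Lam : ℝ}
    (hgap : S.SpectralGap K Lam₀) (hLam : Lam ∈ Ioo (-Lam₀) 0) {lam : ℂ} (hlam : Lam ≤ lam.re)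
    (hz : lam ∉ F.fastZeros S Lam) {κ : Type*} [Fintype κ]
    {W : ℝ → Matrix (Fin n ⊕ Fin n) κ ℂ} (hW : ∀ x, HasDerivAt W (F.A22lim S lam x * W x) x)
    {B : ℝ} (hB : ∀ x, ‖W x‖ ≤ B) : W = 0 := by
  by_contra hne
  obtain ⟨M, hM, -, hMx⟩ := h.exists_coeff h1 hK hrate
  refine hz ⟨hlam, isFastReducedEvansValue_zero_of_bounded (h.continuous_A22lim h1 lam)
    (M := ‖cx S.D₂inv‖ + (M + ‖lam‖)) (fun x => ?_) (h.tendsto_A22lim h1 lam h.homoclinic_top)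
    (h.tendsto_A22lim h1 lam h.homoclinic_bot) (hgap.re_ne_zero hLam hK.2.2.1 hlam) hW hB hne⟩
  rw [A22lim_eq]
  refine (S.norm_fastBlock_le _ _).trans ?_
  gcongr
  exact (hMx x).1

/-- Removing open discs of a fixed radius keeps limits of points of the region away from the zeros;
the half-plane constraint only survives in closed form. -/
theorem not_mem_fastZeros_of_tendsto {ω ϖ Lam δ : ℝ} (hδ : 0 < δ) {J : Type*} {l : Filter J}
    [l.NeBot] {lam : J → ℂ} (hmem : ∀ j, lam j ∈ region F S ω ϖ Lam δ) {lam₀ : ℂ}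
    (hlim : Tendsto lam l (𝓝 lam₀)) : Lam ≤ lam₀.re ∧ lam₀ ∉ F.fastZeros S Lam := by
  refine ⟨ge_of_tendsto ((Complex.continuous_re.tendsto _).comp hlim)
    (Eventually.of_forall fun j => (hmem j).1.1.le), fun hz => ?_⟩
  obtain ⟨j, hj⟩ := (hlim.eventually (Metric.ball_mem_nhds lam₀ hδ)).exists
  exact (hmem j).2 (mem_iUnion₂.2 ⟨lam₀, hz, hj⟩)

/-- Failure of the a priori estimate, normalized at a point of the fundamental cell. -/
theorem Bounds.exists_of_not_apriori {Ls βs P ε : ℝ} (h : F.Bounds Ls βs P ε) {lam : ℂ}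
    {κ : Type*} [Fintype κ] {η : ℝ} (hη : 0 < η)
    (hno : ¬ APriori (fun x => F.A22 S ε x lam) κ (1 / η)) :
    ∃ (y : ℝ) (W Φ : ℝ → Matrix (Fin n ⊕ Fin n) κ ℂ), |y| ≤ F.L ε ∧
      (∀ x, HasDerivAt W (F.A22 S ε (x + y) lam * W x + Φ x) x) ∧ (∀ x, ‖W x‖ ≤ 1) ∧
      (∀ x, ‖Φ x‖ ≤ η) ∧ 1 / 2 < ‖W 0‖ := by
  by_contra hcon
  push Not at hcon
  refine hno (apriori_of_normalized hη fun W Φ hW hW1 hΦ x => ?_)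
  obtain ⟨y, k, hy, hx, hper⟩ := h.exists_cell x
  have e : ∀ s, F.A22 S ε (s + x) lam = F.A22 S ε (s + y) lam := fun s => by
    have h2 := hper (s + y)
    have hu : F.u ε (s + x) = F.u ε (s + y) := by
      rw [hx, ← add_assoc]; exact congrArg (fun z : Phase m n => z.1) h2
    have hv : F.v ε (s + x) = F.v ε (s + y) := by
      rw [hx, ← add_assoc]; exact congrArg (fun z : Phase m n => z.2.2.1) h2
    rw [A22_eq, A22_eq, base, base, hu, hv]
  have := hcon y (fun s => W (s + x)) (fun s => Φ (s + x)) hy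
    (fun s => ((hW (s + x)).comp_add_const s x).congr_deriv (by rw [e]))
    (fun s => hW1 _) (fun s => hΦ _)
  simpa using this

/-- Compactness with two scenarios for the points `y j` where normalized counterexamples are not
small. If they stay bounded along the ultrafilter, the translated coefficients converge to the fast
limit problem; otherwise the pulse leaves every window and they converge to the hyperbolic matrix at
some `u₁ ∈ K`. Neither limit has a nonzero bounded solution. Translations within the fundamental
cell suffice by periodicity, and the bounded region makes `λ` converge. -/
theorem S3.exists_uniform_apriori (h1 : S.S1) (h : F.S3 S) {K : Set (Fin m → ℝ)}
    (hK : F.IsSlowCompactum S K) {βf ρ : ℝ} (hrate : F.IsPulseRate S βf ρ) {Lam₀ Lam : ℝ}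
    (hgap : S.SpectralGap K Lam₀) (hLam : Lam ∈ Ioo (-Lam₀) 0) {δ : ℝ} (hδ : 0 < δ) (ω : ℝ)
    {ϖ : ℝ} (hϖ : ϖ ∈ Ioo (Real.pi / 2) Real.pi) (κ : Type*) [Fintype κ] :
    ∃ C, 0 ≤ C ∧ ∀ᶠ ε in 𝓝[>] (0 : ℝ), ∀ lam ∈ region F S ω ϖ Lam δ,
      APriori (fun x => F.A22 S ε x lam) κ C := by
  obtain ⟨M, hM, hco, hMx⟩ := h.exists_coeff h1 hK hrate
  obtain ⟨Ls, hLs, βs, hβs, P, hP, hbd, -⟩ := h.exists_bounds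
  obtain ⟨Rlam, hRlam⟩ := exists_bound_regionZero ω Lam hϖ
  by_contra hcon
  push Not at hcon
  have hseq : ∀ j : ℕ, ∃ (ε : ℝ) (lam : ℂ) (y : ℝ) (W Φ : ℝ → Matrix (Fin n ⊕ Fin n) κ ℂ),
      ε ∈ Ioo 0 (1 / ((j : ℝ) + 1)) ∧ F.Coeff S K M βf ρ ε ∧ F.Bounds Ls βs P ε ∧
      lam ∈ region F S ω ϖ Lam δ ∧ |y| ≤ F.L ε ∧
      (∀ x, HasDerivAt W (F.A22 S ε (x + y) lam * W x + Φ x) x) ∧ (∀ x, ‖W x‖ ≤ 1) ∧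
      (∀ x, ‖Φ x‖ ≤ 1 / ((j : ℝ) + 1)) ∧ 1 / 2 < ‖W 0‖ := by
    intro j
    have hj : (0 : ℝ) < 1 / ((j : ℝ) + 1) := by positivity
    have hfr := hcon (1 / (1 / ((j : ℝ) + 1))) (by positivity)
    obtain ⟨ε, ⟨lam, hlam, hno⟩, hc, hb, hε⟩ := (hfr.and_eventually
      (hco.and (hbd.and (Ioo_mem_nhdsGT hj)))).exists
    obtain ⟨y, W, Φ, hy, hrest⟩ := hb.exists_of_not_apriori hj hno
    exact ⟨ε, lam, y, W, Φ, hε, hc, hb, hlam, hy, hrest⟩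
  choose ε lam y W Φ hε hc hb hlam hy hW hW1 hΦ hW0 using hseq
  set l : Ultrafilter ℕ := hyperfilter ℕ with hl
  have hη : Tendsto (fun j : ℕ => 1 / ((j : ℝ) + 1)) l (𝓝 0) :=
    tendsto_one_div_add_atTop_nhds_zero_nat.mono_left Nat.hyperfilter_le_atTop
  have hε0 : Tendsto ε l (𝓝[>] 0) := tendsto_nhdsWithin_iff.2
    ⟨squeeze_zero (fun j => (hε j).1.le) (fun j => (hε j).2.le) hη,
      Eventually.of_forall fun j => (hε j).1⟩
  obtain ⟨lam₀, -, hlim⟩ := (isCompact_closedBall (0 : ℂ) Rlam).ultrafilter_le_nhds'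
    (l.map lam) (by
      change ∀ᶠ j in (l : Filter ℕ), lam j ∈ Metric.closedBall 0 Rlam
      refine Eventually.of_forall fun j => ?_
      rw [mem_closedBall_zero_iff]
      exact hRlam _ (hlam j).1)
  have hlim : Tendsto lam l (𝓝 lam₀) := hlim
  obtain ⟨hre, hz⟩ := not_mem_fastZeros_of_tendsto hδ hlam hlim
  have hlam0 : Tendsto (fun j => ‖lam j - lam₀‖) l (𝓝 0) :=
    tendsto_iff_norm_sub_tendsto_zero.1 hlim
  by_cases hcase : ∃ R, ∀ᶠ j in (l : Filter ℕ), |y j| ≤ R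
  · obtain ⟨R₀, hR₀⟩ := hcase
    obtain ⟨y₀, -, hy₀⟩ := (isCompact_Icc (a := -R₀) (b := R₀)).ultrafilter_le_nhds'
      (l.map y) (hR₀.mono fun j hj => abs_le.1 hj)
    have hy₀ : Tendsto y l (𝓝 y₀) := hy₀
    have hAk : LocUnif l (fun j x => F.A22 S (ε j) (x + y j) (lam j))
        (fun x => F.A22lim S lam₀ (x + y₀)) := by
      intro R t ht
      have ht1 : Tendsto (fun j => M * ε j ^ βf + ‖lam j - lam₀‖) l (𝓝 0) := by
        simpa using (((tendsto_rpow_nhdsGT_zero hrate.1).comp hε0).const_mul M).add hlam0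
      have hreg := ((tendsto_rpow_neg_nhdsGT_zero (neg_lt_zero.2 hrate.2.2.1)).comp
        hε0).eventually_ge_atTop (R + R₀)
      filter_upwards [LocUnif.translate (h.continuous_A22lim h1 lam₀) hy₀
        R (t / 2) (half_pos ht), ht1.eventually_le_const (half_pos ht), hreg, hR₀]
        with j hj1 hj2 hj3 hj4 x hx
      have hin : x + y j ∈ pulseRegion ρ (ε j) := abs_le.1 ((abs_add_le _ _).trans
        (le_trans (add_le_add hx hj4) hj3))
      have h5 := S.norm_fastBlock_sub_le (S.GV (F.base (ε j) (x + y j))) (S.GV (F.baseH (x + y j)))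
        (lam j) lam₀
      rw [← A22_eq, ← A22lim_eq] at h5
      have h6 := (hc j).GV_near _ hin
      have h7 := hj1 x hx
      have h8 := norm_sub_le_norm_sub_add_norm_sub (F.A22 S (ε j) (x + y j) (lam j))
        (F.A22lim S lam₀ (x + y j)) (F.A22lim S lam₀ (x + y₀))
      linarith
    obtain ⟨Z, hZ, hZ1, hZ0⟩ := exists_bounded_solution_of_approx
      (A := fun x => F.A22lim S lam₀ (x + y₀))
      ((h.continuous_A22lim h1 lam₀).comp (continuous_id.add continuous_const)) hAk hη hW hW1 hΦ hW0
    have hzero := h.eq_zero_of_bounded h1 hK hrate hgap hLam hre hz (W := fun x => Z (x - y₀))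
      (fun x => ((hZ (x - y₀)).comp_sub_const x y₀).congr_deriv (by rw [sub_add_cancel]))
      (fun x => hZ1 _)
    refine hZ0 (funext fun x => ?_)
    have := congrFun hzero (x + y₀)
    simpa using this
  · have hfar : ∀ R, ∀ᶠ j in (l : Filter ℕ), R < |y j| := fun R => by
      have : ¬ ∀ᶠ j in (l : Filter ℕ), |y j| ≤ R := fun h' => hcase ⟨R, h'⟩
      have := Ultrafilter.eventually_not.2 this
      exact this.mono fun j hj => not_le.1 hj
    obtain ⟨u₁, hu₁, hulim⟩ := hK.1.ultrafilter_le_nhds' (l.map fun j => F.u (ε j) (y j))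
      (by
        change ∀ᶠ j in (l : Filter ℕ), F.u (ε j) (y j) ∈ K
        exact Eventually.of_forall fun j => (hc j).u_mem _)
    have hulim : Tendsto (fun j => F.u (ε j) (y j)) l (𝓝 u₁) := hulim
    have hu0 : Tendsto (fun j => ‖F.u (ε j) (y j) - u₁‖) l (𝓝 0) :=
      tendsto_iff_norm_sub_tendsto_zero.1 hulim
    have hε0' : Tendsto ε l (𝓝 0) := hε0.mono_right nhdsWithin_le_nhds
    have hAk : LocUnif l (fun j x => F.A22 S (ε j) (x + y j) (lam j))
        (fun _ => S.asympMatrix u₁ lam₀) := by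
      intro R t ht
      have hmem : ((u₁, 0, 0) : (Fin m → ℝ) × (Fin n → ℝ) × ℝ) ∈ S.dom :=
        ⟨hK.2.1 hu₁, h1.zero_mem_V, h1.zero_mem_I⟩
      obtain ⟨d, hd, hd'⟩ := Metric.continuousAt_iff.1
        ((continuousOn_GV h1).continuousAt (h1.isOpen_dom.mem_nhds hmem)) (t / 3) (by positivity)
      -- The quantity `min |y| L - R` bounds from below the distance of the window around `y` to the
      -- pulse at `0` and to its neighbours at `±2L`.
      have hmin : Tendsto (fun j => min |y j| (F.L (ε j)) - R) l atTop := by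
        refine tendsto_atTop_add_const_right _ _ (tendsto_atTop.2 fun b => ?_)
        filter_upwards [hfar b, (h.tendsto_L.comp hε0).eventually_ge_atTop b] with j h2 h3
        exact le_min h2.le h3
      have hexp : Tendsto (fun j => Real.exp (-βs * (min |y j| (F.L (ε j)) - R))) l (𝓝 0) :=
        Real.tendsto_exp_atBot.comp (hmin.const_mul_atTop_of_neg (neg_lt_zero.2 hβs))
      have ht1 : Tendsto (fun j => M * (ε j + Ls * Real.exp (-βs * (min |y j| (F.L (ε j)) - R))))
          l (𝓝 0) := by
        simpa using (hε0'.add (hexp.const_mul Ls)).const_mul M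
      have ht2 : Tendsto (fun j => ε j * P * R + ‖F.u (ε j) (y j) - u₁‖) l (𝓝 0) := by
        simpa using ((hε0'.mul_const P).mul_const R).add hu0
      filter_upwards [ht1.eventually_le_const (by positivity : 0 < t / 3),
        ht2.eventually_lt_const hd, hlam0.eventually_le_const (by positivity : 0 < t / 3),
        hmin.eventually_ge_atTop 0] with j hj1 hj2 hj3 hj4 x hx
      have hj4' : R ≤ min |y j| (F.L (ε j)) := by linarith
      have hxy1 : |x + y j| ≤ |x| + |y j| := abs_add_le _ _
      have hxy2 : |y j| ≤ |x + y j| + |x| := by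
        have := abs_sub_abs_le_abs_sub (y j) (-x)
        rw [abs_neg, sub_neg_eq_add, add_comm (y j)] at this
        linarith
      have hv : ‖F.v (ε j) (x + y j)‖
          ≤ Ls * Real.exp (-βs * (min |y j| (F.L (ε j)) - R)) := by
        have hL : R ≤ F.L (ε j) := hj4'.trans (min_le_right _ _)
        refine ((hb j).v_le _ (by linarith [hy j])).trans ?_
        have h2 : min |y j| (F.L (ε j)) - R
            ≤ min |x + y j| (2 * F.L (ε j) - |x + y j|) := by
          refine le_min ?_ ?_
          · linarith [min_le_left |y j| (F.L (ε j))]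
          · linarith [min_le_right |y j| (F.L (ε j)), hy j]
        have h3 := mul_le_mul_of_nonneg_left h2 hβs.le
        gcongr Ls * Real.exp ?_
        linarith
      have hu : ‖F.u (ε j) (x + y j) - u₁‖ < d := by
        have h2 := norm_sub_le_norm_sub_add_norm_sub (F.u (ε j) (x + y j)) (F.u (ε j) (y j)) u₁
        have h3 := (hb j).u_lip (x + y j) (y j)
        rw [add_sub_cancel_right] at h3
        have h4 : ε j * P * |x| ≤ ε j * P * R := by
          have := (hε j).1.le
          gcongr
        linarith
      have hG1 := (hc j).GV_sub_le (x + y j)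
      have hG2 : ‖S.GV (F.u (ε j) (x + y j), 0, 0) - S.GV (u₁, 0, 0)‖ ≤ t / 3 := by
        rw [← dist_eq_norm]
        refine (hd' ?_).le
        rw [dist_eq_norm]
        refine lt_of_le_of_lt (norm_triple_sub_le le_rfl ?_ ?_) hu <;> simp
      have hG3 := norm_sub_le_norm_sub_add_norm_sub (S.GV (F.base (ε j) (x + y j)))
        (S.GV (F.u (ε j) (x + y j), 0, 0)) (S.GV (u₁, 0, 0))
      have hG4 : M * (ε j + ‖F.v (ε j) (x + y j)‖)
          ≤ M * (ε j + Ls * Real.exp (-βs * (min |y j| (F.L (ε j)) - R))) := by gcongr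
      refine (S.norm_fastBlock_sub_le (S.GV (F.base (ε j) (x + y j))) (S.GV (u₁, 0, 0))
        (lam j) lam₀).trans ?_
      linarith
    obtain ⟨Z, hZ, hZ1, hZ0⟩ := exists_bounded_solution_of_approx
      (A := fun _ => S.asympMatrix u₁ lam₀) continuous_const hAk hη hW hW1 hΦ hW0
    exact hZ0 (eq_zero_of_bounded_of_hyperbolic (hgap.re_ne_zero hLam hu₁ hre) hZ hZ1)

end PulseFamily


/-! ### Periodic solutions of Riccati equations -/

section Riccati

variable {ι κ : Type*} [Fintype ι] [Fintype κ]

/-- A periodic substitute for `exp (k |x|)`, with `x` replaced by `sin (a x) / a`, `a = π / (2L)`.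
Jordan's inequality keeps at least `2/π ≥ 1/2` of the growth on the cell, which is why localization
is obtained at half the rate. -/
theorem exists_periodic_weight {L k : ℝ} (hL : 0 < L) (hk : 0 ≤ k) :
    ∃ g g' : ℝ → ℝ, (∀ x, HasDerivAt g (g' x) x) ∧ (∀ x, 0 < g x) ∧ (∀ x, |g' x| ≤ k * g x) ∧
      (∀ x, g (x + 2 * L) = g x) ∧ (∀ x, g x ≤ Real.exp (k * (1 + |x|))) ∧
      ∀ x, |x| ≤ L → Real.exp (k / 2 * |x|) ≤ g x := by
  set a := Real.pi / (2 * L) with ha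
  have ha0 : 0 < a := by have := Real.pi_pos; positivity
  set σ : ℝ → ℝ := fun x => √(1 + (Real.sin (a * x) / a) ^ 2) with hσ
  have hsq : ∀ x, 0 < 1 + (Real.sin (a * x) / a) ^ 2 := fun x => by positivity
  have hσ0 : ∀ x, 0 < σ x := fun x => Real.sqrt_pos.2 (hsq x)
  have hσ1 : ∀ x, |Real.sin (a * x) / a| ≤ σ x := fun x => Real.abs_le_sqrt (by linarith)
  have hσ2 : ∀ x, σ x ≤ 1 + |x| := fun x => by
    have h1 : |Real.sin (a * x) / a| ≤ |x| := by
      rw [abs_div, abs_of_pos ha0, div_le_iff₀ ha0]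
      refine Real.abs_sin_le_abs.trans ?_
      rw [abs_mul, abs_of_pos ha0, mul_comm]
    rw [hσ, Real.sqrt_le_left (by positivity)]
    nlinarith [abs_nonneg x, abs_nonneg (Real.sin (a * x) / a), sq_abs (Real.sin (a * x) / a)]
  have hσ' : ∀ x, HasDerivAt σ (Real.sin (a * x) / a * Real.cos (a * x) / σ x) x := fun x => by
    have h0 : HasDerivAt (fun x : ℝ => a * x) a x := by
      simpa using (hasDerivAt_id x).const_mul a
    have h1 : HasDerivAt (fun x : ℝ => Real.sin (a * x) / a) (Real.cos (a * x)) x :=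
      (h0.sin.div_const a).congr_deriv (by field_simp)
    have h2 : HasDerivAt (fun x : ℝ => 1 + (Real.sin (a * x) / a) ^ 2)
        (2 * (Real.sin (a * x) / a * Real.cos (a * x))) x :=
      ((h1.pow 2).const_add 1).congr_deriv (by push_cast; ring)
    exact (h2.sqrt (hsq x).ne').congr_deriv (by
      simp only [hσ]; rw [mul_div_mul_left _ _ two_ne_zero])
  refine ⟨fun x => Real.exp (k * σ x), fun x => Real.exp (k * σ x) *
    (k * (Real.sin (a * x) / a * Real.cos (a * x) / σ x)),
    fun x => ((hσ' x).const_mul k).exp, fun x => Real.exp_pos _, fun x => ?_, fun x => ?_,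
    fun x => ?_, fun x hx => ?_⟩
  · have h1 : |Real.sin (a * x) / a * Real.cos (a * x) / σ x| ≤ 1 := by
      rw [abs_div, abs_of_pos (hσ0 x), div_le_one (hσ0 x), abs_mul]
      exact (mul_le_of_le_one_right (abs_nonneg _) (Real.abs_cos_le_one _)).trans (hσ1 x)
    rw [abs_mul, abs_mul, Real.abs_exp, abs_of_nonneg hk, mul_comm]
    gcongr
    exact mul_le_of_le_one_right hk h1
  · have h1 : a * (x + 2 * L) = a * x + Real.pi := by rw [ha]; field_simp
    simp only [hσ]
    rw [h1, Real.sin_add_pi, neg_div, neg_sq]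
  · exact Real.exp_le_exp.2 (mul_le_mul_of_nonneg_left (hσ2 x) hk)
  · refine Real.exp_le_exp.2 ?_
    have h1 : |a * x| ≤ Real.pi / 2 := by
      rw [abs_mul, abs_of_pos ha0, ha]
      calc Real.pi / (2 * L) * |x| ≤ Real.pi / (2 * L) * L := by
            have := Real.pi_pos
            gcongr
        _ = Real.pi / 2 := by field_simp
    have h2 := Real.mul_abs_le_abs_sin h1
    have h3 : 2 / Real.pi * |x| ≤ |Real.sin (a * x) / a| := by
      rw [abs_div, abs_of_pos ha0, le_div_iff₀ ha0]
      rw [abs_mul, abs_of_pos ha0] at h2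
      linarith
    have h4 : (1 : ℝ) / 2 ≤ 2 / Real.pi := by
      rw [div_le_div_iff₀ two_pos Real.pi_pos]
      linarith [Real.pi_le_four]
    have h5 : 1 / 2 * |x| ≤ σ x := by
      refine le_trans ?_ (h3.trans (hσ1 x))
      gcongr
    have h6 := mul_le_mul_of_nonneg_left h5 hk
    linarith

theorem exists_mem_cell {L : ℝ} (hL : 0 < L) (x : ℝ) :
    ∃ (y : ℝ) (k : ℤ), |y| ≤ L ∧ x = y + k * (2 * L) := by
  have hL : 0 < 2 * L := by linarith
  refine ⟨toIcoMod hL (-L) x, toIcoDiv hL (-L) x, ?_, ?_⟩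
  · have := toIcoMod_mem_Ico hL (-L) x
    rw [abs_le]
    exact ⟨this.1, by linarith [this.2]⟩
  · have := toIcoMod_add_toIcoDiv_zsmul hL (-L) x
    rw [zsmul_eq_mul] at this
    exact this.symm

theorem norm_quadratic_le {W : Matrix ι κ ℂ} {P : Matrix κ κ ℂ} {Q : Matrix κ ι ℂ} {s r : ℝ}
    (hP : ‖P‖ ≤ s) (hQ : ‖Q‖ ≤ s) (hW : ‖W‖ ≤ r) :
    ‖W * P + W * Q * W‖ ≤ s * (1 + r) * ‖W‖ := by
  have hs : 0 ≤ s := (norm_nonneg _).trans hP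
  have h1 : ‖W * P‖ ≤ ‖W‖ * s := (Matrix.linfty_opNorm_mul _ _).trans (by gcongr)
  have h2 : ‖W * Q * W‖ ≤ ‖W‖ * s * r := (Matrix.linfty_opNorm_mul _ _).trans (by
    gcongr
    exact (Matrix.linfty_opNorm_mul _ _).trans (by gcongr))
  refine (norm_add_le _ _).trans ?_
  linarith

theorem norm_quadratic_sub_le {W Z : Matrix ι κ ℂ} {P : Matrix κ κ ℂ} {Q : Matrix κ ι ℂ} {s r : ℝ}
    (hP : ‖P‖ ≤ s) (hQ : ‖Q‖ ≤ s) (hW : ‖W‖ ≤ r) (hZ : ‖Z‖ ≤ r) :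
    ‖(W * P + W * Q * W) - (Z * P + Z * Q * Z)‖ ≤ s * (1 + 2 * r) * ‖W - Z‖ := by
  have hs : 0 ≤ s := (norm_nonneg _).trans hP
  have e : (W * P + W * Q * W) - (Z * P + Z * Q * Z)
      = (W - Z) * P + (W - Z) * Q * W + Z * Q * (W - Z) := by
    simp only [Matrix.sub_mul, Matrix.mul_sub]; abel
  have h1 : ‖(W - Z) * P‖ ≤ ‖W - Z‖ * s := (Matrix.linfty_opNorm_mul _ _).trans (by gcongr)
  have h2 : ‖(W - Z) * Q * W‖ ≤ ‖W - Z‖ * s * r := (Matrix.linfty_opNorm_mul _ _).trans (by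
    gcongr
    exact (Matrix.linfty_opNorm_mul _ _).trans (by gcongr))
  have h3 : ‖Z * Q * (W - Z)‖ ≤ r * s * ‖W - Z‖ := (Matrix.linfty_opNorm_mul _ _).trans (by
    have : ‖Z * Q‖ ≤ r * s := (Matrix.linfty_opNorm_mul _ _).trans (by
      have := (norm_nonneg _).trans hZ
      gcongr)
    gcongr)
  rw [e]
  refine (norm_add₃_le).trans ?_
  linarith

/-- Picard iteration with the slow terms as forcing: each step solves a linear periodic problem. The
a priori estimate keeps the ball of radius `2 C M` invariant and, the slow coefficients being small,
makes the step a contraction with constant `1/2`. -/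
theorem exists_periodic_riccati {A : ℝ → Matrix ι ι ℂ} {P : ℝ → Matrix κ κ ℂ}
    {Q : ℝ → Matrix κ ι ℂ} {R : ℝ → Matrix ι κ ℂ} (hA : Continuous A) (hP : Continuous P)
    (hQ : Continuous Q) (hR : Continuous R) {T : ℝ} (hT : T ≠ 0) (hAT : ∀ x, A (x + T) = A x)
    (hPT : ∀ x, P (x + T) = P x) (hQT : ∀ x, Q (x + T) = Q x) (hRT : ∀ x, R (x + T) = R x)
    {C M s : ℝ} (hC : 0 ≤ C) (hap : APriori A κ C) (hPs : ∀ x, ‖P x‖ ≤ s) (hQs : ∀ x, ‖Q x‖ ≤ s)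
    (hRM : ∀ x, ‖R x‖ ≤ M) (hs : C * (s * (1 + 2 * (2 * C * M))) ≤ 1 / 2) :
    ∃ W : ℝ → Matrix ι κ ℂ,
      (∀ x, HasDerivAt W (A x * W x + (R x - (W x * P x + W x * Q x * W x))) x) ∧
      (∀ x, W (x + T) = W x) ∧ ∀ x, ‖W x‖ ≤ 2 * C * M := by
  have : CompleteSpace (Matrix ι κ ℂ) := FiniteDimensional.complete ℂ _
  have hs0 : 0 ≤ s := (norm_nonneg _).trans (hPs 0)
  have hM0 : 0 ≤ M := (norm_nonneg _).trans (hRM 0)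
  set r := 2 * C * M with hr
  have hr0 : 0 ≤ r := by positivity
  let E := {f : BoundedContinuousFunction ℝ (Matrix ι κ ℂ) //
    (∀ x, ‖f x‖ ≤ r) ∧ ∀ x, f (x + T) = f x}
  have hclosed : IsClosed {f : BoundedContinuousFunction ℝ (Matrix ι κ ℂ) |
      (∀ x, ‖f x‖ ≤ r) ∧ ∀ x, f (x + T) = f x} := by
    have hev : ∀ x, Continuous fun f : BoundedContinuousFunction ℝ (Matrix ι κ ℂ) => f x := fun x =>
      continuous_eval_const x
    rw [Set.ofPred_and, Set.ofPred_forall, Set.ofPred_forall]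
    exact (isClosed_iInter fun x => isClosed_le (hev x).norm continuous_const).inter
      (isClosed_iInter fun x => isClosed_eq (hev _) (hev _))
  have : CompleteSpace E := hclosed.completeSpace_coe
  have : Nonempty E := ⟨⟨0, fun x => by simpa using hr0, fun x => rfl⟩⟩
  have hstep : ∀ f : E, ∃ g : E, ∀ x, HasDerivAt g.1
      (A x * g.1 x + (R x - (f.1 x * P x + f.1 x * Q x * f.1 x))) x := by
    rintro ⟨f, hf, hfT⟩
    have hfc : Continuous f := f.continuous
    obtain ⟨W, hW, hWT⟩ := exists_periodic_solution hA hT hAT hap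
      (F := fun x => R x - (f x * P x + f x * Q x * f x))
      (hR.sub ((hfc.matrix_mul hP).add ((hfc.matrix_mul hQ).matrix_mul hfc)))
      (fun x => by rw [hRT, hfT, hPT, hQT])
    have hWc : Continuous W := continuous_iff_continuousAt.2 fun x => (hW x).continuousAt
    obtain ⟨B, hB⟩ := exists_bound_of_periodic hWc hT hWT
    have hWr : ∀ x, ‖W x‖ ≤ r := fun x => by
      have h1 := hap W _ B (M + s * (1 + r) * r) hW hB (fun x => by
        refine (norm_sub_le _ _).trans (add_le_add (hRM x) ?_)
        exact (norm_quadratic_le (hPs x) (hQs x) (hf x)).trans (by gcongr; exact hf x)) x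
      have h2 : C * (s * (1 + r)) ≤ 1 / 2 := le_trans (by gcongr; linarith) hs
      have h3 := mul_le_mul_of_nonneg_right h2 hr0
      rw [hr] at h1 h3 ⊢
      linarith
    exact ⟨⟨BoundedContinuousFunction.ofNormedAddCommGroup W hWc r hWr, hWr, hWT⟩, hW⟩
  choose Φ hΦ using hstep
  have hcon : ContractingWith (1 / 2) Φ := by
    refine ⟨by norm_num, LipschitzWith.of_dist_le_mul fun f g => ?_⟩
    have hd : 0 ≤ dist f g := dist_nonneg
    change dist (Φ f).1 (Φ g).1 ≤ _
    rw [BoundedContinuousFunction.dist_le (by positivity)]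
    intro x
    rw [dist_eq_norm]
    have h1 := hap (fun x => (Φ f).1 x - (Φ g).1 x)
      (fun x => (g.1 x * P x + g.1 x * Q x * g.1 x) - (f.1 x * P x + f.1 x * Q x * f.1 x))
      (r + r) (s * (1 + 2 * r) * dist f g)
      (fun x => ((hΦ f x).sub (hΦ g x)).congr_deriv (by rw [Matrix.mul_sub]; abel))
      (fun x => (norm_sub_le _ _).trans (add_le_add ((Φ f).2.1 x) ((Φ g).2.1 x)))
      (fun x => by
        refine (norm_quadratic_sub_le (hPs x) (hQs x) (g.2.1 x) (f.2.1 x)).trans ?_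
        gcongr
        rw [← dist_eq_norm, dist_comm]
        exact BoundedContinuousFunction.dist_coe_le_dist x) x
    refine h1.trans ?_
    have h2 := mul_le_mul_of_nonneg_right hs hd
    push_cast
    linarith
  set f := hcon.fixedPoint Φ
  have hf : Φ f = f := hcon.fixedPoint_isFixedPt
  refine ⟨f.1, fun x => ?_, f.2.2, f.2.1⟩
  have := hΦ f x
  rwa [hf] at this

/-- Localized forcing yields localized periodic solutions of the Riccati equation. -/
theorem riccati_localized {A : ℝ → Matrix ι ι ℂ} {P : ℝ → Matrix κ κ ℂ}
    {Q : ℝ → Matrix κ ι ℂ} {R W : ℝ → Matrix ι κ ℂ} {L : ℝ} (hL : 0 < L)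
    (hRT : ∀ x, R (x + 2 * L) = R x) {C M s r k : ℝ} (hap : APriori A κ C)
    (hPs : ∀ x, ‖P x‖ ≤ s) (hQs : ∀ x, ‖Q x‖ ≤ s) (hk : 0 ≤ k)
    (hRM : ∀ x, |x| ≤ L → ‖R x‖ ≤ M * Real.exp (-k * |x|))
    (hW : ∀ x, HasDerivAt W (A x * W x + (R x - (W x * P x + W x * Q x * W x))) x)
    (hWr : ∀ x, ‖W x‖ ≤ r) (hC : C * (k + s * (1 + r)) ≤ 1 / 2) {x : ℝ} (hx : |x| ≤ L) :
    ‖W x‖ ≤ 2 * C * (M * Real.exp k) * Real.exp (-(k / 2) * |x|) := by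
  have hs0 : 0 ≤ s := (norm_nonneg _).trans (hPs 0)
  have hr0 : 0 ≤ r := (norm_nonneg _).trans (hWr 0)
  obtain ⟨g, g', hg, hg0, hg', hgT, hgle, hgge⟩ := exists_periodic_weight hL hk
  have hgc : Continuous g := continuous_iff_continuousAt.2 fun x => (hg x).continuousAt
  obtain ⟨B, hB⟩ := exists_bound_of_periodic hgc (mul_pos two_pos hL).ne' hgT
  have hgR : ∀ x, g x * ‖R x‖ ≤ M * Real.exp k := fun x => by
    obtain ⟨y, j, hy, rfl⟩ := exists_mem_cell hL x
    have e1 : g (y + j * (2 * L)) = g y := Function.Periodic.int_mul hgT j y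
    have e2 : R (y + j * (2 * L)) = R y := Function.Periodic.int_mul hRT j y
    rw [e1, e2]
    calc g y * ‖R y‖ ≤ Real.exp (k * (1 + |y|)) * (M * Real.exp (-k * |y|)) :=
          mul_le_mul (hgle y) (hRM y hy) (norm_nonneg _) (Real.exp_pos _).le
      _ = M * (Real.exp (k * (1 + |y|)) * Real.exp (-k * |y|)) := by ring
      _ = M * Real.exp k := by rw [← Real.exp_add]; congr 2; ring
  have h := hap.weighted hk (by positivity : 0 ≤ s * (1 + r)) hC hW hg hg0 hg' (B := B * r)
    (δ := M * Real.exp k) (fun x => ?_) (fun x => ?_) x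
  · have h1 : Real.exp (k / 2 * |x|) * ‖W x‖ ≤ 2 * C * (M * Real.exp k) :=
      (mul_le_mul_of_nonneg_right (hgge x hx) (norm_nonneg _)).trans h
    rw [neg_mul, Real.exp_neg, ← div_eq_mul_inv, le_div_iff₀ (Real.exp_pos _), mul_comm]
    exact h1
  · rw [norm_smul]
    exact mul_le_mul (hB x) (hWr x) (norm_nonneg _) ((norm_nonneg _).trans (hB x))
  · rw [norm_smul, norm_smul, Real.norm_of_nonneg (hg0 x).le]
    have h1 := norm_sub_le (R x) (W x * P x + W x * Q x * W x)
    have h2 := norm_quadratic_le (hPs x) (hQs x) (hWr x)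
    have h3 := mul_le_mul_of_nonneg_left (h1.trans (add_le_add le_rfl h2)) (hg0 x).le
    linarith [hgR x]

end Riccati


/-! ### The Riccati transformation along the pulse -/

namespace PulseFamily

variable {m n : ℕ} {S : RDSystem m n} {F : PulseFamily m n}

theorem Bounds.base_periodic {Ls βs P ε : ℝ} (h : F.Bounds Ls βs P ε) (x : ℝ) :
    F.base ε (x + 2 * F.L ε) = F.base ε x := by
  have h1 := h.periodic x
  have hu : F.u ε (x + 2 * F.L ε) = F.u ε x := congrArg (fun z : Phase m n => z.1) h1
  have hv : F.v ε (x + 2 * F.L ε) = F.v ε x := congrArg (fun z : Phase m n => z.2.2.1) h1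
  rw [base, base, hu, hv]

theorem A11_eq (ε x : ℝ) (lam : ℂ) : F.A11 S ε x lam = Matrix.fromBlocks 0 (cx S.D₁inv)
    ((ε : ℂ) • (S.H₁U (F.base ε x) + lam • 1) + S.H₂U (F.base ε x)) 0 := rfl

theorem A12_eq (ε x : ℝ) : F.A12 S ε x = Matrix.fromBlocks 0 0
    ((ε : ℂ) • S.H₁V (F.base ε x) + S.H₂V (F.base ε x)) 0 := rfl

theorem A21_eq (ε x : ℝ) : F.A21 S ε x = Matrix.fromBlocks 0 0 (S.GU (F.base ε x)) 0 := rfl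

theorem A21lim_eq (x : ℝ) : F.A21lim S x = Matrix.fromBlocks 0 0 (S.GU (F.baseH x)) 0 := rfl

namespace Coeff

variable {K : Set (Fin m → ℝ)} {M βf ρ ε : ℝ}

theorem continuous_jet (h1 : S.S1) (h : F.Coeff S K M βf ρ ε) :
    Continuous fun x => S.jet (F.base ε x) :=
  h1.contDiffOn_jet.continuousOn.comp_continuous h.continuous_base h.mem

theorem continuous_A22 (h1 : S.S1) (h : F.Coeff S K M βf ρ ε) (lam : ℂ) :
    Continuous fun x => F.A22 S ε x lam :=
  S.continuous_fastBlock (h.continuous_jet h1).snd.fst lam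

theorem continuous_A21 (h1 : S.S1) (h : F.Coeff S K M βf ρ ε) :
    Continuous fun x => F.A21 S ε x :=
  continuous_const.matrix_fromBlocks continuous_const (h.continuous_jet h1).fst continuous_const

theorem continuous_A12 (h1 : S.S1) (h : F.Coeff S K M βf ρ ε) :
    Continuous fun x => F.A12 S ε x := by
  have hU : Continuous fun x => S.H₁V (F.base ε x) := (h.continuous_jet h1).snd.snd.snd.fst
  have hV : Continuous fun x => S.H₂V (F.base ε x) := (h.continuous_jet h1).snd.snd.snd.snd.snd
  have hsum : Continuous fun x => (ε : ℂ) • S.H₁V (F.base ε x) + S.H₂V (F.base ε x) :=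
    (hU.const_smul (ε : ℂ)).add hV
  exact continuous_const.matrix_fromBlocks continuous_const hsum continuous_const

theorem continuous_A11 (h1 : S.S1) (h : F.Coeff S K M βf ρ ε) (lam : ℂ) :
    Continuous fun x => F.A11 S ε x lam := by
  have hU : Continuous fun x => S.H₁U (F.base ε x) := (h.continuous_jet h1).snd.snd.fst
  have hV : Continuous fun x => S.H₂U (F.base ε x) := (h.continuous_jet h1).snd.snd.snd.snd.fst
  have hsum : Continuous fun x =>
      (ε : ℂ) • (S.H₁U (F.base ε x) + lam • 1) + S.H₂U (F.base ε x) :=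
    ((hU.add continuous_const).const_smul (ε : ℂ)).add hV
  exact continuous_const.matrix_fromBlocks continuous_const hsum continuous_const

theorem norm_smul_le {E : Type*} [NormedAddCommGroup E] [NormedSpace ℂ E] (hε : 0 < ε)
    (h : F.Coeff S K M βf ρ ε) (y : E) : ‖(ε : ℂ) • y‖ ≤ ‖y‖ := by
  rw [norm_smul, Complex.norm_real, Real.norm_of_nonneg hε.le]
  exact mul_le_of_le_one_left (norm_nonneg _) h.le_one

theorem norm_A11_le (hε : 0 < ε) (h : F.Coeff S K M βf ρ ε) (x : ℝ) (lam : ℂ) :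
    ‖F.A11 S ε x lam‖ ≤ ‖cx S.D₁inv‖ + (2 * M + ‖lam‖) := by
  have hj := h.jet_le x
  have h1 : ‖S.H₁U (F.base ε x)‖ ≤ M :=
    (norm_fst_le _).trans ((norm_snd_le _).trans ((norm_snd_le _).trans hj))
  have h2 : ‖S.H₂U (F.base ε x)‖ ≤ M := (norm_fst_le _).trans ((norm_snd_le _).trans
    ((norm_snd_le _).trans ((norm_snd_le _).trans ((norm_snd_le _).trans hj))))
  have h3 : ‖S.H₁U (F.base ε x) + lam • 1‖ ≤ M + ‖lam‖ := by
    refine (norm_add_le _ _).trans (add_le_add h1 ?_)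
    rw [norm_smul]
    exact mul_le_of_le_one_right (norm_nonneg _) norm_one_matrix_le
  rw [A11_eq]
  refine (norm_fromBlocks_antidiag_le _ _).trans (add_le_add le_rfl ((norm_add_le _ _).trans ?_))
  have h4 := h.norm_smul_le hε (S.H₁U (F.base ε x) + lam • 1)
  linarith

theorem norm_A12_le (hε : 0 < ε) (h : F.Coeff S K M βf ρ ε) (x : ℝ) :
    ‖F.A12 S ε x‖ ≤ 2 * M := by
  have hj := h.jet_le x
  have h1 : ‖S.H₁V (F.base ε x)‖ ≤ M := (norm_fst_le _).trans ((norm_snd_le _).trans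
    ((norm_snd_le _).trans ((norm_snd_le _).trans hj)))
  have h2 : ‖S.H₂V (F.base ε x)‖ ≤ M := (norm_snd_le _).trans ((norm_snd_le _).trans
    ((norm_snd_le _).trans ((norm_snd_le _).trans ((norm_snd_le _).trans hj))))
  rw [A12_eq]
  refine (norm_fromBlocks_lower_le _).trans ((norm_add_le _ _).trans ?_)
  have h4 := h.norm_smul_le hε (S.H₁V (F.base ε x))
  linarith

theorem norm_A21_le (h : F.Coeff S K M βf ρ ε) (x : ℝ) : ‖F.A21 S ε x‖ ≤ M * ‖F.v ε x‖ :=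
  (norm_fromBlocks_lower_le _).trans (h.GU_le x)

theorem norm_A21_le' (h : F.Coeff S K M βf ρ ε) (x : ℝ) : ‖F.A21 S ε x‖ ≤ M :=
  (norm_fromBlocks_lower_le _).trans ((norm_fst_le _).trans (h.jet_le x))

theorem norm_A21_sub_le (h : F.Coeff S K M βf ρ ε) {x : ℝ} (hx : x ∈ pulseRegion ρ ε) :
    ‖F.A21 S ε x - F.A21lim S x‖ ≤ M * ε ^ βf := by
  rw [A21_eq, A21lim_eq, fromBlocks_sub_fromBlocks]
  simp only [sub_self]
  exact (norm_fromBlocks_lower_le _).trans (h.GU_near x hx)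

theorem norm_A22_sub_le (h : F.Coeff S K M βf ρ ε) {x : ℝ} (hx : x ∈ pulseRegion ρ ε) (lam : ℂ) :
    ‖F.A22 S ε x lam - F.A22lim S lam x‖ ≤ M * ε ^ βf := by
  have := S.norm_fastBlock_sub_le (S.GV (F.base ε x)) (S.GV (F.baseH x)) lam lam
  rw [sub_self, norm_zero, add_zero] at this
  exact this.trans (h.GV_near x hx)

end Coeff

/-- `W` is a periodic solution of the Riccati equation that is exponentially localized on the
fundamental cell. -/
structure LocalizedRiccati (F : PulseFamily m n) (S : RDSystem m n) (C k ε : ℝ) (lam : ℂ)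
    (W : ℝ → Matrix (Fin n ⊕ Fin n) (Fin m ⊕ Fin m) ℂ) : Prop where
  solves : F.SolvesRiccati S W ε lam
  periodic : ∀ x, W (x + 2 * F.L ε) = W x
  localized : ∀ x, |x| ≤ F.L ε → ‖W x‖ ≤ C * Real.exp (-k * |x|)

namespace LocalizedRiccati

variable {C k ε : ℝ} {lam : ℂ} {W : ℝ → Matrix (Fin n ⊕ Fin n) (Fin m ⊕ Fin m) ℂ}

theorem norm_le (h : F.LocalizedRiccati S C k ε lam W) (hC : 0 ≤ C) (hk : 0 ≤ k)
    (hL : 0 < F.L ε) (x : ℝ) : ‖W x‖ ≤ C := by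
  obtain ⟨y, j, hy, rfl⟩ := exists_mem_cell hL x
  have e : W (y + j * (2 * F.L ε)) = W y := Function.Periodic.int_mul h.periodic j y
  rw [e]
  refine (h.localized y hy).trans (mul_le_of_le_one_right hC (Real.exp_le_one_iff.2 ?_))
  rw [neg_mul, neg_nonpos]
  positivity

theorem hasDerivAt (h : F.LocalizedRiccati S C k ε lam W) (x : ℝ) :
    HasDerivAt W (F.A22 S ε x lam * W x + (F.A21 S ε x - (W x * ((√ε : ℂ) • F.A11 S ε x lam)
      + W x * ((√ε : ℂ) • F.A12 S ε x) * W x))) x :=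
  (h.solves x).congr_deriv (by
    simp only [Matrix.mul_smul, Matrix.smul_mul]
    abel)

end LocalizedRiccati

theorem norm_sqrt_smul_le {E : Type*} [NormedAddCommGroup E] [NormedSpace ℂ E] (ε : ℝ) {y : E}
    {N : ℝ} (h : ‖y‖ ≤ N) : ‖(√ε : ℂ) • y‖ ≤ √ε * N := by
  rw [norm_smul, Complex.norm_real, Real.norm_of_nonneg (Real.sqrt_nonneg _)]
  gcongr

/-- The uniform constants of the Riccati transformation. -/
structure Uniform (F : PulseFamily m n) (S : RDSystem m n) (K : Set (Fin m → ℝ)) (Ω : Set ℂ)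
    (M Ls βs P N C C₁ k βf ρ ε : ℝ) : Prop where
  coeff : F.Coeff S K M βf ρ ε
  bounds : F.Bounds Ls βs P ε
  apriori : ∀ lam ∈ Ω, APriori (fun x => F.A22 S ε x lam) (Fin m ⊕ Fin m) C
  slow_le : ∀ lam ∈ Ω, ∀ x, ‖(√ε : ℂ) • F.A11 S ε x lam‖ ≤ √ε * N ∧
    ‖(√ε : ℂ) • F.A12 S ε x‖ ≤ √ε * N
  riccati : ∀ lam ∈ Ω, ∃ W, F.LocalizedRiccati S C₁ k ε lam W

theorem S3.exists_uniform (h1 : S.S1) (h : F.S3 S) {K : Set (Fin m → ℝ)}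
    (hK : F.IsSlowCompactum S K) {βf ρ : ℝ} (hrate : F.IsPulseRate S βf ρ) {Lam₀ Lam : ℝ}
    (hgap : S.SpectralGap K Lam₀) (hLam : Lam ∈ Ioo (-Lam₀) 0) {δ : ℝ} (hδ : 0 < δ) (ω : ℝ)
    {ϖ : ℝ} (hϖ : ϖ ∈ Ioo (Real.pi / 2) Real.pi) :
    ∃ M Ls βs P N C C₁ k : ℝ, 0 ≤ M ∧ 0 ≤ Ls ∧ 0 ≤ N ∧ 0 ≤ C ∧ 0 < C₁ ∧ 0 < k ∧ k ≤ βs ∧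
      (∀ x, ‖S.GV (F.baseH x)‖ ≤ M ∧ ‖S.GU (F.baseH x)‖ ≤ M * ‖F.vh x‖ ∧
        ‖F.vh x‖ ≤ Ls * Real.exp (-βs * |x|)) ∧
      ∀ᶠ ε in 𝓝[>] (0 : ℝ),
        F.Uniform S K (region F S ω ϖ Lam δ) M Ls βs P N C C₁ k βf ρ ε := by
  obtain ⟨M, hM, hco, hMx⟩ := h.exists_coeff h1 hK hrate
  obtain ⟨Ls, hLs, βs, hβs, P, hP, hbd, -⟩ := h.exists_bounds
  obtain ⟨Rlam, hRlam⟩ := exists_bound_regionZero ω Lam hϖ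
  obtain ⟨C, hC, hap⟩ := h.exists_uniform_apriori h1 hK hrate hgap hLam hδ ω hϖ (Fin m ⊕ Fin m)
  have hdec := h.homoclinic_le h1 hbd
  set N := ‖cx S.D₁inv‖ + (2 * M + |Rlam|) with hN
  have hN0 : 0 ≤ N := by positivity
  -- The smallness budget `1/2` is split: `C k ≤ 1/4` for the weight and `1/4` for the terms
  -- carrying `√ε`. Taking `k ≤ βs` ensures that the forcing decays at rate `k`.
  set k := min βs (1 / (4 * (C + 1))) with hk
  have hk0 : 0 < k := by positivity
  have hkβ : k ≤ βs := min_le_left _ _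
  have hCk : C * k ≤ 1 / 4 := by
    have h2 : C * k ≤ C * (1 / (4 * (C + 1))) := by gcongr; exact min_le_right _ _
    refine h2.trans ?_
    rw [mul_one_div, div_le_div_iff₀ (by positivity) (by norm_num)]
    linarith
  have hsm : ∀ᶠ ε in 𝓝[>] (0 : ℝ), C * (√ε * N * (1 + 2 * (2 * C * M))) ≤ 1 / 4 := by
    have : Tendsto (fun ε : ℝ => C * (√ε * N * (1 + 2 * (2 * C * M)))) (𝓝[>] 0)
        (𝓝 (C * (√0 * N * (1 + 2 * (2 * C * M))))) :=
      (Continuous.tendsto (by fun_prop) 0).mono_left nhdsWithin_le_nhds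
    exact this.eventually_le_const (by simp)
  -- The constant is that of `riccati_localized`, with `1` added to make it positive; the rate `k /
  -- 2` reflects the loss in the periodic weight.
  refine ⟨M, Ls, βs, P, N, C, 2 * C * (M * Ls * Real.exp k) + 1, k / 2, hM, hLs.le, hN0, hC,
    by positivity, by positivity, by linarith, fun x => ⟨(hMx x).1, (hMx x).2, (hdec x).1⟩, ?_⟩
  filter_upwards [hco, hbd, hap, hsm] with ε hco hbd hap hsm
  have hε := hbd.pos
  have hL : 0 < F.L ε := by linarith [hbd.one_le_L]
  have hslow : ∀ lam ∈ region F S ω ϖ Lam δ, ∀ x, ‖(√ε : ℂ) • F.A11 S ε x lam‖ ≤ √ε * N ∧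
      ‖(√ε : ℂ) • F.A12 S ε x‖ ≤ √ε * N := fun lam hlam x => by
    have h2 := (hRlam lam hlam.1).trans (le_abs_self _)
    refine ⟨norm_sqrt_smul_le ε ((hco.norm_A11_le hε x lam).trans (by rw [hN]; gcongr)),
      norm_sqrt_smul_le ε ((hco.norm_A12_le hε x).trans ?_)⟩
    have := norm_nonneg (cx S.D₁inv)
    have := abs_nonneg Rlam
    rw [hN]; linarith
  refine ⟨hco, hbd, hap, hslow, fun lam hlam => ?_⟩
  have hb := hbd.base_periodic
  obtain ⟨W, hW, hWT, hWr⟩ := exists_periodic_riccati (κ := Fin m ⊕ Fin m)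
    (A := fun x => F.A22 S ε x lam) (P := fun x => (√ε : ℂ) • F.A11 S ε x lam)
    (Q := fun x => (√ε : ℂ) • F.A12 S ε x) (R := fun x => F.A21 S ε x)
    (hco.continuous_A22 h1 lam) ((hco.continuous_A11 h1 lam).const_smul (√ε : ℂ))
    ((hco.continuous_A12 h1).const_smul (√ε : ℂ)) (hco.continuous_A21 h1) (mul_pos two_pos hL).ne'
    (fun x => by rw [A22_eq, A22_eq, hb]) (fun x => by rw [A11_eq, A11_eq, hb])
    (fun x => by rw [A12_eq, A12_eq, hb]) (fun x => by rw [A21_eq, A21_eq, hb]) hC (hap lam hlam)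
    (fun x => (hslow lam hlam x).1) (fun x => (hslow lam hlam x).2) hco.norm_A21_le'
    (by linarith)
  refine ⟨W, fun x => (hW x).congr_deriv ?_, hWT, fun x hx => ?_⟩
  · simp only [Matrix.mul_smul, Matrix.smul_mul]
    abel
  · refine (riccati_localized hL (fun x => by rw [A21_eq, A21_eq, hb]) (M := M * Ls) (k := k)
      (hap lam hlam) (fun x => (hslow lam hlam x).1) (fun x => (hslow lam hlam x).2) hk0.le
      (fun y hy => ?_) hW hWr ?_ hx).trans ?_
    · refine (hco.norm_A21_le y).trans ?_
      rw [mul_assoc]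
      gcongr
      refine (hbd.v_le' hy).trans ?_
      have h5 := mul_le_mul_of_nonneg_right hkβ (abs_nonneg y)
      gcongr Ls * Real.exp ?_
      linarith
    · have h3 : C * (√ε * N * (1 + 2 * C * M)) ≤ C * (√ε * N * (1 + 2 * (2 * C * M))) := by
        have h4 : 0 ≤ 2 * C * M := by positivity
        have h5 : 1 + 2 * C * M ≤ 1 + 2 * (2 * C * M) := by linarith
        exact mul_le_mul_of_nonneg_left (mul_le_mul_of_nonneg_left h5 (by positivity)) hC
      rw [mul_add]
      linarith
    · gcongr
      linarith

end PulseFamily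


/-! ### The inhomogeneous fast limit problem -/

/-- A stretched exponential in `1/ε` beats every power of `ε`; the cube is what the tail estimate
needs. -/
theorem eventually_mul_exp_rpow_le {k ρ : ℝ} (hk : 0 < k) (hρ : 0 < ρ) (B : ℝ) :
    ∀ᶠ ε in 𝓝[>] (0 : ℝ), B * Real.exp (-k * ε ^ (-ρ)) ≤ ε ^ 3 := by
  have h1 := ((tendsto_rpow_mul_exp_neg_mul_atTop_nhds_zero (3 / ρ) k hk).comp
    (tendsto_rpow_neg_nhdsGT_zero (neg_lt_zero.2 hρ))).const_mul B
  rw [mul_zero] at h1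
  filter_upwards [h1.eventually_le_const one_pos, eventually_mem_nhdsWithin] with ε h2 hε
  have hε : 0 < ε := hε
  have h3 : (ε ^ (-ρ)) ^ (3 / ρ) = (ε ^ 3)⁻¹ := by
    rw [← Real.rpow_mul hε.le, ← Real.rpow_natCast ε 3, ← Real.rpow_neg hε.le]
    congr 1
    push_cast
    field_simp
  simp only [Function.comp_apply] at h2
  rw [h3] at h2
  have h4 : 0 < ε ^ 3 := by positivity
  have h5 : ε ^ 3 * (B * ((ε ^ 3)⁻¹ * Real.exp (-k * ε ^ (-ρ)))) ≤ ε ^ 3 * 1 := by gcongr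
  have h6 : ε ^ 3 * (B * ((ε ^ 3)⁻¹ * Real.exp (-k * ε ^ (-ρ))))
      = B * Real.exp (-k * ε ^ (-ρ)) := by
    field_simp
  linarith

/-- What matters is that the derivative bound `Θ` does not depend on the plateau length, which grows
like `1/ε` in the application. -/
theorem exists_cutoff : ∃ Θ, 0 ≤ Θ ∧ ∀ L : ℝ, ∃ χ χ' : ℝ → ℝ, (∀ x, HasDerivAt χ (χ' x) x) ∧
    (∀ x, 0 ≤ χ x ∧ χ x ≤ 1) ∧ (∀ x, |x| ≤ L → χ x = 1) ∧ (∀ x, L + 1 ≤ |x| → χ x = 0) ∧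
    (∀ x, |χ' x| ≤ Θ) ∧ ∀ x, ¬ (L ≤ |x| ∧ |x| ≤ L + 1) → χ' x = 0 := by
  obtain ⟨θ, θ', hθ, -, hθ0, hθ1, hθb, hθ', Θ, hΘ⟩ := exists_smooth_step
  have hΘ0 : 0 ≤ Θ := (abs_nonneg _).trans (hΘ 0)
  refine ⟨Θ + Θ, by positivity, fun L => ⟨fun x => θ (L + 1 - x) * θ (L + 1 + x),
    fun x => -θ' (L + 1 - x) * θ (L + 1 + x) + θ (L + 1 - x) * θ' (L + 1 + x), fun x => ?_,
    fun x => ?_, fun x hx => ?_, fun x hx => ?_, fun x => ?_, fun x hx => ?_⟩⟩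
  · have h1 : HasDerivAt (fun x => θ (L + 1 - x)) (-θ' (L + 1 - x)) x :=
      (hθ _).comp_const_sub (L + 1) x
    have h2 : HasDerivAt (fun x => θ (L + 1 + x)) (θ' (L + 1 + x)) x :=
      (hθ _).comp_const_add (L + 1) x
    exact h1.mul h2
  · exact ⟨mul_nonneg (hθb _).1 (hθb _).1, mul_le_one₀ (hθb _).2 (hθb _).1 (hθb _).2⟩
  · have h := abs_le.1 hx
    change θ (L + 1 - x) * θ (L + 1 + x) = 1
    rw [hθ1 _ (by linarith), hθ1 _ (by linarith), mul_one]
  · change θ (L + 1 - x) * θ (L + 1 + x) = 0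
    rcases le_abs.1 hx with h | h
    · rw [hθ0 _ (by linarith), zero_mul]
    · rw [hθ0 (L + 1 + x) (by linarith), mul_zero]
  · refine (abs_add_le _ _).trans (add_le_add ?_ ?_)
    · rw [abs_mul, abs_neg, abs_of_nonneg (hθb _).1]
      exact (mul_le_of_le_one_right (abs_nonneg _) (hθb _).2).trans (hΘ _)
    · rw [abs_mul, abs_of_nonneg (hθb _).1]
      exact (mul_le_of_le_one_left (abs_nonneg _) (hθb _).2).trans (hΘ _)
  · change -θ' (L + 1 - x) * θ (L + 1 + x) + θ (L + 1 - x) * θ' (L + 1 + x) = 0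
    rcases lt_or_ge |x| L with h | h
    · have h2 := abs_lt.1 h
      rw [hθ' (L + 1 - x) fun h3 => by linarith [h3.2], hθ' (L + 1 + x) fun h3 => by
        linarith [h3.2]]
      ring
    · have h3 : L + 1 < |x| := by
        by_contra h4
        exact hx ⟨h, not_lt.1 h4⟩
      rcases lt_abs.1 h3 with h4 | h4
      · rw [hθ' (L + 1 - x) fun h5 => by linarith [h5.1], hθ0 (L + 1 - x) (by linarith)]
        ring
      · rw [hθ' (L + 1 + x) fun h5 => by linarith [h5.1], hθ0 (L + 1 + x) (by linarith)]
        ring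

namespace PulseFamily

variable {m n : ℕ} {S : RDSystem m n} {F : PulseFamily m n}

theorem S3.continuous_A21lim (h1 : S.S1) (h : F.S3 S) : Continuous (F.A21lim S) :=
  continuous_const.matrix_fromBlocks continuous_const
    ((continuousOn_GU h1).comp_continuous h.continuous_baseH (h.baseH_mem h1)) continuous_const

/-- Covers points outside the pulse region and points near the end of the cell; `L - 1` accounts for
periodic images of the cut-off layer. Both lengths are at least of the order of a negative power of
`ε`, since `ε L` has a positive limit. -/
theorem S3.exists_exp_min_le (h : F.S3 S) {k ρ : ℝ} (hk : 0 < k) (hρ : 0 < ρ) :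
    ∀ᶠ ε in 𝓝[>] (0 : ℝ), Real.exp (-k * min (ε ^ (-ρ)) (F.L ε - 1)) ≤ ε ^ 3 := by
  filter_upwards [eventually_mul_exp_rpow_le hk hρ 1,
    eventually_mul_exp_rpow_le (mul_pos hk (half_pos h.Lc₀_pos)) one_pos (Real.exp k),
    h.period.eventually_const_lt (half_lt_self h.Lc₀_pos), eventually_mem_nhdsWithin]
    with ε h2 h3 h4 hε
  have hε : 0 < ε := hε
  rcases min_choice (ε ^ (-ρ)) (F.L ε - 1) with h5 | h5
  · rw [h5]; linarith
  · rw [h5]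
    refine le_trans ?_ h3
    rw [← Real.exp_add, Real.exp_le_exp, Real.rpow_neg hε.le, Real.rpow_one]
    have h6 : F.Lc₀ / 2 * ε⁻¹ ≤ F.L ε := by
      rw [← div_eq_mul_inv, div_le_iff₀ hε]; linarith
    have h7 := mul_le_mul_of_nonneg_left h6 hk.le
    linarith

/-- The solution is a limit, along an ultrafilter finer than `ε ↓ 0`, of the localized Riccati
solutions: the linear and quadratic slow terms carry `√ε` and disappear, while the localization
estimate passes to the limit. -/
theorem S3.exists_fastInhom (h1 : S.S1) (h : F.S3 S) {K : Set (Fin m → ℝ)} {Ω : Set ℂ}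
    {M Ls βs P N C C₁ k βf ρ : ℝ} (hβ : 0 < βf) (hρ : 0 < ρ) (hC₁ : 0 ≤ C₁) (hk : 0 ≤ k)
    (hu : ∀ᶠ ε in 𝓝[>] (0 : ℝ), F.Uniform S K Ω M Ls βs P N C C₁ k βf ρ ε) {lam : ℂ}
    (hlam : lam ∈ Ω) : ∃ X, F.SolvesFastInhom S lam X ∧
      ∀ x, ‖X x‖ ≤ C₁ * Real.exp (-k * |x|) := by
  have hch : ∀ ε, ∃ W, F.Uniform S K Ω M Ls βs P N C C₁ k βf ρ ε →
      F.LocalizedRiccati S C₁ k ε lam W := fun ε => by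
    by_cases hε : F.Uniform S K Ω M Ls βs P N C C₁ k βf ρ ε
    · obtain ⟨W, hW⟩ := hε.riccati lam hlam
      exact ⟨W, fun _ => hW⟩
    · exact ⟨0, fun h' => absurd h' hε⟩
  choose W hW using hch
  set l : Ultrafilter ℝ := Ultrafilter.of (𝓝[>] (0 : ℝ)) with hl
  have hle : (l : Filter ℝ) ≤ 𝓝[>] (0 : ℝ) := Ultrafilter.of_le _
  have hreg : ∀ R, ∀ᶠ ε in 𝓝[>] (0 : ℝ), ∀ x, |x| ≤ R → x ∈ pulseRegion ρ ε := fun R => by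
    filter_upwards [(tendsto_rpow_neg_nhdsGT_zero (neg_lt_zero.2 hρ)).eventually_ge_atTop R]
      with ε hε x hx
    exact abs_le.1 (hx.trans hε)
  have hAk : LocUnif l (fun ε x => F.A22 S ε x lam) (F.A22lim S lam) := by
    intro R t ht
    refine Eventually.filter_mono hle ?_
    filter_upwards [hu, hreg R, eventually_mul_rpow_lt (c := M) hβ ht] with ε hu hreg hs x hx
    exact (hu.coeff.norm_A22_sub_le (hreg x hx) lam).trans hs.le
  have hFk : LocUnif l (fun ε x => F.A21 S ε x - (W ε x * ((√ε : ℂ) • F.A11 S ε x lam)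
      + W ε x * ((√ε : ℂ) • F.A12 S ε x) * W ε x)) (F.A21lim S) := by
    intro R t ht
    refine Eventually.filter_mono hle ?_
    have ht1 : Tendsto (fun ε : ℝ => √ε * N * (1 + C₁) * C₁) (𝓝[>] 0)
        (𝓝 (√0 * N * (1 + C₁) * C₁)) :=
      (Continuous.tendsto (by fun_prop) 0).mono_left nhdsWithin_le_nhds
    rw [Real.sqrt_zero, zero_mul, zero_mul, zero_mul] at ht1
    filter_upwards [hu, hreg R, eventually_mul_rpow_lt (c := M) hβ (half_pos ht),
      ht1.eventually_le_const (half_pos ht)] with ε hu hreg hs hs2 x hx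
    have hL : 0 < F.L ε := by linarith [hu.bounds.one_le_L]
    have h2 := hu.coeff.norm_A21_sub_le (hreg x hx)
    have hWx := (hW ε hu).norm_le hC₁ hk hL x
    have h3 := norm_quadratic_le (hu.slow_le lam hlam x).1 (hu.slow_le lam hlam x).2 hWx
    have hN : 0 ≤ √ε * N := (norm_nonneg _).trans (hu.slow_le lam hlam x).1
    have h4 : √ε * N * (1 + C₁) * ‖W ε x‖ ≤ √ε * N * (1 + C₁) * C₁ := by gcongr
    rw [sub_right_comm]
    refine (norm_sub_le _ _).trans ?_
    linarith
  obtain ⟨X, hX, hlim⟩ := exists_ultralimit_solution (h.continuous_A22lim h1 lam) hAk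
    (h.continuous_A21lim h1) hFk (Wk := W) (B := C₁)
    (Eventually.filter_mono hle (hu.mono fun ε hε => (hW ε hε).hasDerivAt))
    (Eventually.filter_mono hle (hu.mono fun ε hε =>
      (hW ε hε).norm_le hC₁ hk (by linarith [hε.bounds.one_le_L]) 0))
  refine ⟨X, hX, fun x => le_of_tendsto (hlim x).norm (Eventually.filter_mono hle ?_)⟩
  filter_upwards [hu, h.tendsto_L.eventually_ge_atTop |x|] with ε hε hL
  exact (hW ε hε).localized x hL

/-- `W` is periodic while `X` decays, so they are compared only after a cut-off at the cell
boundary. The truncated difference solves the fast system with forcing `O(ε^βf)`, and the a priori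
estimate applies. Inside the pulse region the forcing is small because the coefficients are close;
outside it, because `X`, `v` and `v_h` are exponentially small. The slow terms contribute `√ε`,
which is where `βf ≤ 1/4` is more than enough. -/
theorem S3.exists_norm_sub_le (h : F.S3 S) {K : Set (Fin m → ℝ)} {Ω : Set ℂ}
    {M Ls βs P N C C₁ k βf ρ : ℝ} (hrate : F.IsPulseRate S βf ρ) (hM : 0 ≤ M) (hLs : 0 ≤ Ls)
    (hN : 0 ≤ N) (hC₁ : 0 ≤ C₁) (hk : 0 < k) (hkβ : k ≤ βs)
    (hlim : ∀ x, ‖S.GV (F.baseH x)‖ ≤ M ∧ ‖S.GU (F.baseH x)‖ ≤ M * ‖F.vh x‖ ∧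
        ‖F.vh x‖ ≤ Ls * Real.exp (-βs * |x|))
    (hu : ∀ᶠ ε in 𝓝[>] (0 : ℝ), F.Uniform S K Ω M Ls βs P N C C₁ k βf ρ ε) :
    ∃ C₂, ∀ᶠ ε in 𝓝[>] (0 : ℝ), ∀ lam ∈ Ω, ∀ W X, F.LocalizedRiccati S C₁ k ε lam W →
      F.SolvesFastInhom S lam X → (∀ x, ‖X x‖ ≤ C₁ * Real.exp (-k * |x|)) →
      ∀ x, |x| ≤ F.L ε → ‖W x - X x‖ ≤ C₂ * ε ^ βf := by
  obtain ⟨hβ0, hβ1, hρ, -⟩ := hrate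
  obtain ⟨Θ, hΘ, hcut⟩ := exists_cutoff
  set B := 2 * M * C₁ + (M + 2 * M * Ls) + N * (1 + C₁) * C₁ with hB
  refine ⟨C * (B + Θ * (2 * C₁)), ?_⟩
  filter_upwards [hu, h.exists_exp_min_le hk hρ] with ε hu hE lam hlam W X hW hX hXk x hx
  have hε := hu.bounds.pos
  have hL1 := hu.bounds.one_le_L
  have hL : 0 < F.L ε := by linarith
  set E := Real.exp (-k * min (ε ^ (-ρ)) (F.L ε - 1)) with hEdef
  have hmin0 : 0 ≤ min (ε ^ (-ρ)) (F.L ε - 1) := le_min (by positivity) (by linarith)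
  have hβp : 0 ≤ ε ^ βf := by positivity
  have hEβ : E ≤ ε ^ βf := by
    refine hE.trans ?_
    rw [← Real.rpow_natCast]
    exact rpow_le_of_le hε hu.coeff.le_one (by push_cast; linarith)
  have hsq : √ε ≤ ε ^ βf := by
    rw [Real.sqrt_eq_rpow]
    exact rpow_le_of_le hε hu.coeff.le_one (by linarith)
  have hexp : ∀ {s b : ℝ}, k ≤ b → min (ε ^ (-ρ)) (F.L ε - 1) ≤ s →
      Real.exp (-b * s) ≤ ε ^ βf := by
    intro s b hb hs
    refine le_trans (Real.exp_le_exp.2 ?_) hEβ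
    have h2 := mul_le_mul hb hs hmin0 (hk.le.trans hb)
    linarith
  have hW1 : ∀ y, ‖W y‖ ≤ C₁ := hW.norm_le hC₁ hk.le hL
  have hX1 : ∀ y, ‖X y‖ ≤ C₁ := fun y =>
    (hXk y).trans (mul_le_of_le_one_right hC₁ (Real.exp_le_one_iff.2 (by
      rw [neg_mul, neg_nonpos]; positivity)))
  obtain ⟨χ, χ', hχ, hχb, hχ1, hχ0, hχ'b, hχ'0⟩ := hcut (F.L ε)
  set Fd := fun y => (F.A22 S ε y lam - F.A22lim S lam y) * X y + ((F.A21 S ε y - F.A21lim S y)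
    - (W y * ((√ε : ℂ) • F.A11 S ε y lam) + W y * ((√ε : ℂ) • F.A12 S ε y) * W y)) with hFd
  have hFdle : ∀ y, |y| ≤ F.L ε + 1 → ‖Fd y‖ ≤ B * ε ^ βf := by
    intro y hy
    have hq : ‖W y * ((√ε : ℂ) • F.A11 S ε y lam) + W y * ((√ε : ℂ) • F.A12 S ε y) * W y‖
        ≤ N * (1 + C₁) * C₁ * ε ^ βf := by
      refine (norm_quadratic_le (hu.slow_le lam hlam y).1 (hu.slow_le lam hlam y).2
        (hW1 y)).trans ?_
      calc √ε * N * (1 + C₁) * ‖W y‖ ≤ ε ^ βf * N * (1 + C₁) * C₁ := by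
            gcongr
            exact hW1 y
        _ = _ := by ring
    have hmain : ‖(F.A22 S ε y lam - F.A22lim S lam y) * X y‖ ≤ 2 * M * C₁ * ε ^ βf ∧
        ‖F.A21 S ε y - F.A21lim S y‖ ≤ (M + 2 * M * Ls) * ε ^ βf := by
      by_cases hyr : y ∈ pulseRegion ρ ε
      · constructor
        · refine (Matrix.linfty_opNorm_mul _ _).trans ?_
          have h2 := mul_le_mul (hu.coeff.norm_A22_sub_le hyr lam) (hX1 y) (norm_nonneg _)
            (by positivity)
          have h3 : 0 ≤ M * ε ^ βf * C₁ := by positivity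
          linarith
        · have h3 : 0 ≤ 2 * M * Ls * ε ^ βf := by positivity
          linarith [hu.coeff.norm_A21_sub_le hyr]
      · have hyρ : ε ^ (-ρ) ≤ |y| := by
          by_contra h4
          exact hyr (abs_le.1 (not_le.1 h4).le)
        have hmy : min (ε ^ (-ρ)) (F.L ε - 1) ≤ |y| := (min_le_left _ _).trans hyρ
        constructor
        · refine (Matrix.linfty_opNorm_mul _ _).trans ?_
          have h2 : ‖F.A22 S ε y lam - F.A22lim S lam y‖ ≤ 2 * M := by
            have h3 := S.norm_fastBlock_sub_le (S.GV (F.base ε y)) (S.GV (F.baseH y)) lam lam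
            rw [sub_self, norm_zero, add_zero, ← A22_eq, ← A22lim_eq] at h3
            have h4 : ‖S.GV (F.base ε y)‖ ≤ M :=
              (norm_fst_le _).trans ((norm_snd_le _).trans (hu.coeff.jet_le y))
            linarith [norm_sub_le (S.GV (F.base ε y)) (S.GV (F.baseH y)), (hlim y).1]
          have h5 : ‖X y‖ ≤ C₁ * ε ^ βf := (hXk y).trans (by gcongr; exact hexp le_rfl hmy)
          have h6 := mul_le_mul h2 h5 (norm_nonneg _) (by positivity)
          linarith
        · have h2 : ‖F.v ε y‖ ≤ Ls * ε ^ βf := by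
            refine (hu.bounds.v_le y (by linarith)).trans ?_
            gcongr
            refine hexp hkβ (le_min hmy ((min_le_right _ _).trans (by linarith)))
          have h3 : ‖F.vh y‖ ≤ Ls * ε ^ βf := (hlim y).2.2.trans (by gcongr; exact hexp hkβ hmy)
          have h4 : ‖F.A21lim S y‖ ≤ M * ‖F.vh y‖ :=
            (norm_fromBlocks_lower_le _).trans (hlim y).2.1
          have h5 := hu.coeff.norm_A21_le y
          have h6 := mul_le_mul_of_nonneg_left h2 hM
          have h7 := mul_le_mul_of_nonneg_left h3 hM
          have h8 : 0 ≤ M * ε ^ βf := by positivity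
          linarith [norm_sub_le (F.A21 S ε y) (F.A21lim S y)]
    have h9 := norm_add_le ((F.A22 S ε y lam - F.A22lim S lam y) * X y)
      ((F.A21 S ε y - F.A21lim S y)
        - (W y * ((√ε : ℂ) • F.A11 S ε y lam) + W y * ((√ε : ℂ) • F.A12 S ε y) * W y))
    have h10 := norm_sub_le (F.A21 S ε y - F.A21lim S y)
      (W y * ((√ε : ℂ) • F.A11 S ε y lam) + W y * ((√ε : ℂ) • F.A12 S ε y) * W y)
    have h11 : B * ε ^ βf = 2 * M * C₁ * ε ^ βf + (M + 2 * M * Ls) * ε ^ βf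
      + N * (1 + C₁) * C₁ * ε ^ βf := by rw [hB]; ring
    rw [h11]
    linarith [hmain.1, hmain.2]
  -- In the cut-off layer `W` is evaluated through its periodic image in the cell, at distance at
  -- least `L - 1` from the origin, so both functions are small there and `χ'` does no harm.
  have hWend : ∀ y, F.L ε ≤ |y| → |y| ≤ F.L ε + 1 → ‖W y - X y‖ ≤ 2 * C₁ * ε ^ βf := by
    intro y hy1 hy2
    have h2 : ‖X y‖ ≤ C₁ * ε ^ βf := (hXk y).trans (by
      gcongr; exact hexp le_rfl ((min_le_right _ _).trans (by linarith)))
    obtain ⟨z, hz, hz1, hz2⟩ : ∃ z, W y = W z ∧ F.L ε - 1 ≤ |z| ∧ |z| ≤ F.L ε := by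
      rcases le_total 0 y with h0 | h0
      · rw [abs_of_nonneg h0] at hy1 hy2
        refine ⟨y - 2 * F.L ε, ?_, ?_, ?_⟩
        · have := hW.periodic (y - 2 * F.L ε)
          rwa [sub_add_cancel] at this
        · rw [abs_of_nonpos (by linarith)]; linarith
        · rw [abs_of_nonpos (by linarith)]; linarith
      · rw [abs_of_nonpos h0] at hy1 hy2
        refine ⟨y + 2 * F.L ε, (hW.periodic y).symm, ?_, ?_⟩
        · rw [abs_of_nonneg (by linarith)]; linarith
        · rw [abs_of_nonneg (by linarith)]; linarith
    have h3 : ‖W y‖ ≤ C₁ * ε ^ βf := by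
      rw [hz]
      refine (hW.localized z hz2).trans ?_
      gcongr
      exact hexp le_rfl ((min_le_right _ _).trans hz1)
    linarith [norm_sub_le (W y) (X y)]
  have key := hu.apriori lam hlam (fun y => χ y • (W y - X y))
    (fun y => χ y • Fd y + χ' y • (W y - X y)) (2 * C₁) ((B + Θ * (2 * C₁)) * ε ^ βf)
    (fun y => ((hχ y).smul ((hW.hasDerivAt y).sub (hX y))).congr_deriv ?_)
    (fun y => ?_) (fun y => ?_) x
  · rw [hχ1 x hx, one_smul, ← mul_assoc] at key
    exact key
  · have e : F.A22 S ε y lam * W y + (F.A21 S ε y - (W y * ((√ε : ℂ) • F.A11 S ε y lam)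
        + W y * ((√ε : ℂ) • F.A12 S ε y) * W y)) - (F.A22lim S lam y * X y + F.A21lim S y)
        = F.A22 S ε y lam * (W y - X y) + Fd y := by
      simp only [hFd, Matrix.mul_sub, Matrix.sub_mul]
      abel
    change χ y • _ + χ' y • (W y - X y)
      = F.A22 S ε y lam * (χ y • (W y - X y)) + (χ y • Fd y + χ' y • (W y - X y))
    rw [e, Matrix.mul_smul, smul_add, add_assoc]
  · rw [norm_smul, Real.norm_of_nonneg (hχb y).1]
    refine (mul_le_of_le_one_left (norm_nonneg _) (hχb y).2).trans ?_
    linarith [norm_sub_le (W y) (X y), hW1 y, hX1 y]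
  · rw [add_mul]
    refine (norm_add_le _ _).trans (add_le_add ?_ ?_)
    · rcases le_total |y| (F.L ε + 1) with h2 | h2
      · rw [norm_smul, Real.norm_of_nonneg (hχb y).1]
        exact (mul_le_of_le_one_left (norm_nonneg _) (hχb y).2).trans (hFdle y h2)
      · rw [hχ0 y h2, zero_smul, norm_zero]
        positivity
    · by_cases h2 : F.L ε ≤ |y| ∧ |y| ≤ F.L ε + 1
      · rw [norm_smul, Real.norm_eq_abs, mul_assoc]
        exact mul_le_mul (hχ'b y) (hWend y h2.1 h2.2) (norm_nonneg _) hΘ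
      · rw [hχ'0 y h2, zero_smul, norm_zero]
        positivity

end PulseFamily


/-! ### Factorization of the Evans function -/

namespace PulseFamily

variable {m n : ℕ} {S : RDSystem m n} {F : PulseFamily m n}

theorem LocalizedRiccati.factorization (h1 : S.S1) {K : Set (Fin m → ℝ)} {M βf ρ C k ε : ℝ}
    (hco : F.Coeff S K M βf ρ ε) {lam : ℂ} {W : ℝ → Matrix (Fin n ⊕ Fin n) (Fin m ⊕ Fin m) ℂ}
    (hW : F.LocalizedRiccati S C k ε lam W) :
    IsEvolution (F.fullCoeff S ε lam) (evolution (F.fullCoeff S ε lam)) ∧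
    IsEvolution (F.slowCoeff S W ε lam) (evolution (F.slowCoeff S W ε lam)) ∧
    IsEvolution (F.fastCoeff S W ε lam) (evolution (F.fastCoeff S W ε lam)) ∧
    ∀ γ : ℂ, F.evans S ε lam γ = floquetDet (F.slowCoeff S W ε lam) (F.L ε) γ *
      floquetDet (F.fastCoeff S W ε lam) (F.L ε) γ := by
  have hWc : Continuous W := continuous_iff_continuousAt.2 fun x => (hW.solves x).continuousAt
  have h₁₁ : Continuous fun x => (√ε : ℂ) • F.A11 S ε x lam :=
    (hco.continuous_A11 h1 lam).const_smul (√ε : ℂ)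
  have h₁₂ : Continuous fun x => (√ε : ℂ) • F.A12 S ε x :=
    (hco.continuous_A12 h1).const_smul (√ε : ℂ)
  have h₂₁ := hco.continuous_A21 h1
  have h₂₂ := hco.continuous_A22 h1 lam
  have es : F.slowCoeff S W ε lam = fun x => (√ε : ℂ) • F.A11 S ε x lam
      + ((√ε : ℂ) • F.A12 S ε x) * W x := funext fun x => by
    rw [slowCoeff, smul_add, Matrix.smul_mul]
  have ef : F.fastCoeff S W ε lam = fun x => F.A22 S ε x lam
      - W x * ((√ε : ℂ) • F.A12 S ε x) := funext fun x => by
    rw [fastCoeff, Matrix.mul_smul]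
  have hs : Continuous (F.slowCoeff S W ε lam) := by
    rw [es]; exact h₁₁.add (h₁₂.matrix_mul hWc)
  have hf : Continuous (F.fastCoeff S W ε lam) := by
    rw [ef]; exact h₂₂.sub (hWc.matrix_mul h₁₂)
  refine ⟨isEvolution_evolution (h₁₁.matrix_fromBlocks h₁₂ h₂₁ h₂₂), isEvolution_evolution hs,
    isEvolution_evolution hf, fun γ => ?_⟩
  rw [es, ef]
  refine floquetDet_fromBlocks h₁₁ h₁₂ h₂₁ h₂₂ (fun x => (hW.solves x).congr_deriv ?_) ?_ γ
  · simp only [Matrix.mul_smul, Matrix.smul_mul]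
  · have := hW.periodic (-F.L ε)
    rw [← this]
    congr 1
    ring

/-- The difference of two bounded solutions solves the homogeneous fast limit problem, which has no
nonzero bounded solution off the zeros. -/
theorem S3.isXin (h1 : S.S1) (h : F.S3 S) {K : Set (Fin m → ℝ)} (hK : F.IsSlowCompactum S K)
    {βf ρ : ℝ} (hrate : F.IsPulseRate S βf ρ) {Lam₀ Lam : ℝ} (hgap : S.SpectralGap K Lam₀)
    (hLam : Lam ∈ Ioo (-Lam₀) 0) {lam : ℂ} (hlam : Lam ≤ lam.re) (hz : lam ∉ F.fastZeros S Lam)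
    {X : ℝ → Matrix (Fin n ⊕ Fin n) (Fin m ⊕ Fin m) ℂ} (hX : F.SolvesFastInhom S lam X) {C k : ℝ}
    (hC : 0 < C) (hk : 0 < k) (hXk : ∀ x, ‖X x‖ ≤ C * Real.exp (-k * |x|)) :
    F.IsXin S lam X := by
  refine ⟨hX, ⟨C, hC, k, hk, hXk⟩, fun Y hY ⟨B, hB⟩ => ?_⟩
  have hX1 : ∀ x, ‖X x‖ ≤ C := fun x =>
    (hXk x).trans (mul_le_of_le_one_right hC.le (Real.exp_le_one_iff.2 (by
      rw [neg_mul, neg_nonpos]; positivity)))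
  have h0 := h.eq_zero_of_bounded h1 hK hrate hgap hLam hlam hz (W := fun x => Y x - X x)
    (fun x => ((hY x).sub (hX x)).congr_deriv (by rw [Matrix.mul_sub]; abel)) (B := B + C)
    fun x => (norm_sub_le _ _).trans (add_le_add (hB x) (hX1 x))
  exact funext fun x => sub_eq_zero.1 (congrFun h0 x)

end PulseFamily

end EvansRiccati

/-! ### Assembly of the theorem. -/

theorem mainTheorem5 {m n : ℕ} (hm : 0 < m) (hn : 0 < n)
    (S : EvansRiccati.RDSystem m n) (F : EvansRiccati.PulseFamily m n)
    (hS1 : S.S1) (hS2 : S.S2) (hS3 : F.S3 S) :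
    (∃ K, F.IsSlowCompactum S K) ∧
    (∀ K, F.IsSlowCompactum S K → ∃ Lam₀ > 0, S.SpectralGap K Lam₀) ∧
    (∃ βf ρ, F.IsPulseRate S βf ρ) ∧
    ∀ K, F.IsSlowCompactum S K → ∀ Lam₀ > 0, S.SpectralGap K Lam₀ →
    ∀ Lam ∈ Set.Ioo (-Lam₀) 0, ∀ δ > 0,
    ∀ ω > 0, ∀ ϖ ∈ Set.Ioo (Real.pi / 2) Real.pi,
    ∀ βf ρ, F.IsPulseRate S βf ρ →
    ∃ Xin : ℝ → ℂ → Matrix (Fin n ⊕ Fin n) (Fin m ⊕ Fin m) ℂ,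
      (∀ lam ∈ EvansRiccati.region F S ω ϖ Lam δ, F.IsXin S lam (fun x => Xin x lam)) ∧
    ∃ ε₀ > 0, ∃ U : ℝ → ℝ → ℂ → Matrix (Fin n ⊕ Fin n) (Fin m ⊕ Fin m) ℂ,
      (∀ ε ∈ Set.Ioo 0 ε₀, ∀ lam ∈ EvansRiccati.region F S ω ϖ Lam δ,
        F.SolvesRiccati S (fun x => U ε x lam) ε lam ∧
        EvansRiccati.IsEvolution (F.fullCoeff S ε lam)
          (EvansRiccati.evolution (F.fullCoeff S ε lam)) ∧
        EvansRiccati.IsEvolution (F.slowCoeff S (fun x => U ε x lam) ε lam)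
          (EvansRiccati.evolution (F.slowCoeff S (fun x => U ε x lam) ε lam)) ∧
        EvansRiccati.IsEvolution (F.fastCoeff S (fun x => U ε x lam) ε lam)
          (EvansRiccati.evolution (F.fastCoeff S (fun x => U ε x lam) ε lam)) ∧
        ∀ γ : ℂ, F.evans S ε lam γ =
          EvansRiccati.floquetDet (F.slowCoeff S (fun x => U ε x lam) ε lam) (F.L ε) γ *
          EvansRiccati.floquetDet (F.fastCoeff S (fun x => U ε x lam) ε lam) (F.L ε) γ) ∧
      (∃ C : ℝ, ∀ ε ∈ Set.Ioo 0 ε₀, ∀ lam ∈ EvansRiccati.region F S ω ϖ Lam δ, ∀ x,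
        ‖U ε x lam‖ ≤ C) ∧
      (∀ ε ∈ Set.Ioo 0 ε₀, ∀ lam ∈ EvansRiccati.region F S ω ϖ Lam δ, ∀ x,
        U ε (x + 2 * F.L ε) lam = U ε x lam) ∧
      (∃ C : ℝ, ∀ ε ∈ Set.Ioo 0 ε₀, ∀ lam ∈ EvansRiccati.region F S ω ϖ Lam δ,
        ∀ x ∈ Set.Icc (-F.L ε) (F.L ε), ‖U ε x lam - Xin x lam‖ ≤ C * ε ^ βf) ∧
      (∃ C : ℝ, ∀ ε ∈ Set.Ioo 0 ε₀, ∀ lam ∈ EvansRiccati.region F S ω ϖ Lam δ,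
        ∀ x ∈ Set.Icc (-F.L ε) (F.L ε) \ EvansRiccati.PulseFamily.pulseRegion ρ ε,
          ‖U ε x lam‖ ≤ C * ε ^ 3) := by
  refine ⟨hS3.exists_slowCompactum hS1,
    fun K hK => EvansRiccati.RDSystem.exists_spectralGap hS1 hS2 hK.1 hK.2.1,
    hS3.exists_pulseRate hS1, ?_⟩
  intro K hK Lam₀ _ hgap Lam hLam δ hδ ω _ ϖ hϖ βf ρ hrate
  obtain ⟨M, Ls, βs, P, N, C, C₁, k, hM, hLs, hN, -, hC₁, hk, hkβ, hlim, hu⟩ :=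
    hS3.exists_uniform hS1 hK hrate hgap hLam hδ ω hϖ
  obtain ⟨C₂, hsub⟩ := hS3.exists_norm_sub_le hrate hM hLs hN hC₁.le hk hkβ hlim hu
  have hX : ∀ lam, ∃ X, lam ∈ EvansRiccati.region F S ω ϖ Lam δ → F.SolvesFastInhom S lam X ∧
      ∀ x, ‖X x‖ ≤ C₁ * Real.exp (-k * |x|) := fun lam => by
    by_cases hlam : lam ∈ EvansRiccati.region F S ω ϖ Lam δ
    · obtain ⟨X, hX⟩ := hS3.exists_fastInhom hS1 hrate.1 hrate.2.2.1 hC₁.le hk.le hu hlam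
      exact ⟨X, fun _ => hX⟩
    · exact ⟨0, fun h => absurd h hlam⟩
  choose X hX using hX
  refine ⟨fun x lam => X lam x, fun lam hlam => ?_, ?_⟩
  · obtain ⟨hre, hz⟩ := EvansRiccati.PulseFamily.not_mem_fastZeros_of_tendsto hδ
      (l := atTop) (lam := fun _ : ℕ => lam) (fun _ => hlam) tendsto_const_nhds
    exact hS3.isXin hS1 hK hrate hgap hLam hre hz (hX lam hlam).1 hC₁ hk (hX lam hlam).2
  obtain ⟨ε₀, hε₀, hev⟩ := mem_nhdsGT_iff_exists_Ioo_subset.1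
    (hu.and (hsub.and (hS3.exists_exp_min_le hk hrate.2.2.1)))
  have hW : ∀ ε lam, ∃ W, ε ∈ Set.Ioo 0 ε₀ → lam ∈ EvansRiccati.region F S ω ϖ Lam δ →
      F.LocalizedRiccati S C₁ k ε lam W := fun ε lam => by
    by_cases h : ε ∈ Set.Ioo 0 ε₀ ∧ lam ∈ EvansRiccati.region F S ω ϖ Lam δ
    · obtain ⟨W, hW⟩ := (hev h.1).1.riccati lam h.2
      exact ⟨W, fun _ _ => hW⟩
    · exact ⟨0, fun h2 h3 => absurd ⟨h2, h3⟩ h⟩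
  choose W hW using hW
  refine ⟨ε₀, hε₀, fun ε x lam => W ε lam x, fun ε hε lam hlam => ⟨(hW ε lam hε hlam).solves,
    (hW ε lam hε hlam).factorization hS1 (hev hε).1.coeff⟩, ⟨C₁, fun ε hε lam hlam x => ?_⟩,
    fun ε hε lam hlam => (hW ε lam hε hlam).periodic, ⟨C₂, fun ε hε lam hlam x hx => ?_⟩,
    ⟨C₁, fun ε hε lam hlam x hx => ?_⟩⟩
  · have := (hev hε).1.bounds.one_le_L
    exact (hW ε lam hε hlam).norm_le hC₁.le hk.le (by linarith) x
  · exact (hev hε).2.1 lam hlam _ _ (hW ε lam hε hlam) (hX lam hlam).1 (hX lam hlam).2 x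
      (abs_le.2 hx)
  · refine ((hW ε lam hε hlam).localized x (abs_le.2 hx.1)).trans
      (mul_le_mul_of_nonneg_left (le_trans (Real.exp_le_exp.2 ?_) (hev hε).2.2) hC₁.le)
    have h1 : min (ε ^ (-ρ)) (F.L ε - 1) ≤ |x| := (min_le_left _ _).trans (by
      by_contra h2
      exact hx.2 (abs_le.1 (not_le.1 h2).le))
    have h2 := mul_le_mul_of_nonneg_left h1 hk.le
    linarith
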